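/- Let $m\ge 1$ be an integer. Write $\|\cdot\|_2$ for the norm of $\mathcal L^2([0,1])$ and $\mathcal W^{m,2}([0,1])$ for the space of functions $f:[0,1]\to\mathbb R$ such that $f,f',\dots,f^{(m-1)}$ exist and are absolutely continuous and $\|f^{(m)}\|_2<\infty$. For $\lambda>0$ put $\|f\|_{m,\lambda}^2=\|f\|_2^2+\lambda\|f^{(m)}\|_2^2$. Let $f_o\in\mathcal W^{m,2}([0,1])$, let $t_{1n},\dots,t_{nn}\in[0,1]$ be non-random design points, let $\epsilon_1,\epsilon_2,\dots$ be independent, identically distributed random variables, and let $Y_i=f_o(t_{in})+\epsilon_i$ $(i=1,\dots,n)$. Assume: (A1) $\rho:\mathbb R\to\mathbb R$ is convex and $\psi:\mathbb R\to\mathbb R$ is any choice of its subgradient; (A2) $\lim_{t\to0}\mathbb E\{\psi(\epsilon_1+t)-\psi(\epsilon_1)\}^2=0$; (A3) $\mathbb E\{|\psi(\epsilon_1)|^2\}<\infty$, $\mathbb E\{\psi(\epsilon_1)\}=0$, and there is a constant $\xi>0$ with $\mathbb E\{\psi(\epsilon_1+t)\}=\xi t+o(|t|)$ as $t\to0$;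 (A4) there is a constant $C$ such that $\left|\frac1n\sum_{i=1}^n f(t_{in})-\int_0^1 f(t)\,dt\right|\le\frac{C}{n}\|f'\|_2$ for all $n\ge2$ and all $f\in\mathcal W^{1,2}([0,1])$. Let $\lambda=\lambda_n>0$ be non-random with $\lambda_n\asymp n^{-2m/(2m+1)}$. Call $(\widehat f_n)_{n\ge m}$ a sequence of M-type smoothing splines if each $\widehat f_n$ minimizes $$\frac1n\sum_{i=1}^n\rho(Y_i-f(t_{in}))+\lambda_n\|f^{(m)}\|_2^2$$ over $f\in\mathcal W^{m,2}([0,1])$. Then there exists a sequence of M-type smoothing splines such that $$\|\widehat f_n-f_o\|_{m,\lambda_n}^2=O_P\left(\lambda_n+(n\lambda_n^{1/(2m)})^{-1}\right),\qquad(*)$$ and every sequence of M-type smoothing splines that satisfies $(*)$ also satisfies $$\|\widehat f_n^{(j)}-f_o^{(j)}\|_2^2=O_P\left(n^{-2(m-j)/(2m+1)}\right),\qquad j=1,\dots,m-1,$$ and $(\widehat f_n^{(m)})_{n\ge m}$ is tight in the $\mathcal L^2([0,1])$ norm, in the sense of being bounded in probability: for every $\delta>0$ there is $K$ with $\Pr(\|\widehat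 f_n^{(m)}\|_2>K)\le\delta$ for all $n\ge m$. (For events that are not measurable, probabilities are outer probabilities.) -/

import Mathlib

open MeasureTheory ProbabilityTheory Filter Topology Asymptotics

noncomputable section

/-- The `j`-th derivative of `f` on `[0,1]` (one-sided at the end points).  It depends only on the
values of `f` on `[0,1]`.  For a function in the Sobolev space of order `m`, it is the classical
derivative if `j < m`, and the almost everywhere derivative of `f^{(m-1)}` if `j = m`. -/
def unitDeriv (j : ℕ) (f : ℝ → ℝ) : ℝ → ℝ :=
  iteratedDerivWithin j f (Set.Icc 0 1)

/-- Membership in the Hilbert-Sobolev space `W^{m,2}([0,1])`, for `m ≥ 1`: the derivatives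
`f, f', …, f^{(m-1)}` exist and are continuous on `[0,1]`, the last one is absolutely continuous
(the lower ones are so automatically), and `f^{(m)}` is square integrable on `[0,1]`. -/
def MemSobolev (m : ℕ) (f : ℝ → ℝ) : Prop :=
  ContDiffOn ℝ ((m - 1 : ℕ) : ℕ∞) f (Set.Icc 0 1) ∧
    AbsolutelyContinuousOnInterval (unitDeriv (m - 1) f) 0 1 ∧
    MemLp (unitDeriv m f) 2 (volume.restrict (Set.Icc 0 1))

/-- The squared norm of `L²([0,1])`. -/
def l2NormSq (f : ℝ → ℝ) : ℝ :=
  ∫ x in (0 : ℝ)..1, f x ^ 2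

/-- The squared norm `‖f‖²_{m,lam} = ‖f‖² + lam ‖f^{(m)}‖²` of `W^{m,2}([0,1])`. -/
def sobolevNormSq (m : ℕ) (lam : ℝ) (f : ℝ → ℝ) : ℝ :=
  l2NormSq f + lam * l2NormSq (unitDeriv m f)

/-- The penalized empirical loss at `f`, with loss function `ρ`, smoothing parameter `lam`,
design points `t` and responses `y`. -/
def penalizedLoss (m : ℕ) (ρ : ℝ → ℝ) (lam : ℝ) {n : ℕ} (t y : Fin n → ℝ) (f : ℝ → ℝ) : ℝ :=
  (1 / (n : ℝ)) * ∑ i, ρ (y i - f (t i)) + lam * l2NormSq (unitDeriv m f)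

/-- `f` is an M-type smoothing spline: it minimizes the penalized empirical loss over
`W^{m,2}([0,1])`. -/
def IsMTypeSpline (m : ℕ) (ρ : ℝ → ℝ) (lam : ℝ) {n : ℕ} (t y : Fin n → ℝ) (f : ℝ → ℝ) : Prop :=
  MemSobolev m f ∧
    ∀ g : ℝ → ℝ, MemSobolev m g → penalizedLoss m ρ lam t y f ≤ penalizedLoss m ρ lam t y g

/-- `ψ` is a choice of the subgradient of `ρ`. -/
def IsSubgradientSelection (ρ ψ : ℝ → ℝ) : Prop :=
  ∀ x y : ℝ, ρ x + ψ x * (y - x) ≤ ρ y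

/-- Quasi-uniformity of a triangular array of design points. -/
def IsQuasiUniform (t : (n : ℕ) → Fin n → ℝ) : Prop :=
  ∃ C : ℝ, ∀ n : ℕ, 2 ≤ n → ∀ f : ℝ → ℝ, MemSobolev 1 f →
    |(1 / (n : ℝ)) * ∑ i, f (t n i) - ∫ x in (0 : ℝ)..1, f x| ≤
      C / n * Real.sqrt (l2NormSq (unitDeriv 1 f))

/-- `X n = O_P(r n)` as `n → ∞`, for nonnegative `r`. Outer probabilities are understood for sets
that are not measurable. -/
def IsBigOInProb {Ω : Type*} [MeasurableSpace Ω] (μ : Measure Ω) (X : ℕ → Ω → ℝ) (r : ℕ → ℝ) :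
    Prop :=
  ∀ δ : ℝ, 0 < δ → ∃ K : ℝ, 0 < K ∧ ∀ᶠ n in atTop,
    μ {ω | K * r n < |X n ω|} ≤ ENNReal.ofReal δ

/-- Tightness, with respect to the norm of `L²([0,1])`, of the family `X n`, `n ≥ n₀`: it is
bounded in probability, i.e. up to arbitrarily small probability, all members lie in a common ball
of `L²([0,1])`. -/
def IsTightL2 {Ω : Type*} [MeasurableSpace Ω] (μ : Measure Ω) (n₀ : ℕ) (X : ℕ → Ω → ℝ → ℝ) :
    Prop :=
  ∀ δ : ℝ, 0 < δ → ∃ K : ℝ, 0 < K ∧ ∀ n, n₀ ≤ n →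
    μ {ω | K < Real.sqrt (l2NormSq (X n ω))} ≤ ENNReal.ofReal δ

end

noncomputable section

/-! ### Functions that are absolutely continuous on an interval -/

/-! Write `b = λ^{1/(2m)}`, so that `λ = b^{2m}` and `b ≍ n^{-1/(2m+1)}`, and put `R = λ + 1/(nb)`.
The basic rate in fact holds for every sequence of minimizers. Since the penalized loss is convex,
it suffices that, with high probability, it exceeds its value at `f₀` on the whole sphere `‖g‖_{m,λ}
= τ = K√R` around `f₀` (`sobolevNormSq_sub_le_of_sphere`). With the remainder `r(e,u) = ρ(e-u) -
ρ(e) + ψ(e)u`, the excess empirical loss at `f₀ + g` splits into the mean of `r`, its centred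
fluctuation and the linear noise term `Σ ψ(ε_i) g(t_i)`.

The mean of `r` is at least `(ξ/8)u²` for small `u` (`exists_le_integral_lossRemainder`). It can be
used because `R/b → 0` makes `g` uniformly small on the sphere, and a quasi-uniform design compares
the empirical norm with the `L²` norm (`exists_l2NormSq_le_empirical`). The noise term is handled by
duality (`exists_gram`): point evaluations are controlled by a positive semidefinite matrix `G` with
diagonal `O(1/b)`, so the supremum over the sphere is at most `τ √(zᵀGz)` with `z_i = ψ(ε_i)`, and
the expectation of `zᵀGz` is `E ψ² · tr G`.

For the fluctuation, `r(e,·)` is Lipschitz on `[-η,η]` with constant `D(e) = ψ(e+η) - ψ(e-η)`.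
Symmetrization and contraction replace it by a linear process with multipliers of second moment at
most `4 E D²` (`integral_finMax_centered_le`, tensorized in `integral_finMax_sum_le`), for which the
same Gram bound gives the expected supremum without chaining. By (A2) `E D²` is as small as desired
for small `η`, so the fluctuation is a small fraction of `n τ²` (`measure_exists_lt_le`, combined in
`measure_lt_sobolevNormSq_sub_le`).

Derivative rates follow from the interpolation inequality `b^{2j}‖g^{(j)}‖² ≤ C‖g‖²_{m,λ}`
(`exists_l2NormSq_unitDeriv_le`), tightness from `R = O(λ)`. Both this inequality and the Gram
matrix rest on one local integral representation of `g^{(j)}(x)` through `g` and `g^{(m)}`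
(`exists_local_kernel`). Minimizers exist because (A3) forces `ρ` to grow linearly, and because only
the values at the design points and the norm of `g^{(m)}` enter the loss
(`exists_forall_le_comp_add_norm_sq`). -/

theorem AbsolutelyContinuousOnInterval.congr_on_uIcc {f g : ℝ → ℝ} {a b : ℝ}
    (hf : AbsolutelyContinuousOnInterval f a b) (hfg : Set.EqOn f g (Set.uIcc a b)) :
    AbsolutelyContinuousOnInterval g a b := by
  rw [absolutelyContinuousOnInterval_iff] at hf ⊢
  intro ε hε
  obtain ⟨δ, hδ, h⟩ := hf ε hε
  refine ⟨δ, hδ, fun E hE hsum => ?_⟩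
  refine lt_of_eq_of_lt (Finset.sum_congr rfl fun i hi => ?_) (h E hE hsum)
  obtain ⟨h1, h2⟩ := hE.1 i hi
  rw [hfg h1, hfg h2]

theorem ae_ne_real (c : ℝ) : ∀ᵐ x : ℝ, x ≠ c := by
  simp [ae_iff, measure_singleton]

theorem ae_Icc_mem_Ioo : ∀ᵐ x : ℝ, x ∈ Set.Icc (0 : ℝ) 1 → x ∈ Set.Ioo (0 : ℝ) 1 := by
  filter_upwards [ae_ne_real 0, ae_ne_real 1] with x h0 h1 hx
  exact ⟨lt_of_le_of_ne hx.1 (Ne.symm h0), lt_of_le_of_ne hx.2 h1⟩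

theorem derivWithin_eq_deriv_of_mem_Ioo (F : ℝ → ℝ) {x : ℝ} (hx : x ∈ Set.Ioo (0 : ℝ) 1) :
    derivWithin F (Set.Icc 0 1) x = deriv F x :=
  derivWithin_of_mem_nhds (Icc_mem_nhds hx.1 hx.2)

theorem unitDeriv_succ (j : ℕ) (f : ℝ → ℝ) :
    unitDeriv (j + 1) f = derivWithin (unitDeriv j f) (Set.Icc 0 1) := by
  simp only [unitDeriv]
  exact iteratedDerivWithin_succ

theorem unitDeriv_zero (f : ℝ → ℝ) : unitDeriv 0 f = f := by
  simp [unitDeriv]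

theorem uniqueDiffOn_unitInterval : UniqueDiffOn ℝ (Set.Icc (0 : ℝ) 1) :=
  uniqueDiffOn_Icc one_pos

theorem uIcc_subset_unit {x y : ℝ} (hx : x ∈ Set.Icc (0 : ℝ) 1) (hy : y ∈ Set.Icc (0 : ℝ) 1) :
    Set.uIcc x y ⊆ Set.Icc (0 : ℝ) 1 := Set.uIcc_subset_Icc hx hy

theorem memLp_two_of_continuousOn_unit {f : ℝ → ℝ} (hf : ContinuousOn f (Set.Icc 0 1)) :
    MemLp f 2 (volume.restrict (Set.Icc (0 : ℝ) 1)) := by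
  obtain ⟨C, hC⟩ := isCompact_Icc.exists_bound_of_continuousOn hf
  exact MemLp.of_bound (hf.aestronglyMeasurable measurableSet_Icc) C
    ((ae_restrict_iff' measurableSet_Icc).2 (Eventually.of_forall hC))

theorem intervalIntegrable_of_memLp_unit {f : ℝ → ℝ}
    (hf : MemLp f 2 (volume.restrict (Set.Icc (0 : ℝ) 1))) :
    IntervalIntegrable f volume 0 1 := by
  rw [intervalIntegrable_iff_integrableOn_Icc_of_le zero_le_one]
  exact hf.integrable (by norm_num)

namespace MemSobolev

variable {m : ℕ} {f g : ℝ → ℝ}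

theorem absolutelyContinuous (hf : MemSobolev m f) {j : ℕ} (hj : j < m) :
    AbsolutelyContinuousOnInterval (unitDeriv j f) 0 1 := by
  rcases Nat.lt_or_ge j (m - 1) with h | h
  · have h1 : ContDiffOn ℝ ((j + 1 : ℕ) : ℕ∞) f (Set.Icc 0 1) := hf.1.of_le (by exact_mod_cast h)
    have h2 := (contDiffOn_nat_succ_iff_contDiffOn_one_iteratedDerivWithin
      uniqueDiffOn_unitInterval).1 (by exact_mod_cast h1)
    refine ContDiffOn.absolutelyContinuousOnInterval ?_
    rw [Set.uIcc_of_le zero_le_one]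
    exact h2.2
  · have : j = m - 1 := by omega
    rw [this]; exact hf.2.1

theorem continuousOn (hf : MemSobolev m f) {j : ℕ} (hj : j < m) :
    ContinuousOn (unitDeriv j f) (Set.Icc 0 1) := by
  simpa [Set.uIcc_of_le (zero_le_one' ℝ)] using (hf.absolutelyContinuous hj).continuousOn

theorem memLp (hf : MemSobolev m f) {j : ℕ} (hj : j ≤ m) :
    MemLp (unitDeriv j f) 2 (volume.restrict (Set.Icc (0 : ℝ) 1)) := by
  rcases Nat.lt_or_ge j m with h | h
  · exact memLp_two_of_continuousOn_unit (hf.continuousOn h)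
  · have : j = m := le_antisymm hj h
    rw [this]; exact hf.2.2

theorem intervalIntegrable (hf : MemSobolev m f) {j : ℕ} (hj : j ≤ m) :
    IntervalIntegrable (unitDeriv j f) volume 0 1 :=
  intervalIntegrable_of_memLp_unit (hf.memLp hj)

theorem ae_hasDerivAt (hf : MemSobolev m f) {j : ℕ} (hj : j < m) :
    ∀ᵐ x : ℝ, x ∈ Set.Icc (0 : ℝ) 1 →
      HasDerivAt (unitDeriv j f) (unitDeriv (j + 1) f x) x := by
  filter_upwards [ae_Icc_mem_Ioo, (hf.absolutelyContinuous hj).ae_differentiableAt] with x h1 h2 hx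
  rw [unitDeriv_succ, derivWithin_eq_deriv_of_mem_Ioo _ (h1 hx)]
  exact (h2 (by simpa [Set.uIcc_of_le (zero_le_one' ℝ)] using hx)).hasDerivAt

theorem integral_unitDeriv_succ (hf : MemSobolev m f) {j : ℕ} (hj : j < m) {x y : ℝ}
    (hx : x ∈ Set.Icc (0 : ℝ) 1) (hy : y ∈ Set.Icc (0 : ℝ) 1) :
    ∫ s in x..y, unitDeriv (j + 1) f s = unitDeriv j f y - unitDeriv j f x := by
  have hsub := uIcc_subset_unit hx hy
  rw [← ((hf.absolutelyContinuous hj).mono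
    (by rwa [Set.uIcc_of_le (zero_le_one' ℝ)] : Set.uIcc x y ⊆ _)).integral_deriv_eq_sub]
  refine intervalIntegral.integral_congr_ae ?_
  filter_upwards [hf.ae_hasDerivAt hj] with s hs hs'
  exact ((hs (hsub (Set.uIoc_subset_uIcc hs'))).deriv).symm

end MemSobolev

/-! ### A criterion for membership in the Sobolev space -/

section Builder

variable {m : ℕ} {F : ℕ → ℝ → ℝ}

/-- Descending induction, with `k` counting down from the top order: an integrable `F (j + 1)` has
an absolutely continuous primitive `F j`, which is continuous and hence integrable in turn. -/
theorem primitive_chain_absolutelyContinuous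
    (hF : ∀ j < m, ∀ x ∈ Set.Icc (0 : ℝ) 1, F j x = F j 0 + ∫ s in (0 : ℝ)..x, F (j + 1) s)
    (hm : MemLp (F m) 2 (volume.restrict (Set.Icc (0 : ℝ) 1))) :
    ∀ k, ∀ j, j + k + 1 = m → AbsolutelyContinuousOnInterval (F j) 0 1 := by
  have key : ∀ j < m, IntervalIntegrable (F (j + 1)) volume 0 1 →
      AbsolutelyContinuousOnInterval (F j) 0 1 := by
    intro j hj hint
    have h1 := hint.absolutelyContinuousOnInterval_intervalIntegral (c := 0) (by simp)
    have h2 : AbsolutelyContinuousOnInterval (fun _ : ℝ => F j 0) 0 1 :=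
      ContDiffOn.absolutelyContinuousOnInterval contDiffOn_const
    refine (h2.add h1).congr_on_uIcc fun x hx => ?_
    rw [Set.uIcc_of_le zero_le_one] at hx
    exact (hF j hj x hx).symm
  intro k
  induction k with
  | zero =>
    intro j hj
    refine key j (by omega) ?_
    have : j + 1 = m := by omega
    rw [this]
    exact intervalIntegrable_of_memLp_unit hm
  | succ k ih =>
    intro j hj
    exact key j (by omega) (ih (j + 1) (by omega)).continuousOn.intervalIntegrable

theorem primitive_chain_hasDerivWithinAt
    (hF : ∀ j < m, ∀ x ∈ Set.Icc (0 : ℝ) 1, F j x = F j 0 + ∫ s in (0 : ℝ)..x, F (j + 1) s)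
    (hm : MemLp (F m) 2 (volume.restrict (Set.Icc (0 : ℝ) 1))) {j : ℕ} (hj : j + 1 < m)
    {x : ℝ} (hx : x ∈ Set.Icc (0 : ℝ) 1) :
    HasDerivWithinAt (F j) (F (j + 1) x) (Set.Icc 0 1) x := by
  have hc : ContinuousOn (F (j + 1)) (Set.Icc 0 1) := by
    simpa [Set.uIcc_of_le (zero_le_one' ℝ)] using
      (primitive_chain_absolutelyContinuous hF hm (m - j - 2) (j + 1) (by omega)).continuousOn
  -- Instance for the fundamental theorem of calculus along neighbourhoods within `Icc 0 1`, which
  -- covers the end points.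
  have : Fact (x ∈ Set.Icc (0 : ℝ) 1) := ⟨hx⟩
  have h1 : HasDerivWithinAt (fun u => ∫ s in (0 : ℝ)..u, F (j + 1) s) (F (j + 1) x)
      (Set.Icc 0 1) x := by
    apply intervalIntegral.integral_hasDerivWithinAt_right
    · exact (hc.mono (Set.Icc_subset_Icc le_rfl hx.2)).intervalIntegrable_of_Icc hx.1
    · exact hc.stronglyMeasurableAtFilter_nhdsWithin measurableSet_Icc x
    · exact hc.continuousWithinAt hx
  exact (h1.const_add (F j 0)).congr (fun y hy => hF j (by omega) y hy) (hF j (by omega) x hx)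

theorem unitDeriv_eqOn_of_primitive_chain {f : ℝ → ℝ}
    (hF : ∀ j < m, ∀ x ∈ Set.Icc (0 : ℝ) 1, F j x = F j 0 + ∫ s in (0 : ℝ)..x, F (j + 1) s)
    (hm : MemLp (F m) 2 (volume.restrict (Set.Icc (0 : ℝ) 1)))
    (hf : Set.EqOn f (F 0) (Set.Icc 0 1)) :
    ∀ j < m, Set.EqOn (unitDeriv j f) (F j) (Set.Icc 0 1) := by
  intro j
  induction j with
  | zero => intro _; rw [unitDeriv_zero]; exact hf
  | succ j ih =>
    intro hj x hx
    rw [unitDeriv_succ, derivWithin_congr (ih (by omega)) (ih (by omega) hx)]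
    exact (primitive_chain_hasDerivWithinAt hF hm hj hx).derivWithin
      (uniqueDiffOn_unitInterval x hx)

/-- At the top order the integrand is merely integrable, so Lebesgue differentiation yields the
derivative only almost everywhere. -/
theorem unitDeriv_ae_eq_of_primitive_chain {f : ℝ → ℝ} (h1m : 1 ≤ m)
    (hF : ∀ j < m, ∀ x ∈ Set.Icc (0 : ℝ) 1, F j x = F j 0 + ∫ s in (0 : ℝ)..x, F (j + 1) s)
    (hm : MemLp (F m) 2 (volume.restrict (Set.Icc (0 : ℝ) 1)))
    (hf : Set.EqOn f (F 0) (Set.Icc 0 1)) :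
    unitDeriv m f =ᵐ[volume.restrict (Set.Icc (0 : ℝ) 1)] F m := by
  obtain ⟨k, rfl⟩ : ∃ k, m = k + 1 := ⟨m - 1, by omega⟩
  have hint := intervalIntegrable_of_memLp_unit hm
  refine (ae_restrict_iff' measurableSet_Icc).2 ?_
  filter_upwards [hint.ae_hasDerivAt_integral, ae_Icc_mem_Ioo] with x h1 h2 hx
  have h3 := h1 (by simpa [Set.uIcc_of_le (zero_le_one' ℝ)] using hx) 0 (by simp)
  have h4 := unitDeriv_eqOn_of_primitive_chain hF hm hf k (by omega)
  have h5 : HasDerivWithinAt (unitDeriv k f) (F (k + 1) x) (Set.Icc 0 1) x :=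
    (h3.const_add (F k 0)).hasDerivWithinAt.congr
      (fun y hy => by rw [h4 hy, hF k (by omega) y hy]) (by rw [h4 hx, hF k (by omega) x hx])
  rw [unitDeriv_succ]
  exact h5.derivWithin (uniqueDiffOn_unitInterval x hx)

/-- Linear combinations, squares and iterated primitives come with explicit candidates for all their
derivatives, so membership reduces to integral identities. -/
theorem memSobolev_of_primitive_chain {f : ℝ → ℝ} (h1m : 1 ≤ m)
    (hF : ∀ j < m, ∀ x ∈ Set.Icc (0 : ℝ) 1, F j x = F j 0 + ∫ s in (0 : ℝ)..x, F (j + 1) s)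
    (hm : MemLp (F m) 2 (volume.restrict (Set.Icc (0 : ℝ) 1)))
    (hf : Set.EqOn f (F 0) (Set.Icc 0 1)) :
    MemSobolev m f := by
  have hEq := unitDeriv_eqOn_of_primitive_chain hF hm hf
  have hAC := primitive_chain_absolutelyContinuous hF hm
  refine ⟨?_, ?_, hm.ae_eq (unitDeriv_ae_eq_of_primitive_chain h1m hF hm hf).symm⟩
  · have := (contDiffOn_nat_iff_continuousOn_differentiableOn_deriv (f := f) (n := m - 1)
      uniqueDiffOn_unitInterval).2 ⟨?_, ?_⟩
    · exact_mod_cast this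
    · intro j hj
      have h1 : ContinuousOn (F j) (Set.Icc 0 1) := by
        simpa [Set.uIcc_of_le (zero_le_one' ℝ)] using
          (hAC (m - 1 - j) j (by omega)).continuousOn
      exact h1.congr (hEq j (by omega))
    · intro j hj x hx
      exact ((primitive_chain_hasDerivWithinAt hF hm (by omega) hx).congr
        (hEq j (by omega)) (hEq j (by omega) hx)).differentiableWithinAt
  · refine (hAC 0 (m - 1) (by omega)).congr_on_uIcc fun x hx => ?_
    rw [Set.uIcc_of_le zero_le_one] at hx
    exact (hEq (m - 1) (by omega) hx).symm

end Builder

/-! ### Linear combinations and squares of Sobolev functions -/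

namespace MemSobolev

variable {m : ℕ} {f g : ℝ → ℝ}

theorem chain (hf : MemSobolev m f) {j : ℕ} (hj : j < m) {x : ℝ} (hx : x ∈ Set.Icc (0 : ℝ) 1) :
    unitDeriv j f x = unitDeriv j f 0 + ∫ s in (0 : ℝ)..x, unitDeriv (j + 1) f s := by
  rw [hf.integral_unitDeriv_succ hj (by simp) hx]; ring

theorem chain_linear_combination (hf : MemSobolev m f) (hg : MemSobolev m g) (a b : ℝ) :
    ∀ j < m, ∀ x ∈ Set.Icc (0 : ℝ) 1,
      a * unitDeriv j f x + b * unitDeriv j g x = (a * unitDeriv j f 0 + b * unitDeriv j g 0) +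
        ∫ s in (0 : ℝ)..x, (a * unitDeriv (j + 1) f s + b * unitDeriv (j + 1) g s) := by
  intro j hj x hx
  have hs : Set.uIcc 0 x ⊆ Set.uIcc (0 : ℝ) 1 := by
    rw [Set.uIcc_of_le zero_le_one]; exact uIcc_subset_unit (by simp) hx
  rw [intervalIntegral.integral_add
    (((hf.intervalIntegrable hj).mono_set hs).const_mul a)
    (((hg.intervalIntegrable hj).mono_set hs).const_mul b),
    intervalIntegral.integral_const_mul, intervalIntegral.integral_const_mul,
    hf.chain hj hx, hg.chain hj hx]
  ring

theorem linear_combination (h1m : 1 ≤ m) (hf : MemSobolev m f) (hg : MemSobolev m g) (a b : ℝ) :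
    MemSobolev m (fun x => a * f x + b * g x) :=
  memSobolev_of_primitive_chain (F := fun j x => a * unitDeriv j f x + b * unitDeriv j g x) h1m
    (hf.chain_linear_combination hg a b)
    (((hf.memLp le_rfl).const_mul a).add ((hg.memLp le_rfl).const_mul b))
    (fun x _ => by simp [unitDeriv_zero])

theorem unitDeriv_linear_combination (hf : MemSobolev m f) (hg : MemSobolev m g) (a b : ℝ)
    {j : ℕ} (hj : j < m) :
    Set.EqOn (unitDeriv j (fun x => a * f x + b * g x))
      (fun x => a * unitDeriv j f x + b * unitDeriv j g x) (Set.Icc 0 1) :=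
  unitDeriv_eqOn_of_primitive_chain (F := fun j x => a * unitDeriv j f x + b * unitDeriv j g x)
    (hf.chain_linear_combination hg a b)
    (((hf.memLp le_rfl).const_mul a).add ((hg.memLp le_rfl).const_mul b))
    (fun x _ => by simp [unitDeriv_zero]) j hj

theorem unitDeriv_top_linear_combination (h1m : 1 ≤ m) (hf : MemSobolev m f)
    (hg : MemSobolev m g) (a b : ℝ) :
    unitDeriv m (fun x => a * f x + b * g x) =ᵐ[volume.restrict (Set.Icc (0 : ℝ) 1)]
      (fun x => a * unitDeriv m f x + b * unitDeriv m g x) :=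
  unitDeriv_ae_eq_of_primitive_chain (F := fun j x => a * unitDeriv j f x + b * unitDeriv j g x)
    h1m (hf.chain_linear_combination hg a b)
    (((hf.memLp le_rfl).const_mul a).add ((hg.memLp le_rfl).const_mul b))
    (fun x _ => by simp [unitDeriv_zero])

/-- A chain of length one, `g²` followed by `2gg'`, encoded by the `if`; it is integration by parts
for an absolutely continuous function against itself. The design condition will be applied to `g²`.
-/
theorem sq_chain (h1m : 1 ≤ m) (hg : MemSobolev m g) :
    ∀ j < 1, ∀ x ∈ Set.Icc (0 : ℝ) 1,
      (fun (k : ℕ) x => if k = 0 then g x ^ 2 else 2 * (g x * unitDeriv 1 g x)) j x =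
      (fun (k : ℕ) x => if k = 0 then g x ^ 2 else 2 * (g x * unitDeriv 1 g x)) j 0 +
      ∫ s in (0 : ℝ)..x,
        (fun (k : ℕ) x => if k = 0 then g x ^ 2 else 2 * (g x * unitDeriv 1 g x)) (j + 1) s := by
  intro j hj x hx
  obtain rfl : j = 0 := by omega
  have hs : Set.uIcc 0 x ⊆ Set.Icc (0 : ℝ) 1 := uIcc_subset_unit (by simp) hx
  have hAC : AbsolutelyContinuousOnInterval g 0 x := by
    have := hg.absolutelyContinuous (j := 0) (by omega)
    rw [unitDeriv_zero] at this
    exact this.mono (by rwa [Set.uIcc_of_le (zero_le_one' ℝ)])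
  have h1 := hAC.integral_deriv_mul_eq_sub hAC
  have h2 : ∫ s in (0 : ℝ)..x, 2 * (g s * unitDeriv 1 g s) = g x * g x - g 0 * g 0 := by
    rw [← h1]
    refine intervalIntegral.integral_congr_ae ?_
    filter_upwards [hg.ae_hasDerivAt (j := 0) (by omega)] with s hs1 hs2
    have := (hs1 (hs (Set.uIoc_subset_uIcc hs2))).deriv
    rw [unitDeriv_zero] at this
    rw [this]; ring
  simp only [if_true, zero_add, one_ne_zero, if_false]
  rw [h2]; ring

theorem memLp_mul_deriv (h1m : 1 ≤ m) (hg : MemSobolev m g) :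
    MemLp (fun x => 2 * (g x * unitDeriv 1 g x)) 2 (volume.restrict (Set.Icc (0 : ℝ) 1)) := by
  have hc : ContinuousOn g (Set.Icc 0 1) := by
    simpa [unitDeriv_zero] using hg.continuousOn (j := 0) (by omega)
  obtain ⟨C, hC⟩ := isCompact_Icc.exists_bound_of_continuousOn hc
  refine MemLp.const_mul ?_ 2
  refine MemLp.of_le_mul (c := C) (hg.memLp (j := 1) h1m)
    ((hc.aestronglyMeasurable measurableSet_Icc).mul (hg.memLp (j := 1) h1m).1) ?_
  refine (ae_restrict_iff' measurableSet_Icc).2 (Eventually.of_forall fun x hx => ?_)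
  rw [norm_mul]
  exact mul_le_mul_of_nonneg_right (hC x hx) (norm_nonneg _)

theorem sq (h1m : 1 ≤ m) (hg : MemSobolev m g) : MemSobolev 1 (fun x => g x ^ 2) :=
  memSobolev_of_primitive_chain le_rfl (hg.sq_chain h1m)
    (by simpa using hg.memLp_mul_deriv h1m) (fun x _ => by simp)

theorem unitDeriv_sq (h1m : 1 ≤ m) (hg : MemSobolev m g) :
    unitDeriv 1 (fun x => g x ^ 2) =ᵐ[volume.restrict (Set.Icc (0 : ℝ) 1)]
      (fun x => 2 * (g x * unitDeriv 1 g x)) := by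
  simpa using unitDeriv_ae_eq_of_primitive_chain (f := fun x => g x ^ 2) le_rfl (hg.sq_chain h1m)
    (by simpa using hg.memLp_mul_deriv h1m) (fun x _ => by simp)

end MemSobolev

/-! ### The norm of `L²([0,1])` -/

theorem l2NormSq_eq_setIntegral (f : ℝ → ℝ) :
    l2NormSq f = ∫ x in Set.Icc (0 : ℝ) 1, f x ^ 2 := by
  rw [l2NormSq, intervalIntegral.integral_of_le zero_le_one, integral_Icc_eq_integral_Ioc]

theorem l2NormSq_nonneg (f : ℝ → ℝ) : 0 ≤ l2NormSq f := by
  rw [l2NormSq_eq_setIntegral]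
  exact integral_nonneg fun x => sq_nonneg _

theorem l2NormSq_congr_ae {f g : ℝ → ℝ}
    (h : f =ᵐ[volume.restrict (Set.Icc (0 : ℝ) 1)] g) : l2NormSq f = l2NormSq g := by
  rw [l2NormSq_eq_setIntegral, l2NormSq_eq_setIntegral]
  exact integral_congr_ae (h.mono fun x hx => by simp [hx])

theorem l2NormSq_congr {f g : ℝ → ℝ} (h : Set.EqOn f g (Set.Icc 0 1)) :
    l2NormSq f = l2NormSq g :=
  l2NormSq_congr_ae ((ae_restrict_iff' measurableSet_Icc).2 (Eventually.of_forall h))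

theorem l2NormSq_const_mul (a : ℝ) (f : ℝ → ℝ) :
    l2NormSq (fun x => a * f x) = a ^ 2 * l2NormSq f := by
  simp only [l2NormSq, mul_pow, intervalIntegral.integral_const_mul]

theorem sobolevNormSq_nonneg (m : ℕ) {lam : ℝ} (hlam : 0 ≤ lam) (f : ℝ → ℝ) :
    0 ≤ sobolevNormSq m lam f :=
  add_nonneg (l2NormSq_nonneg _) (mul_nonneg hlam (l2NormSq_nonneg _))

/-- The Cauchy-Schwarz inequality for real square integrable functions. -/
theorem sq_integral_mul_le {α : Type*} [MeasurableSpace α] {ν : Measure α} {f g : α → ℝ}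
    (hf : MemLp f 2 ν) (hg : MemLp g 2 ν) :
    (∫ x, f x * g x ∂ν) ^ 2 ≤ (∫ x, f x ^ 2 ∂ν) * ∫ x, g x ^ 2 ∂ν := by
  have hff := hf.integrable_sq
  have hgg := hg.integrable_sq
  have hfg : Integrable (fun x => f x * g x) ν := hf.integrable_mul hg
  have key : ∀ s : ℝ, 0 ≤ (∫ x, f x ^ 2 ∂ν) * (s * s) + (2 * ∫ x, f x * g x ∂ν) * s +
      ∫ x, g x ^ 2 ∂ν := by
    intro s
    have h : ∫ x, (s * f x + g x) ^ 2 ∂ν = (∫ x, f x ^ 2 ∂ν) * (s * s) +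
        (2 * ∫ x, f x * g x ∂ν) * s + ∫ x, g x ^ 2 ∂ν := by
      have : (fun x => (s * f x + g x) ^ 2) =
          fun x => (s * s * f x ^ 2 + (2 * s) * (f x * g x)) + g x ^ 2 := by
        ext x; ring
      have hi : Integrable (fun x => s * s * f x ^ 2 + (2 * s) * (f x * g x)) ν :=
        (hff.const_mul _).add (hfg.const_mul _)
      rw [this, integral_add hi hgg,
        integral_add (hff.const_mul _) (hfg.const_mul _), integral_const_mul, integral_const_mul]
      ring
    rw [← h]
    exact integral_nonneg fun x => sq_nonneg _
  have := discrim_le_zero key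
  rw [discrim] at this
  nlinarith

theorem l2NormSq_add_le {f g : ℝ → ℝ} (hf : MemLp f 2 (volume.restrict (Set.Icc (0 : ℝ) 1)))
    (hg : MemLp g 2 (volume.restrict (Set.Icc (0 : ℝ) 1))) :
    l2NormSq (fun x => f x + g x) ≤ 2 * l2NormSq f + 2 * l2NormSq g := by
  simp only [l2NormSq_eq_setIntegral]
  rw [← integral_const_mul, ← integral_const_mul,
    ← integral_add (hf.integrable_sq.const_mul _) (hg.integrable_sq.const_mul _)]
  refine integral_mono (hf.add hg).integrable_sq
    ((hf.integrable_sq.const_mul _).add (hg.integrable_sq.const_mul _)) fun x => ?_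
  show (f x + g x) ^ 2 ≤ 2 * f x ^ 2 + 2 * g x ^ 2
  nlinarith [sq_nonneg (f x - g x)]

/-! ### Local integral representations of derivatives -/

/-- A smooth function that agrees with `x ^ k / k!` near `0` and vanishes near `1`. -/
def localMonomial (k : ℕ) (x : ℝ) : ℝ :=
  (k.factorial : ℝ)⁻¹ * x ^ k * Real.smoothTransition (2 - 3 * x)

theorem contDiff_localMonomial (k : ℕ) (n : ℕ) : ContDiff ℝ n (localMonomial k) := by
  have h : ContDiff ℝ (n : ℕ∞) (fun x : ℝ => Real.smoothTransition (2 - 3 * x)) :=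
    Real.smoothTransition.contDiff.comp (by fun_prop)
  exact (ContDiff.mul (by fun_prop) (by fun_prop)).mul (by exact_mod_cast h)

theorem localMonomial_eventuallyEq_zero (k : ℕ) :
    localMonomial k =ᶠ[𝓝 0] fun x => (k.factorial : ℝ)⁻¹ * x ^ k := by
  filter_upwards [Iio_mem_nhds (show (0 : ℝ) < 1 / 3 by norm_num)] with x hx
  rw [localMonomial, Real.smoothTransition.one_of_one_le, mul_one]
  rw [Set.mem_Iio] at hx; linarith

theorem localMonomial_eventuallyEq_one (k : ℕ) :
    localMonomial k =ᶠ[𝓝 1] fun _ => 0 := by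
  filter_upwards [Ioi_mem_nhds (show (2 / 3 : ℝ) < 1 by norm_num)] with x hx
  rw [localMonomial, Real.smoothTransition.zero_of_nonpos, mul_zero]
  rw [Set.mem_Ioi] at hx; linarith

/-- This selects a single boundary term when integrating by parts repeatedly; at the other end point
all boundary terms vanish. -/
theorem iteratedDeriv_localMonomial_zero (k i : ℕ) :
    iteratedDeriv i (localMonomial k) 0 = if i = k then 1 else 0 := by
  rw [(localMonomial_eventuallyEq_zero k).iteratedDeriv_eq, iteratedDeriv_const_mul_field,
    iteratedDeriv_fun_pow_zero]
  split_ifs with h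
  · subst h
    exact inv_mul_cancel₀ (by positivity)
  · simp

theorem iteratedDeriv_localMonomial_one (k i : ℕ) :
    iteratedDeriv i (localMonomial k) 1 = 0 := by
  rw [(localMonomial_eventuallyEq_one k).iteratedDeriv_eq]
  simp

/-- The `i`-th derivative of the rescaled function `s ↦ localMonomial k ((s - x) / β)`. -/
def scaledWeight (k i : ℕ) (x β s : ℝ) : ℝ :=
  (β ^ i)⁻¹ * iteratedDeriv i (localMonomial k) ((s - x) / β)

theorem hasDerivAt_scaledWeight (k i : ℕ) (x β s : ℝ) :
    HasDerivAt (scaledWeight k i x β) (scaledWeight k (i + 1) x β s) s := by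
  have h1 : HasDerivAt (iteratedDeriv i (localMonomial k))
      (iteratedDeriv (i + 1) (localMonomial k) ((s - x) / β)) ((s - x) / β) := by
    rw [iteratedDeriv_succ]
    exact ((contDiff_localMonomial k (i + 1)).differentiable_iteratedDeriv i
      (by exact_mod_cast Nat.lt_succ_self i) _).hasDerivAt
  have h2 : HasDerivAt (fun s => (s - x) / β) (1 / β) s :=
    ((hasDerivAt_id s).sub_const x).div_const β
  refine ((h1.comp s h2).const_mul (β ^ i)⁻¹).congr_deriv ?_
  rw [scaledWeight, pow_succ, mul_inv]; ring

theorem continuous_scaledWeight (k i : ℕ) (x β : ℝ) : Continuous (scaledWeight k i x β) :=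
  continuous_iff_continuousAt.2 fun s => (hasDerivAt_scaledWeight k i x β s).continuousAt

theorem absolutelyContinuous_scaledWeight (k i : ℕ) (x β a b : ℝ) :
    AbsolutelyContinuousOnInterval (scaledWeight k i x β) a b := by
  refine ContDiffOn.absolutelyContinuousOnInterval (ContDiff.contDiffOn ?_)
  rw [contDiff_one_iff_deriv]
  refine ⟨fun s => (hasDerivAt_scaledWeight k i x β s).differentiableAt, ?_⟩
  rw [funext fun s => (hasDerivAt_scaledWeight k i x β s).deriv]
  exact continuous_scaledWeight k (i + 1) x β

theorem scaledWeight_left (k i : ℕ) (x β : ℝ) :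
    scaledWeight k i x β x = if i = k then (β ^ k)⁻¹ else 0 := by
  rw [scaledWeight, sub_self, zero_div, iteratedDeriv_localMonomial_zero]
  split_ifs with h
  · rw [h, mul_one]
  · simp

theorem scaledWeight_right (k i : ℕ) (x : ℝ) {β : ℝ} (hβ : β ≠ 0) :
    scaledWeight k i x β (x + β) = 0 := by
  rw [scaledWeight, add_sub_cancel_left, div_self hβ, iteratedDeriv_localMonomial_one, mul_zero]

/-- One integration by parts, moving a derivative from `g` to the weight. The boundary term at `x +
β` is zero and the one at `x` survives only for `i = k`. The sign of `β` is free. -/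
theorem MemSobolev.integral_scaledWeight_mul {m : ℕ} {g : ℝ → ℝ} (hg : MemSobolev m g)
    (k : ℕ) {i : ℕ} (hi : i < m) {x β : ℝ} (hβ : β ≠ 0)
    (hx : x ∈ Set.Icc (0 : ℝ) 1) (hxβ : x + β ∈ Set.Icc (0 : ℝ) 1) :
    ∫ s in x..(x + β), scaledWeight k i x β s * unitDeriv (m - i) g s =
      -(if i = k then (β ^ k)⁻¹ else 0) * unitDeriv (m - (i + 1)) g x -
      ∫ s in x..(x + β), scaledWeight k (i + 1) x β s * unitDeriv (m - (i + 1)) g s := by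
  have hsub := uIcc_subset_unit hx hxβ
  have hAC : AbsolutelyContinuousOnInterval (unitDeriv (m - (i + 1)) g) x (x + β) :=
    (hg.absolutelyContinuous (by omega)).mono (by rwa [Set.uIcc_of_le (zero_le_one' ℝ)])
  have h := (absolutelyContinuous_scaledWeight k i x β x (x + β)).integral_mul_deriv_eq_deriv_mul
    hAC
  have h1 : ∫ s in x..(x + β), scaledWeight k i x β s * unitDeriv (m - i) g s =
      ∫ s in x..(x + β), scaledWeight k i x β s * deriv (unitDeriv (m - (i + 1)) g) s := by
    refine intervalIntegral.integral_congr_ae ?_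
    filter_upwards [hg.ae_hasDerivAt (j := m - (i + 1)) (by omega)] with s hs hs'
    rw [(hs (hsub (Set.uIoc_subset_uIcc hs'))).deriv,
      show m - (i + 1) + 1 = m - i by omega]
  have h2 : ∀ s, deriv (scaledWeight k i x β) s = scaledWeight k (i + 1) x β s :=
    fun s => (hasDerivAt_scaledWeight k i x β s).deriv
  rw [h1, h]
  simp only [h2, scaledWeight_right k i x hβ, scaledWeight_left]
  ring

/-- The derivative `g^{(j)}(x)` is a weighted integral of `g` and `g^{(m)}` over an interval of
length `|β|` with end point `x`. -/
theorem MemSobolev.unitDeriv_eq_integral {m : ℕ} {g : ℝ → ℝ} (hg : MemSobolev m g)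
    {j : ℕ} (hj : j < m) {x β : ℝ} (hβ : β ≠ 0)
    (hx : x ∈ Set.Icc (0 : ℝ) 1) (hxβ : x + β ∈ Set.Icc (0 : ℝ) 1) :
    unitDeriv j g x =
      (-(-1) ^ (m - 1 - j) * β ^ (m - 1 - j)) *
        (∫ s in x..(x + β), scaledWeight (m - 1 - j) 0 x β s * unitDeriv m g s) +
      (-(-1) ^ j * β ^ (m - 1 - j)) *
        (∫ s in x..(x + β), scaledWeight (m - 1 - j) m x β s * g s) := by
  set k := m - 1 - j with hk
  -- `J i` is the integral after `i` integrations by parts. Every step only flips the sign, except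
  -- step `k`, whose boundary term carries `g^{(m-(k+1))}(x) = g^{(j)}(x)`. Comparing `J 0` with `J
  -- m` isolates it.
  set J : ℕ → ℝ := fun i => ∫ s in x..(x + β), scaledWeight k i x β s * unitDeriv (m - i) g s
    with hJ
  have hstep : ∀ i < m, J i = -(if i = k then (β ^ k)⁻¹ else 0) * unitDeriv (m - (i + 1)) g x -
      J (i + 1) := fun i hi => hg.integral_scaledWeight_mul k hi hβ hx hxβ
  have hlow : ∀ p, p ≤ k → J 0 = (-1) ^ p * J p := by
    intro p
    induction p with
    | zero => simp
    | succ p ih =>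
      intro hp
      rw [ih (by omega), hstep p (by omega), if_neg (by omega), pow_succ]; ring
  have hhigh : ∀ p, k + 1 + p ≤ m → J (k + 1) = (-1) ^ p * J (k + 1 + p) := by
    intro p
    induction p with
    | zero => simp
    | succ p ih =>
      intro hp
      rw [ih (by omega), hstep (k + 1 + p) (by omega), if_neg (by omega), pow_succ]
      rw [show k + 1 + p + 1 = k + 1 + (p + 1) by ring]; ring
  have h0 := hlow k le_rfl
  have h1 := hhigh j (by omega)
  have h2 := hstep k (by omega)
  rw [if_pos rfl, show m - (k + 1) = j by omega] at h2
  rw [show k + 1 + j = m by omega] at h1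
  have hJ0 : J 0 = ∫ s in x..(x + β), scaledWeight k 0 x β s * unitDeriv m g s := by simp [hJ]
  have hJm : J m = ∫ s in x..(x + β), scaledWeight k m x β s * g s := by
    simp [hJ, unitDeriv_zero]
  rw [← hJ0, ← hJm, h0, mul_comm (-(-1) ^ j) (β ^ k)]
  have hsq : ((-1 : ℝ) ^ k) * (-1) ^ k = 1 := by rw [← mul_pow]; simp
  have hsq' : ((-1 : ℝ) ^ j) * (-1) ^ j = 1 := by rw [← mul_pow]; simp
  have hβk : β ^ k ≠ 0 := pow_ne_zero _ hβ
  have h3 : -(β ^ k)⁻¹ * unitDeriv j g x = J k + (-1) ^ j * J m := by rw [h2, h1]; ring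
  have h4 : unitDeriv j g x = -(β ^ k) * (J k + (-1) ^ j * J m) := by
    rw [← h3]; field_simp
  rw [h4]
  linear_combination (-(β ^ k) * J k) * (-hsq)

/-- A bounded-weight version of `MemSobolev.unitDeriv_eq_integral`. -/
theorem exists_local_kernel {m j : ℕ} (hj : j < m) :
    ∃ C : ℝ, 0 < C ∧ ∀ x β : ℝ, β ≠ 0 → x ∈ Set.Icc (0 : ℝ) 1 → x + β ∈ Set.Icc (0 : ℝ) 1 →
      ∃ v w : ℝ → ℝ, Continuous v ∧ Continuous w ∧
        (∀ s ∈ Set.uIoc x (x + β), |v s| ≤ C * |β| ^ (m - 1 - j)) ∧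
        (∀ s ∈ Set.uIoc x (x + β), |w s| ≤ C * (|β| ^ (j + 1))⁻¹) ∧
        ∀ g : ℝ → ℝ, MemSobolev m g →
          unitDeriv j g x = (∫ s in Set.uIoc x (x + β), v s * unitDeriv m g s) +
            ∫ s in Set.uIoc x (x + β), w s * g s := by
  set k := m - 1 - j with hk
  have hc0 : Continuous (iteratedDeriv 0 (localMonomial k)) :=
    (contDiff_localMonomial k 0).continuous_iteratedDeriv' 0
  have hcm : Continuous (iteratedDeriv m (localMonomial k)) :=
    (contDiff_localMonomial k m).continuous_iteratedDeriv' m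
  obtain ⟨C0, hC0⟩ := (isCompact_Icc (a := (0 : ℝ)) (b := 1)).exists_bound_of_continuousOn
    hc0.continuousOn
  obtain ⟨Cm, hCm⟩ := (isCompact_Icc (a := (0 : ℝ)) (b := 1)).exists_bound_of_continuousOn
    hcm.continuousOn
  refine ⟨max (max C0 Cm) 1, by positivity, fun x β hβ hx hxβ => ?_⟩
  -- The orientation sign relating the interval integral to the integral over `uIoc`.
  set σ : ℝ := if x ≤ x + β then 1 else -1 with hσ
  have hσ1 : |σ| = 1 := by rw [hσ]; split_ifs <;> simp
  have hmem : ∀ s ∈ Set.uIoc x (x + β), (s - x) / β ∈ Set.Icc (0 : ℝ) 1 := by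
    intro s hs
    rcases lt_or_gt_of_ne hβ with hneg | hpos
    · rw [Set.uIoc_of_ge (by linarith)] at hs
      exact ⟨div_nonneg_of_nonpos (by linarith [hs.2]) hneg.le,
        (div_le_one_of_neg hneg).2 (by linarith [hs.1])⟩
    · rw [Set.uIoc_of_le (by linarith)] at hs
      exact ⟨div_nonneg (by linarith [hs.1]) hpos.le, (div_le_one hpos).2 (by linarith [hs.2])⟩
  refine ⟨fun s => σ * ((-(-1) ^ k * β ^ k) * scaledWeight k 0 x β s),
    fun s => σ * ((-(-1) ^ j * β ^ k) * scaledWeight k m x β s),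
    continuous_const.mul (continuous_const.mul (continuous_scaledWeight _ _ _ _)),
    continuous_const.mul (continuous_const.mul (continuous_scaledWeight _ _ _ _)), ?_, ?_, ?_⟩
  · intro s hs
    have h := hC0 _ (hmem s hs)
    rw [Real.norm_eq_abs] at h
    rw [abs_mul, hσ1, one_mul, abs_mul, abs_mul, abs_neg, abs_pow, abs_neg, abs_one, one_pow,
      one_mul, scaledWeight, pow_zero, inv_one, one_mul, abs_pow, mul_comm]
    exact mul_le_mul_of_nonneg_right (h.trans ((le_max_left _ _).trans (le_max_left _ _)))
      (by positivity)
  · intro s hs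
    have h := hCm _ (hmem s hs)
    rw [Real.norm_eq_abs] at h
    rw [abs_mul, hσ1, one_mul, abs_mul, abs_mul, abs_neg, abs_pow, abs_neg, abs_one, one_pow,
      one_mul, scaledWeight, abs_mul, abs_pow, abs_inv, abs_pow, ← mul_assoc,
      mul_comm (|β| ^ k * _)]
    have hβ' : (0 : ℝ) < |β| := abs_pos.2 hβ
    have hp : |β| ^ k * (|β| ^ m)⁻¹ = (|β| ^ (j + 1))⁻¹ := by
      rw [show m = k + (j + 1) by omega, pow_add, mul_inv, ← mul_assoc,
        mul_inv_cancel₀ (by positivity), one_mul]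
    rw [hp]
    exact mul_le_mul_of_nonneg_right (h.trans ((le_max_right _ _).trans (le_max_left _ _)))
      (by positivity)
  · intro g hg
    rw [hg.unitDeriv_eq_integral hj hβ hx hxβ, intervalIntegral.intervalIntegral_eq_integral_uIoc,
      intervalIntegral.intervalIntegral_eq_integral_uIoc, smul_eq_mul, smul_eq_mul]
    simp only [mul_assoc, integral_const_mul]
    ring

/-! ### Interpolation inequalities and the Gram matrix of the evaluation functionals -/

theorem memLp_two_uIoc_and_integral_sq_le {v : ℝ → ℝ} (hv : Continuous v) {x β M : ℝ}
    (hM : ∀ s ∈ Set.uIoc x (x + β), |v s| ≤ M) :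
    MemLp v 2 (volume.restrict (Set.uIoc x (x + β))) ∧
      ∫ s in Set.uIoc x (x + β), v s ^ 2 ≤ M ^ 2 * |β| := by
  have hvol : volume (Set.uIoc x (x + β)) = ENNReal.ofReal |β| := by
    rw [Set.uIoc, Real.volume_Ioc, max_sub_min_eq_abs]
    congr 2; ring
  have hfin : IsFiniteMeasure (volume.restrict (Set.uIoc x (x + β))) :=
    ⟨by rw [Measure.restrict_apply_univ, hvol]; exact ENNReal.ofReal_lt_top⟩
  have hmem : MemLp v 2 (volume.restrict (Set.uIoc x (x + β))) :=
    MemLp.of_bound hv.aestronglyMeasurable M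
      ((ae_restrict_iff' measurableSet_uIoc).2 (Eventually.of_forall hM))
  refine ⟨hmem, ?_⟩
  calc ∫ s in Set.uIoc x (x + β), v s ^ 2 ≤ ∫ _ in Set.uIoc x (x + β), M ^ 2 := by
        refine setIntegral_mono_on hmem.integrable_sq (integrable_const _) measurableSet_uIoc
          fun s hs => ?_
        rw [← sq_abs]
        exact pow_le_pow_left₀ (abs_nonneg _) (hM s hs) 2
    _ = M ^ 2 * |β| := by
        rw [setIntegral_const, smul_eq_mul, Measure.real, hvol,
          ENNReal.toReal_ofReal (abs_nonneg _), mul_comm]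

theorem memLp_mono_unit {f : ℝ → ℝ} (hf : MemLp f 2 (volume.restrict (Set.Icc (0 : ℝ) 1)))
    {S : Set ℝ} (hS : S ⊆ Set.Icc 0 1) : MemLp f 2 (volume.restrict S) :=
  hf.mono_measure (Measure.restrict_mono hS le_rfl)

theorem integral_sq_mono_set {f : ℝ → ℝ} {S T : Set ℝ} (hf : MemLp f 2 (volume.restrict T))
    (hS : S ⊆ T) : ∫ s in S, f s ^ 2 ≤ ∫ s in T, f s ^ 2 :=
  setIntegral_mono_set hf.integrable_sq (Eventually.of_forall fun _ => sq_nonneg _)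
    hS.eventuallyLE

/-- Cauchy-Schwarz in the kernel representation: the exponents are those of the squared weight
bounds times the length `|β|`. The right-hand integrals stay local so that they can be summed over
disjoint blocks. -/
theorem exists_sq_unitDeriv_le_local {m j : ℕ} (hj : j < m) :
    ∃ C : ℝ, 0 < C ∧ ∀ x β : ℝ, β ≠ 0 → x ∈ Set.Icc (0 : ℝ) 1 → x + β ∈ Set.Icc (0 : ℝ) 1 →
      ∀ g : ℝ → ℝ, MemSobolev m g →
        unitDeriv j g x ^ 2 ≤
          C * (|β| ^ (2 * (m - 1 - j) + 1) * (∫ s in Set.uIoc x (x + β), unitDeriv m g s ^ 2) +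
            (|β| ^ (2 * j + 1))⁻¹ * ∫ s in Set.uIoc x (x + β), g s ^ 2) := by
  obtain ⟨C, hC, h⟩ := exists_local_kernel hj
  refine ⟨2 * C ^ 2, by positivity, fun x β hβ hx hxβ g hg => ?_⟩
  obtain ⟨v, w, hv, hw, hvb, hwb, hrep⟩ := h x β hβ hx hxβ
  have hS : Set.uIoc x (x + β) ⊆ Set.Icc 0 1 :=
    Set.uIoc_subset_uIcc.trans (uIcc_subset_unit hx hxβ)
  obtain ⟨hv2, hvi⟩ := memLp_two_uIoc_and_integral_sq_le hv hvb
  obtain ⟨hw2, hwi⟩ := memLp_two_uIoc_and_integral_sq_le hw hwb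
  have hgm := memLp_mono_unit (hg.memLp (le_refl m)) hS
  have hg0 := memLp_mono_unit (hg.memLp (Nat.zero_le m)) hS
  rw [unitDeriv_zero] at hg0
  have h1 := (sq_integral_mul_le hv2 hgm).trans
    (mul_le_mul_of_nonneg_right hvi (integral_nonneg fun s => sq_nonneg _))
  have h2 := (sq_integral_mul_le hw2 hg0).trans
    (mul_le_mul_of_nonneg_right hwi (integral_nonneg fun s => sq_nonneg _))
  have hb : 0 < |β| := abs_pos.2 hβ
  have e1 : (C * |β| ^ (m - 1 - j)) ^ 2 * |β| = C ^ 2 * |β| ^ (2 * (m - 1 - j) + 1) := by ring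
  have e2 : (C * (|β| ^ (j + 1))⁻¹) ^ 2 * |β| = C ^ 2 * (|β| ^ (2 * j + 1))⁻¹ := by
    field_simp
    ring
  rw [e1] at h1
  rw [e2] at h2
  rw [hrep g hg]
  nlinarith [sq_nonneg ((∫ s in Set.uIoc x (x + β), v s * unitDeriv m g s) -
    ∫ s in Set.uIoc x (x + β), w s * g s)]

/-- Interpolation inequality for the intermediate derivatives. -/
theorem exists_l2NormSq_unitDeriv_le {m j : ℕ} (hj : j ≤ m) :
    ∃ C : ℝ, 0 < C ∧ ∀ b : ℝ, 0 < b → b ≤ 1 → ∀ g : ℝ → ℝ, MemSobolev m g →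
      b ^ (2 * j) * l2NormSq (unitDeriv j g) ≤ C * sobolevNormSq m (b ^ (2 * m)) g := by
  rcases Nat.eq_or_lt_of_le hj with rfl | hj
  · refine ⟨1, one_pos, fun b hb hb1 g hg => ?_⟩
    rw [one_mul, sobolevNormSq]
    linarith [l2NormSq_nonneg g]
  obtain ⟨C, hC, hloc⟩ := exists_sq_unitDeriv_le_local hj
  refine ⟨4 ^ (2 * j) * (2 * C), by positivity, fun b hb hb1 g hg => ?_⟩
  -- Cut `[0,1]` into `N` blocks of length `2h = 1/N`, with `h ≤ b ≤ 4h`. The local bound at scale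
  -- `h` is integrated over each block and summed; passing from `h` back to `b` costs `4^{2j}`.
  set N := ⌈1 / b⌉₊ with hN
  have hb' : 1 ≤ 1 / b := by rw [le_div_iff₀ hb]; linarith
  have hN1 : 1 / b ≤ N := Nat.le_ceil _
  have hN2 : (N : ℝ) < 1 / b + 1 := Nat.ceil_lt_add_one (by positivity)
  have hNpos : (0 : ℝ) < N := by linarith
  set h : ℝ := 1 / (2 * N) with hh
  have hhpos : 0 < h := by positivity
  have hbh : b ≤ 4 * h := by
    have : (N : ℝ) ≤ 2 / b := by
      have : (2 : ℝ) / b = 1 / b + 1 / b := by ring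
      linarith
    rw [hh]
    rw [le_div_iff₀ hb] at this
    rw [mul_one_div, le_div_iff₀ (by positivity)]; nlinarith
  have hhb : h ≤ b := by
    rw [hh, div_le_iff₀ (by positivity)]
    rw [div_le_iff₀ hb] at hN1; nlinarith
  have hsq : ∀ i ≤ m, IntervalIntegrable (fun s => unitDeriv i g s ^ 2) volume 0 1 := by
    intro i hi
    rw [intervalIntegrable_iff_integrableOn_Icc_of_le zero_le_one]
    exact (hg.memLp hi).integrable_sq
  set a : ℕ → ℝ := fun k => k * (2 * h) with ha
  have ha1 : ∀ k, a (k + 1) = a k + 2 * h := by intro k; simp only [ha]; push_cast; ring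
  have haN : a N = 1 := by simp only [ha, hh]; field_simp
  have ha0 : a 0 = 0 := by simp [ha]
  have haI : ∀ k ≤ N, a k ∈ Set.Icc (0 : ℝ) 1 := by
    intro k hk
    refine ⟨by positivity, ?_⟩
    rw [← haN]
    have : (k : ℝ) ≤ N := by exact_mod_cast hk
    exact mul_le_mul_of_nonneg_right this (by positivity)
  have hii : ∀ i ≤ m, ∀ k < N, IntervalIntegrable (fun s => unitDeriv i g s ^ 2) volume
      (a k) (a (k + 1)) := fun i hi k hk => (hsq i hi).mono_set (by
        rw [Set.uIcc_of_le zero_le_one]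
        exact uIcc_subset_unit (haI k hk.le) (haI (k + 1) hk))
  have hsum : ∀ i ≤ m, ∑ k ∈ Finset.range N, ∫ s in (a k)..(a (k + 1)), unitDeriv i g s ^ 2 =
      l2NormSq (unitDeriv i g) := by
    intro i hi
    rw [intervalIntegral.sum_integral_adjacent_intervals (hii i hi), haN, ha0, l2NormSq]
  have hblock : ∀ k < N, h ^ (2 * j) * ∫ s in (a k)..(a (k + 1)), unitDeriv j g s ^ 2 ≤
      2 * C * (h ^ (2 * m) * (∫ s in (a k)..(a (k + 1)), unitDeriv m g s ^ 2) +
        ∫ s in (a k)..(a (k + 1)), unitDeriv 0 g s ^ 2) := by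
    intro k hk
    have hle : a k ≤ a (k + 1) := by rw [ha1]; linarith
    have hsubI : Set.Ioc (a k) (a (k + 1)) ⊆ Set.Icc 0 1 := fun s hs =>
      ⟨(haI k hk.le).1.trans hs.1.le, hs.2.trans (haI (k + 1) hk).2⟩
    simp only [intervalIntegral.integral_of_le hle]
    set A := ∫ s in Set.Ioc (a k) (a (k + 1)), unitDeriv 0 g s ^ 2 with hA
    set B := ∫ s in Set.Ioc (a k) (a (k + 1)), unitDeriv m g s ^ 2 with hB
    have hpt : ∀ x ∈ Set.Ioc (a k) (a (k + 1)), unitDeriv j g x ^ 2 ≤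
        C * (h ^ (2 * (m - 1 - j) + 1) * B + (h ^ (2 * j + 1))⁻¹ * A) := by
      intro x hx
      -- From the left half of the block step right, from the right half step left: a step of length
      -- `h` never leaves the block.
      obtain ⟨β, hβ0, hβ, hβs, hβI⟩ : ∃ β : ℝ, β ≠ 0 ∧ |β| = h ∧
          Set.uIoc x (x + β) ⊆ Set.Ioc (a k) (a (k + 1)) ∧
          x + β ∈ Set.Icc (a k) (a (k + 1)) := by
        have h2 := ha1 k
        rcases le_total x (a k + h) with hxl | hxl
        · refine ⟨h, hhpos.ne', abs_of_pos hhpos, ?_, ⟨by linarith [hx.1], by linarith⟩⟩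
          rw [Set.uIoc_of_le (by linarith)]
          exact Set.Ioc_subset_Ioc hx.1.le (by linarith)
        · refine ⟨-h, by linarith, by rw [abs_neg, abs_of_pos hhpos], ?_,
            ⟨by linarith, by linarith [hx.2]⟩⟩
          rw [Set.uIoc_of_ge (by linarith)]
          exact Set.Ioc_subset_Ioc (by linarith) hx.2
      have hβI' : x + β ∈ Set.Icc (0 : ℝ) 1 :=
        ⟨(haI k hk.le).1.trans hβI.1, hβI.2.trans (haI (k + 1) hk).2⟩
      have := hloc x β hβ0 (hsubI hx) hβI' g hg
      rw [hβ] at this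
      refine this.trans (mul_le_mul_of_nonneg_left (add_le_add ?_ ?_) hC.le)
      · exact mul_le_mul_of_nonneg_left (integral_sq_mono_set
          (memLp_mono_unit (hg.memLp le_rfl) hsubI) hβs) (by positivity)
      · rw [hA, unitDeriv_zero]
        have hg0 := hg.memLp (Nat.zero_le m)
        rw [unitDeriv_zero] at hg0
        exact mul_le_mul_of_nonneg_left (integral_sq_mono_set
          (memLp_mono_unit hg0 hsubI) hβs) (by positivity)
    have hint : ∫ x in Set.Ioc (a k) (a (k + 1)), unitDeriv j g x ^ 2 ≤
        (C * (h ^ (2 * (m - 1 - j) + 1) * B + (h ^ (2 * j + 1))⁻¹ * A)) * (2 * h) := by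
      refine (setIntegral_mono_on (memLp_mono_unit (hg.memLp hj.le) hsubI).integrable_sq
        (integrable_const _) measurableSet_Ioc hpt).trans ?_
      rw [setIntegral_const, smul_eq_mul, Measure.real, Real.volume_Ioc, ha1, mul_comm,
        ENNReal.toReal_ofReal (by linarith)]
      apply le_of_eq; ring
    refine (mul_le_mul_of_nonneg_left hint (by positivity)).trans (le_of_eq ?_)
    have e1 : h ^ (2 * j) * (h ^ (2 * j + 1))⁻¹ * h = 1 := by
      rw [pow_succ]; field_simp
    have e2 : h ^ (2 * j) * h ^ (2 * (m - 1 - j) + 1) * h = h ^ (2 * m) := by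
      rw [← pow_add, ← pow_succ]; congr 1; omega
    linear_combination (2 * C * B) * e2 + (2 * C * A) * e1
  have hmain : h ^ (2 * j) * l2NormSq (unitDeriv j g) ≤
      2 * C * (h ^ (2 * m) * l2NormSq (unitDeriv m g) + l2NormSq g) := by
    have h0 := hsum 0 (Nat.zero_le m)
    rw [show l2NormSq (unitDeriv 0 g) = l2NormSq g by rw [unitDeriv_zero]] at h0
    rw [← hsum j hj.le, ← hsum m le_rfl, ← h0, Finset.mul_sum, Finset.mul_sum,
      ← Finset.sum_add_distrib, Finset.mul_sum]
    exact Finset.sum_le_sum fun k hk => hblock k (Finset.mem_range.1 hk)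
  have hB := l2NormSq_nonneg (unitDeriv m g)
  have hJ := l2NormSq_nonneg (unitDeriv j g)
  calc b ^ (2 * j) * l2NormSq (unitDeriv j g)
      ≤ (4 * h) ^ (2 * j) * l2NormSq (unitDeriv j g) := by gcongr
    _ = 4 ^ (2 * j) * (h ^ (2 * j) * l2NormSq (unitDeriv j g)) := by rw [mul_pow]; ring
    _ ≤ 4 ^ (2 * j) * (2 * C * (h ^ (2 * m) * l2NormSq (unitDeriv m g) + l2NormSq g)) := by
        gcongr
    _ ≤ 4 ^ (2 * j) * (2 * C * (b ^ (2 * m) * l2NormSq (unitDeriv m g) + l2NormSq g)) := by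
        gcongr
    _ = _ := by rw [sobolevNormSq]; ring

theorem exists_half_step {x b : ℝ} (hx : x ∈ Set.Icc (0 : ℝ) 1) (hb : 0 < b) (hb1 : b ≤ 1) :
    ∃ β : ℝ, β ≠ 0 ∧ |β| = b / 2 ∧ x + β ∈ Set.Icc (0 : ℝ) 1 := by
  rcases le_total x (1 / 2) with h | h
  · exact ⟨b / 2, by positivity, abs_of_pos (by positivity), by linarith [hx.1], by linarith⟩
  · exact ⟨-(b / 2), by linarith, by rw [abs_neg, abs_of_pos (by positivity)], by linarith,
      by linarith [hx.2]⟩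

/-- The evaluation functionals are controlled by a Gram matrix with small diagonal. -/
theorem exists_gram {m : ℕ} (hm : 1 ≤ m) :
    ∃ C : ℝ, 0 < C ∧ ∀ b : ℝ, 0 < b → b ≤ 1 → ∀ (n : ℕ) (t : Fin n → ℝ),
      (∀ i, t i ∈ Set.Icc (0 : ℝ) 1) → ∃ G : Fin n → Fin n → ℝ,
        (∀ i, b * G i i ≤ C) ∧ (∀ z : Fin n → ℝ, 0 ≤ ∑ i, ∑ j, z i * z j * G i j) ∧
        ∀ g : ℝ → ℝ, MemSobolev m g → ∀ z : Fin n → ℝ,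
          (∑ i, z i * g (t i)) ^ 2 ≤
            sobolevNormSq m (b ^ (2 * m)) g * ∑ i, ∑ j, z i * z j * G i j := by
  obtain ⟨C, hC, hloc⟩ := exists_local_kernel (m := m) (j := 0) (by omega)
  refine ⟨4 * C ^ 2, by positivity, fun b hb hb1 n t ht => ?_⟩
  choose β hβ0 hβ hβI using fun i => exists_half_step (ht i) hb hb1
  choose v w hv hw hvb hwb hrep using fun i => hloc (t i) (β i) (hβ0 i) (ht i) (hβI i)
  set S : Fin n → Set ℝ := fun i => Set.uIoc (t i) (t i + β i) with hS
  have hSm : ∀ i, MeasurableSet (S i) := fun i => measurableSet_uIoc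
  have hSI : ∀ i, S i ⊆ Set.Icc 0 1 := fun i =>
    Set.uIoc_subset_uIcc.trans (uIcc_subset_unit (ht i) (hβI i))
  set ν : Measure ℝ := volume.restrict (Set.Icc (0 : ℝ) 1) with hν
  set V : Fin n → ℝ → ℝ := fun i => (S i).indicator (v i) with hV
  set W : Fin n → ℝ → ℝ := fun i => (S i).indicator (w i) with hW
  have hrestr : ∀ i, ν.restrict (S i) = volume.restrict (S i) := fun i => by
    rw [hν, Measure.restrict_restrict (hSm i), Set.inter_eq_left.2 (hSI i)]
  have hVL : ∀ i, MemLp (V i) 2 ν := fun i => by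
    rw [hV, memLp_indicator_iff_restrict (hSm i), hrestr]
    exact (memLp_two_uIoc_and_integral_sq_le (hv i) (hvb i)).1
  have hWL : ∀ i, MemLp (W i) 2 ν := fun i => by
    rw [hW, memLp_indicator_iff_restrict (hSm i), hrestr]
    exact (memLp_two_uIoc_and_integral_sq_le (hw i) (hwb i)).1
  have hind : ∀ (i : Fin n) (u f : ℝ → ℝ), ∫ s, (S i).indicator u s * f s ∂ν =
      ∫ s in S i, u s * f s := fun i u f => by
    rw [← hrestr i, ← integral_indicator (hSm i)]
    congr 1; ext s
    by_cases hs : s ∈ S i <;> simp [hs]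
  have hlampos : 0 < b ^ (2 * m) := by positivity
  -- Evaluation at `t i` pairs `W i` with `g` and `V i` with `g^{(m)}`. In the norm `‖g‖² +
  -- λ‖g^{(m)}‖²` the dual norm of such a pair weights the `V` part by `λ⁻¹`, so `G` is the dual
  -- Gram matrix.
  set G : Fin n → Fin n → ℝ := fun i j =>
    (∫ s, W i s * W j s ∂ν) + (b ^ (2 * m))⁻¹ * ∫ s, V i s * V j s ∂ν with hG
  have hquad : ∀ (U : Fin n → ℝ → ℝ), (∀ i, MemLp (U i) 2 ν) → ∀ z : Fin n → ℝ,
      ∑ i, ∑ j, z i * z j * ∫ s, U i s * U j s ∂ν = ∫ s, (∑ i, z i * U i s) ^ 2 ∂ν := by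
    intro U hU z
    have : ∀ s, (∑ i, z i * U i s) ^ 2 = ∑ i, ∑ j, z i * z j * (U i s * U j s) := by
      intro s
      rw [sq, Finset.sum_mul_sum]
      exact Finset.sum_congr rfl fun i _ => Finset.sum_congr rfl fun j _ => by ring
    simp only [this]
    have hUU : ∀ i j, Integrable (fun s => z i * z j * (U i s * U j s)) ν := fun i j =>
      ((hU i).integrable_mul (hU j)).const_mul _
    rw [integral_finsetSum _ fun i _ => integrable_finsetSum _ fun j _ => hUU i j]
    refine Finset.sum_congr rfl fun i _ => ?_
    rw [integral_finsetSum _ fun j _ => hUU i j]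
    exact Finset.sum_congr rfl fun j _ => (integral_const_mul _ _).symm
  have hGz : ∀ z : Fin n → ℝ, ∑ i, ∑ j, z i * z j * G i j =
      (∫ s, (∑ i, z i * W i s) ^ 2 ∂ν) +
        (b ^ (2 * m))⁻¹ * ∫ s, (∑ i, z i * V i s) ^ 2 ∂ν := by
    intro z
    rw [← hquad W hWL z, ← hquad V hVL z, Finset.mul_sum, ← Finset.sum_add_distrib]
    refine Finset.sum_congr rfl fun i _ => ?_
    rw [Finset.mul_sum, ← Finset.sum_add_distrib]
    exact Finset.sum_congr rfl fun j _ => by simp only [hG]; ring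
  refine ⟨G, fun i => ?_, fun z => ?_, fun g hg z => ?_⟩
  · have h1 : ∫ s, W i s * W i s ∂ν ≤ (C * (|β i| ^ (0 + 1))⁻¹) ^ 2 * |β i| := by
      refine le_trans (le_of_eq ?_) (memLp_two_uIoc_and_integral_sq_le (hw i) (hwb i)).2
      rw [hW, hind]
      refine setIntegral_congr_fun (hSm i) fun s hs => ?_
      simp only [Set.indicator_of_mem hs]; ring
    have h2 : ∫ s, V i s * V i s ∂ν ≤ (C * |β i| ^ (m - 1 - 0)) ^ 2 * |β i| := by
      refine le_trans (le_of_eq ?_) (memLp_two_uIoc_and_integral_sq_le (hv i) (hvb i)).2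
      rw [hV, hind]
      refine setIntegral_congr_fun (hSm i) fun s hs => ?_
      simp only [Set.indicator_of_mem hs]; ring
    rw [hβ] at h1 h2
    have e1 : (C * ((b / 2) ^ (0 + 1))⁻¹) ^ 2 * (b / 2) = 2 * C ^ 2 / b := by
      field_simp; ring
    have e2 : (b ^ (2 * m))⁻¹ * ((C * (b / 2) ^ (m - 1 - 0)) ^ 2 * (b / 2)) ≤ 2 * C ^ 2 / b := by
      have hle : (b / 2) ^ (m - 1 - 0) ≤ b ^ (m - 1) := by
        rw [Nat.sub_zero]; exact pow_le_pow_left₀ (by positivity) (by linarith) _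
      have e3 : b ^ (2 * m) = (b ^ (m - 1)) ^ 2 * b * b := by
        obtain ⟨k, rfl⟩ : ∃ k, m = k + 1 := ⟨m - 1, by omega⟩
        simp only [Nat.add_sub_cancel]; ring
      calc (b ^ (2 * m))⁻¹ * ((C * (b / 2) ^ (m - 1 - 0)) ^ 2 * (b / 2))
          ≤ (b ^ (2 * m))⁻¹ * ((C * b ^ (m - 1)) ^ 2 * (b / 2)) := by gcongr
        _ = C ^ 2 / b / 2 := by rw [e3]; field_simp
        _ ≤ 2 * C ^ 2 / b := by
            have : 0 < C ^ 2 / b := by positivity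
            have e4 : 2 * C ^ 2 / b = 2 * (C ^ 2 / b) := by ring
            rw [e4]; linarith
    rw [e1] at h1
    have h3 := mul_le_mul_of_nonneg_left h2 (inv_nonneg.2 hlampos.le)
    have h4 : G i i ≤ 4 * C ^ 2 / b := by
      have : 4 * C ^ 2 / b = 2 * C ^ 2 / b + 2 * C ^ 2 / b := by ring
      simp only [hG]; linarith
    rw [le_div_iff₀ hb] at h4; linarith
  · rw [hGz]
    exact add_nonneg (integral_nonneg fun s => sq_nonneg _)
      (mul_nonneg (inv_nonneg.2 hlampos.le) (integral_nonneg fun s => sq_nonneg _))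
  · have hg0 := hg.memLp (Nat.zero_le m)
    rw [unitDeriv_zero] at hg0
    have hgm := hg.memLp (le_refl m)
    have hlin : ∀ (U : Fin n → ℝ → ℝ), (∀ i, MemLp (U i) 2 ν) → ∀ f : ℝ → ℝ, MemLp f 2 ν →
        ∫ s, (∑ i, z i * U i s) * f s ∂ν = ∑ i, z i * ∫ s, U i s * f s ∂ν := by
      intro U hU f hf
      simp only [Finset.sum_mul, mul_assoc]
      have hUf : ∀ i, Integrable (fun s => z i * (U i s * f s)) ν := fun i =>
        ((hU i).integrable_mul hf).const_mul _
      rw [integral_finsetSum _ fun i _ => hUf i]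
      exact Finset.sum_congr rfl fun i _ => integral_const_mul _ _
    have hrep' : ∑ i, z i * g (t i) = (∫ s, (∑ i, z i * V i s) * unitDeriv m g s ∂ν) +
        ∫ s, (∑ i, z i * W i s) * g s ∂ν := by
      rw [hlin V hVL _ hgm, hlin W hWL _ hg0, ← Finset.sum_add_distrib]
      refine Finset.sum_congr rfl fun i _ => ?_
      have := hrep i g hg
      rw [unitDeriv_zero] at this
      rw [this, hV, hW, hind, hind]; ring
    have hVs : MemLp (fun s => ∑ i, z i * V i s) 2 ν :=
      memLp_finsetSum _ fun i _ => (hVL i).const_mul _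
    have hWs : MemLp (fun s => ∑ i, z i * W i s) 2 ν :=
      memLp_finsetSum _ fun i _ => (hWL i).const_mul _
    have c1 := sq_integral_mul_le hVs hgm
    have c2 := sq_integral_mul_le hWs hg0
    rw [hrep', hGz, sobolevNormSq, l2NormSq_eq_setIntegral, l2NormSq_eq_setIntegral]
    set p := ∫ s, (∑ i, z i * V i s) * unitDeriv m g s ∂ν
    set q := ∫ s, (∑ i, z i * W i s) * g s ∂ν
    set A := ∫ s, (∑ i, z i * W i s) ^ 2 ∂ν with hA
    set B := ∫ s, (∑ i, z i * V i s) ^ 2 ∂ν with hB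
    set X := ∫ s in Set.Icc (0 : ℝ) 1, g s ^ 2 with hX
    set Y := ∫ s in Set.Icc (0 : ℝ) 1, unitDeriv m g s ^ 2 with hY
    have c1' : p ^ 2 ≤ B * Y := c1
    have c2' : q ^ 2 ≤ A * X := c2
    have hA0 : 0 ≤ A := integral_nonneg fun s => sq_nonneg _
    have hB0 : 0 ≤ B := integral_nonneg fun s => sq_nonneg _
    have hX0 : 0 ≤ X := integral_nonneg fun s => sq_nonneg _
    have hY0 : 0 ≤ Y := integral_nonneg fun s => sq_nonneg _
    set L := b ^ (2 * m)
    have hLi : L * L⁻¹ = 1 := mul_inv_cancel₀ hlampos.ne'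
    have hLi0 : 0 < L⁻¹ := inv_pos.2 hlampos
    -- The arithmetic-geometric mean inequality, weighted so that `(p + q)²` is bounded by the full
    -- product `(X + LY)(A + L⁻¹B)`.
    have hpq : 2 * (p * q) ≤ L * Y * A + L⁻¹ * B * X := by
      have h1 : (p * q) ^ 2 ≤ (L * Y * A) * (L⁻¹ * B * X) := by
        calc (p * q) ^ 2 = p ^ 2 * q ^ 2 := by ring
          _ ≤ (B * Y) * (A * X) := mul_le_mul c1' c2' (sq_nonneg _) (by positivity)
          _ = (L * L⁻¹) * ((B * Y) * (A * X)) := by rw [hLi, one_mul]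
          _ = _ := by ring
      have h2 : 0 ≤ L * Y * A := by positivity
      have h3 : 0 ≤ L⁻¹ * B * X := by positivity
      refine (le_abs_self _).trans (abs_le_of_sq_le_sq ?_ (by positivity))
      nlinarith [sq_nonneg (L * Y * A - L⁻¹ * B * X)]
    calc (p + q) ^ 2 = p ^ 2 + q ^ 2 + 2 * (p * q) := by ring
      _ ≤ B * Y + A * X + (L * Y * A + L⁻¹ * B * X) := by linarith
      _ = (L * L⁻¹) * (B * Y) + A * X + (L * Y * A + L⁻¹ * B * X) := by rw [hLi, one_mul]
      _ = (X + L * Y) * (A + L⁻¹ * B) := by ring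

/-- The Gram bound for a single design point with coefficient one. -/
theorem exists_sq_le_sobolevNormSq {m : ℕ} (hm : 1 ≤ m) :
    ∃ C : ℝ, 0 < C ∧ ∀ b : ℝ, 0 < b → b ≤ 1 → ∀ g : ℝ → ℝ, MemSobolev m g →
      ∀ x ∈ Set.Icc (0 : ℝ) 1, b * g x ^ 2 ≤ C * sobolevNormSq m (b ^ (2 * m)) g := by
  obtain ⟨C, hC, h⟩ := exists_gram hm
  refine ⟨C, hC, fun b hb hb1 g hg x hx => ?_⟩
  obtain ⟨G, hG1, -, hG3⟩ := h b hb hb1 1 (fun _ => x) (fun _ => hx)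
  have h1 := hG3 g hg (fun _ => 1)
  simp only [Finset.univ_unique, Finset.sum_singleton, one_mul] at h1
  have hN : 0 ≤ sobolevNormSq m (b ^ (2 * m)) g := sobolevNormSq_nonneg m (by positivity) g
  calc b * g x ^ 2 ≤ b * (sobolevNormSq m (b ^ (2 * m)) g * G default default) := by gcongr
    _ = sobolevNormSq m (b ^ (2 * m)) g * (b * G default default) := by ring
    _ ≤ sobolevNormSq m (b ^ (2 * m)) g * C := by gcongr; exact hG1 _
    _ = _ := mul_comm _ _

/-- Under a quasi-uniform design the empirical norm dominates the `L²` norm, up to a small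
multiple of the Sobolev norm. -/
theorem exists_l2NormSq_le_empirical {m : ℕ} (hm : 1 ≤ m) {t : (n : ℕ) → Fin n → ℝ}
    (hA4 : IsQuasiUniform t) :
    ∃ C : ℝ, 0 < C ∧ ∀ b : ℝ, 0 < b → b ≤ 1 → ∀ n : ℕ, 2 ≤ n → ∀ g : ℝ → ℝ, MemSobolev m g →
      l2NormSq g ≤ (1 / (n : ℝ)) * ∑ i, g (t n i) ^ 2 +
        C / (n * b ^ 2) * sobolevNormSq m (b ^ (2 * m)) g := by
  obtain ⟨C₀, hC₀⟩ := hA4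
  obtain ⟨C₁, hC₁, h₁⟩ := exists_sq_le_sobolevNormSq hm
  obtain ⟨C₂, hC₂, h₂⟩ := exists_l2NormSq_unitDeriv_le hm
  refine ⟨(|C₀| + 1) * (2 * (C₁ + C₂)), by positivity, fun b hb hb1 n hn g hg => ?_⟩
  have h := hC₀ n hn _ (hg.sq hm)
  set N := sobolevNormSq m (b ^ (2 * m)) g with hN
  have hN0 : 0 ≤ N := sobolevNormSq_nonneg m (by positivity) g
  have hnpos : (0 : ℝ) < n := by positivity
  -- With `(g²)' = 2gg'`, the sup bound `g² ≤ C₁N/b` and interpolation `‖g'‖² ≤ C₂N/b²` combine; `b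
  -- ≤ 1` weakens `1/b` to `1/b²`, which makes the bound a perfect square.
  have hd : l2NormSq (unitDeriv 1 fun x => g x ^ 2) ≤ (2 * (C₁ + C₂) * N / b ^ 2) ^ 2 := by
    rw [l2NormSq_congr_ae (hg.unitDeriv_sq hm)]
    have hI : l2NormSq (fun x => 2 * (g x * unitDeriv 1 g x)) ≤
        4 * (C₁ * N / b) * l2NormSq (unitDeriv 1 g) := by
      rw [l2NormSq_eq_setIntegral, l2NormSq_eq_setIntegral, ← integral_const_mul]
      refine setIntegral_mono_on (hg.memLp_mul_deriv hm).integrable_sq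
        ((hg.memLp hm).integrable_sq.const_mul _) measurableSet_Icc fun x hx => ?_
      have h3 := h₁ b hb hb1 g hg x hx
      have h4 : g x ^ 2 ≤ C₁ * N / b := by rw [le_div_iff₀ hb]; linarith
      have h5 := mul_le_mul_of_nonneg_right h4 (sq_nonneg (unitDeriv 1 g x))
      nlinarith
    have h6 := h₂ b hb hb1 g hg
    have h7 : l2NormSq (unitDeriv 1 g) ≤ C₂ * N / b ^ 2 := by
      rw [le_div_iff₀ (by positivity)]
      calc _ = b ^ (2 * 1) * l2NormSq (unitDeriv 1 g) := by ring
        _ ≤ _ := h6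
    have hb3 : C₁ * N / b ≤ C₁ * N / b ^ 2 := by
      apply div_le_div_of_nonneg_left (by positivity) (by positivity)
      nlinarith
    calc _ ≤ 4 * (C₁ * N / b) * l2NormSq (unitDeriv 1 g) := hI
      _ ≤ 4 * (C₁ * N / b ^ 2) * (C₂ * N / b ^ 2) := by
          have := l2NormSq_nonneg (unitDeriv 1 g)
          gcongr
      _ = 4 * (C₁ * C₂) * (N / b ^ 2) ^ 2 := by ring
      _ ≤ (2 * (C₁ + C₂)) ^ 2 * (N / b ^ 2) ^ 2 := by
          refine mul_le_mul_of_nonneg_right ?_ (sq_nonneg _)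
          nlinarith [mul_pos hC₁ hC₂]
      _ = _ := by ring
  have hsq : Real.sqrt (l2NormSq (unitDeriv 1 fun x => g x ^ 2)) ≤
      2 * (C₁ + C₂) * N / b ^ 2 := by
    rw [← Real.sqrt_sq (show 0 ≤ 2 * (C₁ + C₂) * N / b ^ 2 by positivity)]
    exact Real.sqrt_le_sqrt hd
  have hfin : C₀ / n * Real.sqrt (l2NormSq (unitDeriv 1 fun x => g x ^ 2)) ≤
      (|C₀| + 1) * (2 * (C₁ + C₂)) / (n * b ^ 2) * N := by
    calc C₀ / n * Real.sqrt (l2NormSq (unitDeriv 1 fun x => g x ^ 2))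
        ≤ (|C₀| + 1) / n * Real.sqrt (l2NormSq (unitDeriv 1 fun x => g x ^ 2)) := by
          gcongr; linarith [le_abs_self C₀]
      _ ≤ (|C₀| + 1) / n * (2 * (C₁ + C₂) * N / b ^ 2) := by gcongr
      _ = _ := by field_simp
  have := (abs_le.1 (h.trans hfin)).1
  simp only [l2NormSq] at *
  linarith

/-! ### Maxima over finite index sets -/

section FinMax

variable {ι : Type*} [Fintype ι] [Nonempty ι]

/-- The maximum of a real function on a finite nonempty type. -/
def finMax (F : ι → ℝ) : ℝ := Finset.univ.sup' Finset.univ_nonempty F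

theorem le_finMax (F : ι → ℝ) (i : ι) : F i ≤ finMax F := Finset.le_sup' F (Finset.mem_univ i)

theorem finMax_le {F : ι → ℝ} {a : ℝ} (h : ∀ i, F i ≤ a) : finMax F ≤ a :=
  Finset.sup'_le _ _ fun i _ => h i

theorem exists_eq_finMax (F : ι → ℝ) : ∃ i, finMax F = F i := by
  obtain ⟨i, -, hi⟩ := Finset.exists_mem_eq_sup' Finset.univ_nonempty F
  exact ⟨i, hi⟩

theorem abs_finMax_le (F : ι → ℝ) : |finMax F| ≤ ∑ i, |F i| := by
  obtain ⟨i, hi⟩ := exists_eq_finMax F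
  rw [hi]
  exact Finset.single_le_sum (f := fun i => |F i|) (fun i _ => abs_nonneg _) (Finset.mem_univ i)

theorem continuous_finMax : Continuous (finMax : (ι → ℝ) → ℝ) :=
  Continuous.finset_sup'_apply Finset.univ_nonempty fun i _ => continuous_apply i

theorem integrable_finMax {α : Type*} [MeasurableSpace α] {ν : Measure α} {F : α → ι → ℝ}
    (hF : ∀ i, Integrable (fun x => F x i) ν) : Integrable (fun x => finMax (F x)) ν := by
  refine (integrable_finsetSum Finset.univ fun i _ => (hF i).abs).mono'
    (continuous_finMax.measurable.comp_aemeasurable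
      (aemeasurable_pi_iff.2 fun i =>
        (hF i).aestronglyMeasurable.aemeasurable)).aestronglyMeasurable
    (Eventually.of_forall fun x => abs_finMax_le (F x))

end FinMax

/-! ### Symmetrization and contraction, one coordinate at a time -/

section OneStep

variable {ν : Measure ℝ}

/-- The law of `σ (D(X) + D(X'))`, where `X`, `X'` are independent with law `ν` and `σ` is an
independent random sign. -/
def signedSumLaw (ν : Measure ℝ) (D : ℝ → ℝ) : Measure ℝ :=
  (2⁻¹ : ENNReal) • (ν.prod ν).map (fun p => D p.1 + D p.2) +
    (2⁻¹ : ENNReal) • (ν.prod ν).map (fun p => -(D p.1 + D p.2))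

theorem measurable_sum_prod {D : ℝ → ℝ} (hD : Measurable D) :
    Measurable (fun p : ℝ × ℝ => D p.1 + D p.2) :=
  (hD.comp measurable_fst).add (hD.comp measurable_snd)

theorem measurable_neg_sum_prod {D : ℝ → ℝ} (hD : Measurable D) :
    Measurable (fun p : ℝ × ℝ => -(D p.1 + D p.2)) :=
  (measurable_sum_prod hD).neg

theorem isProbabilityMeasure_signedSumLaw [IsProbabilityMeasure ν] {D : ℝ → ℝ} (hD : Measurable D) :
    IsProbabilityMeasure (signedSumLaw ν D) := by
  have h1 := measurable_sum_prod hD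
  constructor
  rw [signedSumLaw, Measure.add_apply, Measure.smul_apply, Measure.smul_apply,
    Measure.map_apply h1 MeasurableSet.univ,
    Measure.map_apply (measurable_neg_sum_prod hD) MeasurableSet.univ]
  simp [ENNReal.inv_two_add_inv_two]

theorem integrable_signedSumLaw {D F : ℝ → ℝ} (hD : Measurable D) (hF : Continuous F)
    (h1 : Integrable (fun p : ℝ × ℝ => F (D p.1 + D p.2)) (ν.prod ν))
    (h2 : Integrable (fun p : ℝ × ℝ => F (-(D p.1 + D p.2))) (ν.prod ν)) :
    Integrable F (signedSumLaw ν D) := by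
  have hm := measurable_sum_prod hD
  have hm' := measurable_neg_sum_prod hD
  refine Integrable.add_measure (Integrable.smul_measure ?_ (by simp))
    (Integrable.smul_measure ?_ (by simp))
  · exact (integrable_map_measure hF.aestronglyMeasurable hm.aemeasurable).2 h1
  · exact (integrable_map_measure hF.aestronglyMeasurable hm'.aemeasurable).2 h2

theorem integral_signedSumLaw {D F : ℝ → ℝ} (hD : Measurable D) (hF : Continuous F)
    (h1 : Integrable (fun p : ℝ × ℝ => F (D p.1 + D p.2)) (ν.prod ν))
    (h2 : Integrable (fun p : ℝ × ℝ => F (-(D p.1 + D p.2))) (ν.prod ν)) :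
    ∫ z, F z ∂(signedSumLaw ν D) =
      2⁻¹ * ∫ p, (F (D p.1 + D p.2) + F (-(D p.1 + D p.2))) ∂(ν.prod ν) := by
  have hm := measurable_sum_prod hD
  have hm' := measurable_neg_sum_prod hD
  rw [signedSumLaw, integral_add_measure
    (Integrable.smul_measure ((integrable_map_measure hF.aestronglyMeasurable
      hm.aemeasurable).2 h1) (by simp))
    (Integrable.smul_measure ((integrable_map_measure hF.aestronglyMeasurable
      hm'.aemeasurable).2 h2) (by simp)),
    integral_smul_measure, integral_smul_measure,
    integral_map hm.aemeasurable hF.aestronglyMeasurable,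
    integral_map hm'.aemeasurable hF.aestronglyMeasurable, integral_add h1 h2]
  simp; ring

variable [IsProbabilityMeasure ν]

theorem integrable_comp_fst {f : ℝ → ℝ} (hf : Integrable f ν) :
    Integrable (fun p : ℝ × ℝ => f p.1) (ν.prod ν) := hf.comp_fst ν

theorem integrable_comp_snd {f : ℝ → ℝ} (hf : Integrable f ν) :
    Integrable (fun p : ℝ × ℝ => f p.2) (ν.prod ν) := hf.comp_snd ν

theorem integrable_id_signedSumLaw {D : ℝ → ℝ} (hD : Measurable D) (hDi : Integrable D ν) :
    Integrable (fun z => z) (signedSumLaw ν D) := by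
  have h := (integrable_comp_fst hDi).add (integrable_comp_snd hDi)
  exact integrable_signedSumLaw hD continuous_id h h.neg

theorem integral_id_signedSumLaw {D : ℝ → ℝ} (hD : Measurable D) (hDi : Integrable D ν) :
    ∫ z, z ∂(signedSumLaw ν D) = 0 := by
  have h := (integrable_comp_fst hDi).add (integrable_comp_snd hDi)
  rw [integral_signedSumLaw (F := fun z => z) hD continuous_id h h.neg]
  simp

theorem integrable_sq_sum_prod {D : ℝ → ℝ} (hDi : MemLp D 2 ν) :
    Integrable (fun p : ℝ × ℝ => (D p.1 + D p.2) ^ 2) (ν.prod ν) :=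
  ((hDi.comp_fst ν).add (hDi.comp_snd ν)).integrable_sq

theorem memLp_id_signedSumLaw {D : ℝ → ℝ} (hD : Measurable D) (hDi : MemLp D 2 ν) :
    MemLp (fun z => z) 2 (signedSumLaw ν D) := by
  rw [memLp_two_iff_integrable_sq measurable_id'.aestronglyMeasurable]
  have h := integrable_sq_sum_prod hDi
  exact integrable_signedSumLaw hD (continuous_pow 2) h (by simpa only [neg_sq] using h)

theorem integral_sq_signedSumLaw_le {D : ℝ → ℝ} (hD : Measurable D) (hDi : MemLp D 2 ν) :
    ∫ z, z ^ 2 ∂(signedSumLaw ν D) ≤ 4 * ∫ x, D x ^ 2 ∂ν := by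
  have h := integrable_sq_sum_prod hDi
  have h1 := integrable_comp_fst hDi.integrable_sq
  have h2 := integrable_comp_snd hDi.integrable_sq
  rw [integral_signedSumLaw (F := fun z => z ^ 2) hD (continuous_pow 2) h
    (by simpa only [neg_sq] using h)]
  have e1 : ∫ p : ℝ × ℝ, D p.1 ^ 2 ∂(ν.prod ν) = ∫ x, D x ^ 2 ∂ν := by
    rw [integral_fun_fst (fun x => D x ^ 2)]; simp
  have e2 : ∫ p : ℝ × ℝ, D p.2 ^ 2 ∂(ν.prod ν) = ∫ x, D x ^ 2 ∂ν := by
    rw [integral_fun_snd (fun x => D x ^ 2)]; simp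
  have : ∫ p : ℝ × ℝ, ((D p.1 + D p.2) ^ 2 + (-(D p.1 + D p.2)) ^ 2) ∂(ν.prod ν) ≤
      ∫ p : ℝ × ℝ, (4 * D p.1 ^ 2 + 4 * D p.2 ^ 2) ∂(ν.prod ν) := by
    refine integral_mono (h.add (by simpa only [neg_sq] using h))
      ((h1.const_mul 4).add (h2.const_mul 4))
      fun p => ?_
    simp only
    nlinarith [sq_nonneg (D p.1 - D p.2)]
  rw [integral_add (h1.const_mul 4) (h2.const_mul 4), integral_const_mul, integral_const_mul,
    e1, e2] at this
  linarith

/-- Symmetrization and contraction in one coordinate. -/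
theorem integral_finMax_centered_le {ι : Type*} [Fintype ι] [Nonempty ι] {D : ℝ → ℝ}
    (hD : Measurable D) (hDi : Integrable D ν) (φ : ℝ → ι → ℝ) (c : ι → ℝ)
    (hφ : ∀ i, Integrable (fun x => φ x i) ν)
    (hlip : ∀ x i k, φ x i - φ x k ≤ D x * |c i - c k|) (A : ι → ℝ) :
    ∫ x, finMax (fun i => A i + ((∫ y, φ y i ∂ν) - φ x i)) ∂ν ≤
      ∫ z, finMax (fun i => A i + z * c i) ∂(signedSumLaw ν D) := by
  -- The mean of `φ` is replaced by an independent copy; pulling that integral out of the maximum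
  -- only increases the value.
  set M : ℝ × ℝ → ℝ := fun p => finMax (fun i => A i + (φ p.2 i - φ p.1 i)) with hM
  have hMint : Integrable M (ν.prod ν) := integrable_finMax fun i =>
    (integrable_const (A i)).add ((integrable_comp_snd (hφ i)).sub (integrable_comp_fst (hφ i)))
  have hstep1 : ∫ x, finMax (fun i => A i + ((∫ y, φ y i ∂ν) - φ x i)) ∂ν ≤
      ∫ p, M p ∂(ν.prod ν) := by
    rw [integral_prod _ hMint]
    refine integral_mono (integrable_finMax fun i =>
      (integrable_const (A i)).add ((integrable_const _).sub (hφ i))) hMint.integral_prod_left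
      fun x => finMax_le fun i => ?_
    have hi : Integrable (fun y => A i + (φ y i - φ x i)) ν :=
      (integrable_const (A i)).add ((hφ i).sub (integrable_const _))
    have he : A i + ((∫ y, φ y i ∂ν) - φ x i) = ∫ y, (A i + (φ y i - φ x i)) ∂ν := by
      have hs : Integrable (fun y => φ y i - φ x i) ν := (hφ i).sub (integrable_const _)
      rw [integral_add (integrable_const _) hs, integral_sub (hφ i) (integrable_const _)]
      simp
    rw [he]
    have hs : Integrable (fun y => finMax (fun i => A i + (φ y i - φ x i))) ν :=
      integrable_finMax fun i => (integrable_const (A i)).add ((hφ i).sub (integrable_const _))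
    exact integral_mono hi hs fun y => le_finMax (fun i => A i + (φ y i - φ x i)) i
  have hcont : Continuous (fun z : ℝ => finMax (fun i => A i + z * c i)) :=
    continuous_finMax.comp (by fun_prop)
  have hd := (integrable_comp_fst hDi).add (integrable_comp_snd hDi)
  have hI1 : Integrable (fun p : ℝ × ℝ => finMax (fun i => A i + (D p.1 + D p.2) * c i))
      (ν.prod ν) := integrable_finMax fun i => (integrable_const (A i)).add (hd.mul_const (c i))
  have hI2 : Integrable (fun p : ℝ × ℝ => finMax (fun i => A i + -(D p.1 + D p.2) * c i))
      (ν.prod ν) := integrable_finMax fun i =>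
        (integrable_const (A i)).add (hd.neg.mul_const (c i))
  refine hstep1.trans ?_
  rw [integral_signedSumLaw (F := fun z => finMax (fun i => A i + z * c i)) hD hcont hI1 hI2]
  have hswap : ∫ p, M p.swap ∂(ν.prod ν) = ∫ p, M p ∂(ν.prod ν) := integral_prod_swap M
  have hMs : Integrable (fun p : ℝ × ℝ => M p.swap) (ν.prod ν) := hMint.swap
  -- Exchanging the two copies plays the role of the random sign.
  have hsum : 2 * ∫ p, M p ∂(ν.prod ν) = ∫ p, (M p + M p.swap) ∂(ν.prod ν) := by
    rw [integral_add hMint hMs, hswap]; ring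
  have hle : ∫ p, (M p + M p.swap) ∂(ν.prod ν) ≤
      ∫ p, (finMax (fun i => A i + (D p.1 + D p.2) * c i) +
        finMax (fun i => A i + -(D p.1 + D p.2) * c i)) ∂(ν.prod ν) := by
    refine integral_mono (hMint.add hMs) (hI1.add hI2) fun p => ?_
    obtain ⟨x, y⟩ := p
    simp only [hM, Prod.swap]
    -- For maximizers `i`, `k` of the two maxima, the differences of `φ` add up to at most `(D x + D
    -- y)|c i - c k|`. The sign of `c i - c k` decides which index is tested with `+(D x + D y)` and
    -- which with its negative.
    obtain ⟨i, hi⟩ := exists_eq_finMax (fun i => A i + (φ y i - φ x i))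
    obtain ⟨k, hk⟩ := exists_eq_finMax (fun i => A i + (φ x i - φ y i))
    rw [hi, hk]
    have h1 := hlip y i k
    have h2 := hlip x k i
    rw [abs_sub_comm] at h2
    have a1 := le_finMax (fun i => A i + (D x + D y) * c i) i
    have a2 := le_finMax (fun i => A i + (D x + D y) * c i) k
    have b1 := le_finMax (fun i => A i + -(D x + D y) * c i) i
    have b2 := le_finMax (fun i => A i + -(D x + D y) * c i) k
    rcases le_total 0 (c i - c k) with h | h
    · rw [abs_of_nonneg h] at h1 h2
      linarith
    · rw [abs_of_nonpos h] at h1 h2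
      linarith
  linarith

end OneStep

/-! ### Tensorization -/

section Tensor

theorem integral_pi_succ {n : ℕ} (ν : Measure ℝ) [IsProbabilityMeasure ν]
    (F : (Fin (n + 1) → ℝ) → ℝ) :
    ∫ x, F x ∂(Measure.pi fun _ : Fin (n + 1) => ν) =
      ∫ p : ℝ × (Fin n → ℝ), F (Fin.cons p.1 p.2) ∂(ν.prod (Measure.pi fun _ : Fin n => ν)) := by
  rw [← ((measurePreserving_piFinSuccAbove (fun _ : Fin (n + 1) => ν) 0).symm).integral_comp']
  simp [MeasurableEquiv.piFinSuccAbove_symm_apply, Fin.insertNthEquiv]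

theorem integrable_eval_pi {n : ℕ} {ν : Measure ℝ} [IsProbabilityMeasure ν] {f : ℝ → ℝ}
    (hf : Integrable f ν) (i : Fin n) :
    Integrable (fun x : Fin n → ℝ => f (x i)) (Measure.pi fun _ : Fin n => ν) :=
  (measurePreserving_eval (fun _ : Fin n => ν) i).integrable_comp_of_integrable hf

/-- Coordinates are exchanged one at a time under Fubini. The offset `A` in the one-step hypothesis
is arbitrary precisely so that it can absorb the contribution of all the other coordinates. -/
theorem integral_finMax_sum_le {ι : Type*} [Fintype ι] [Nonempty ι] {ν π : Measure ℝ}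
    [IsProbabilityMeasure ν] [IsProbabilityMeasure π] (hπ : Integrable (fun z => z) π)
    {n : ℕ} (h : Fin n → ℝ → ι → ℝ) (c : Fin n → ι → ℝ)
    (hh : ∀ i k, Integrable (fun x => h i x k) ν)
    (hstep : ∀ i (A : ι → ℝ), ∫ x, finMax (fun k => A k + h i x k) ∂ν ≤
      ∫ z, finMax (fun k => A k + z * c i k) ∂π) (A : ι → ℝ) :
    ∫ x, finMax (fun k => A k + ∑ i, h i (x i) k) ∂(Measure.pi fun _ : Fin n => ν) ≤
      ∫ z, finMax (fun k => A k + ∑ i, z i * c i k) ∂(Measure.pi fun _ : Fin n => π) := by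
  induction n generalizing A with
  | zero => simp
  | succ n ih =>
    rw [integral_pi_succ, integral_pi_succ]
    simp only [Fin.sum_univ_succ, Fin.cons_zero, Fin.cons_succ]
    have hνs : ∀ k, Integrable (fun x : Fin n → ℝ => ∑ i, h i.succ (x i) k)
        (Measure.pi fun _ : Fin n => ν) := fun k =>
      integrable_finsetSum _ fun i _ => integrable_eval_pi (hh i.succ k) i
    have hπs : ∀ k, Integrable (fun z : Fin n → ℝ => ∑ i, z i * c i.succ k)
        (Measure.pi fun _ : Fin n => π) := fun k =>
      integrable_finsetSum _ fun i _ => (integrable_eval_pi hπ i).mul_const _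
    have hint1 : Integrable (fun p : ℝ × (Fin n → ℝ) =>
        finMax (fun k => A k + (h 0 p.1 k + ∑ i : Fin n, h i.succ (p.2 i) k)))
        (ν.prod (Measure.pi fun _ : Fin n => ν)) := integrable_finMax fun k =>
      (integrable_const _).add (((hh 0 k).comp_fst _).add ((hνs k).comp_snd _))
    have hint2 : Integrable (fun p : ℝ × (Fin n → ℝ) =>
        finMax (fun k => A k + (p.1 * c 0 k + ∑ i : Fin n, h i.succ (p.2 i) k)))
        (π.prod (Measure.pi fun _ : Fin n => ν)) := integrable_finMax fun k =>
      (integrable_const _).add (((hπ.mul_const _).comp_fst _).add ((hνs k).comp_snd _))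
    have hint3 : Integrable (fun p : ℝ × (Fin n → ℝ) =>
        finMax (fun k => A k + (p.1 * c 0 k + ∑ i : Fin n, p.2 i * c i.succ k)))
        (π.prod (Measure.pi fun _ : Fin n => π)) := integrable_finMax fun k =>
      (integrable_const _).add (((hπ.mul_const _).comp_fst _).add ((hπs k).comp_snd _))
    calc ∫ p : ℝ × (Fin n → ℝ),
          finMax (fun k => A k + (h 0 p.1 k + ∑ i : Fin n, h i.succ (p.2 i) k))
          ∂(ν.prod (Measure.pi fun _ : Fin n => ν))
        = ∫ x : Fin n → ℝ, ∫ x₀,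
            finMax (fun k => A k + (h 0 x₀ k + ∑ i : Fin n, h i.succ (x i) k)) ∂ν
            ∂(Measure.pi fun _ : Fin n => ν) := integral_prod_symm _ hint1
      _ ≤ ∫ x : Fin n → ℝ, ∫ z₀,
            finMax (fun k => A k + (z₀ * c 0 k + ∑ i : Fin n, h i.succ (x i) k)) ∂π
            ∂(Measure.pi fun _ : Fin n => ν) := by
          refine integral_mono hint1.integral_prod_right hint2.integral_prod_right fun x => ?_
          have := hstep 0 (fun k => A k + ∑ i : Fin n, h i.succ (x i) k)
          simpa only [add_assoc, add_comm (∑ i : Fin n, h i.succ (x i) _)] using this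
      _ = ∫ p : ℝ × (Fin n → ℝ),
            finMax (fun k => A k + (p.1 * c 0 k + ∑ i : Fin n, h i.succ (p.2 i) k))
            ∂(π.prod (Measure.pi fun _ : Fin n => ν)) := (integral_prod_symm _ hint2).symm
      _ = ∫ z₀, ∫ x : Fin n → ℝ,
            finMax (fun k => A k + (z₀ * c 0 k + ∑ i : Fin n, h i.succ (x i) k))
            ∂(Measure.pi fun _ : Fin n => ν) ∂π := integral_prod _ hint2
      _ ≤ ∫ z₀, ∫ z : Fin n → ℝ,
            finMax (fun k => A k + (z₀ * c 0 k + ∑ i : Fin n, z i * c i.succ k))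
            ∂(Measure.pi fun _ : Fin n => π) ∂π := by
          refine integral_mono hint2.integral_prod_left hint3.integral_prod_left fun z₀ => ?_
          have := ih (fun i => h i.succ) (fun i => c i.succ) (fun i k => hh i.succ k)
            (fun i A => hstep i.succ A) (fun k => A k + z₀ * c 0 k)
          simpa only [add_assoc] using this
      _ = _ := (integral_prod _ hint3).symm

end Tensor

/-! ### Quadratic forms in independent centred variables -/

/-- Independence and centring kill the off-diagonal terms, so only the diagonal of `G` matters. -/
theorem integral_quadraticForm {Ω : Type*} [MeasurableSpace Ω] {μ : Measure Ω}
    [IsProbabilityMeasure μ] {n : ℕ} {X : Fin n → Ω → ℝ} (hX : ∀ i, MemLp (X i) 2 μ)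
    (hind : ∀ i j, i ≠ j → IndepFun (X i) (X j) μ) (hmean : ∀ i, ∫ ω, X i ω ∂μ = 0)
    (G : Fin n → Fin n → ℝ) :
    Integrable (fun ω => ∑ i, ∑ j, X i ω * X j ω * G i j) μ ∧
      ∫ ω, ∑ i, ∑ j, X i ω * X j ω * G i j ∂μ = ∑ i, (∫ ω, X i ω ^ 2 ∂μ) * G i i := by
  have hint : ∀ i j, Integrable (fun ω => X i ω * X j ω * G i j) μ := fun i j =>
    ((hX i).integrable_mul (hX j)).mul_const _
  refine ⟨integrable_finsetSum _ fun i _ => integrable_finsetSum _ fun j _ => hint i j, ?_⟩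
  rw [integral_finsetSum _ fun i _ => integrable_finsetSum _ fun j _ => hint i j]
  refine Finset.sum_congr rfl fun i _ => ?_
  rw [integral_finsetSum _ fun j _ => hint i j, Finset.sum_eq_single i]
  · rw [integral_mul_const]
    simp only [sq]
  · intro j _ hji
    rw [integral_mul_const]
    have := (hind i j hji.symm).integral_mul_eq_mul_integral (hX i).1 (hX j).1
    have h2 : ∫ ω, X i ω * X j ω ∂μ = (∫ ω, X i ω ∂μ) * ∫ ω, X j ω ∂μ := this
    rw [h2, hmean i]; ring
  · simp

/-- Jensen's inequality for the square root. -/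
theorem integral_sqrt_le {Ω : Type*} [MeasurableSpace Ω] {μ : Measure Ω}
    [IsProbabilityMeasure μ] {Q : Ω → ℝ} (hQ : Integrable Q μ) (h0 : ∀ ω, 0 ≤ Q ω) :
    Integrable (fun ω => Real.sqrt (Q ω)) μ ∧
      ∫ ω, Real.sqrt (Q ω) ∂μ ≤ Real.sqrt (∫ ω, Q ω ∂μ) := by
  have hm : AEStronglyMeasurable (fun ω => Real.sqrt (Q ω)) μ :=
    Real.continuous_sqrt.comp_aestronglyMeasurable hQ.1
  have hL : MemLp (fun ω => Real.sqrt (Q ω)) 2 μ := by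
    rw [memLp_two_iff_integrable_sq hm]
    simpa only [Real.sq_sqrt (h0 _)] using hQ
  refine ⟨hL.integrable (by norm_num), Real.le_sqrt_of_sq_le ?_⟩
  have := sq_integral_mul_le hL (memLp_const (1 : ℝ))
  simpa [Real.sq_sqrt (h0 _)] using this

/-- All the linear functionals share one pointwise majorant, the root of a quadratic form, whose
mean is controlled by a trace. The bound does not depend on the size of `ι`, which is what later
permits infinite index sets. -/
theorem integral_finMax_linear_le {ι : Type*} [Fintype ι] [Nonempty ι] {π : Measure ℝ}
    [IsProbabilityMeasure π] (hπ : MemLp (fun z => z) 2 π) (hπ0 : ∫ z, z ∂π = 0) {n : ℕ}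
    (G : Fin n → Fin n → ℝ) (hG : ∀ z : Fin n → ℝ, 0 ≤ ∑ i, ∑ j, z i * z j * G i j)
    {τ : ℝ} (hτ : 0 ≤ τ) (u : ι → Fin n → ℝ)
    (hu : ∀ k, ∀ z : Fin n → ℝ, ∑ i, z i * u k i ≤ τ * Real.sqrt (∑ i, ∑ j, z i * z j * G i j)) :
    ∫ z, finMax (fun k => ∑ i, z i * u k i) ∂(Measure.pi fun _ : Fin n => π) ≤
      τ * Real.sqrt ((∫ z, z ^ 2 ∂π) * ∑ i, G i i) := by
  have hmp : ∀ i : Fin n, MeasurePreserving (Function.eval i)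
      (Measure.pi fun _ : Fin n => π) π := fun i => measurePreserving_eval (fun _ => π) i
  have hX : ∀ i : Fin n, MemLp (fun z : Fin n → ℝ => z i) 2 (Measure.pi fun _ : Fin n => π) :=
    fun i => hπ.comp_measurePreserving (hmp i)
  have hI := iIndepFun_pi (μ := fun _ : Fin n => π) (X := fun _ z => z)
    (fun _ => measurable_id.aemeasurable)
  have hint : ∀ (f : ℝ → ℝ) (_ : Continuous f) (i : Fin n),
      ∫ z : Fin n → ℝ, f (z i) ∂(Measure.pi fun _ : Fin n => π) = ∫ z, f z ∂π := by
    intro f hf i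
    have := integral_map (hmp i).measurable.aemeasurable
      (hf.aestronglyMeasurable (μ := (Measure.pi fun _ : Fin n => π).map (Function.eval i)))
    rw [(hmp i).map_eq] at this
    exact this.symm
  obtain ⟨hQ1, hQ2⟩ := integral_quadraticForm hX (fun i j hij => hI.indepFun hij)
    (fun i => by rw [hint (fun z => z) continuous_id i, hπ0]) G
  simp only [hint (fun z => z ^ 2) (continuous_pow 2), ← Finset.mul_sum] at hQ2
  obtain ⟨hS1, hS2⟩ := integral_sqrt_le hQ1 hG
  rw [hQ2] at hS2
  calc _ ≤ ∫ z : Fin n → ℝ, τ * Real.sqrt (∑ i, ∑ j, z i * z j * G i j)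
        ∂(Measure.pi fun _ : Fin n => π) := by
        refine integral_mono (integrable_finMax fun k => integrable_finsetSum _ fun i _ =>
          ((hX i).integrable (by norm_num)).mul_const _) (hS1.const_mul τ)
          fun z => finMax_le fun k => hu k z
    _ ≤ _ := by
        rw [integral_const_mul]
        exact mul_le_mul_of_nonneg_left hS2 hτ

/-! ### Uniform bounds for sums of independent processes with Lipschitz paths -/

theorem gram_diag_nonneg {n : ℕ} {G : Fin n → Fin n → ℝ}
    (hG : ∀ z : Fin n → ℝ, 0 ≤ ∑ i, ∑ j, z i * z j * G i j) (i : Fin n) : 0 ≤ G i i := by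
  have := hG (Pi.single i 1)
  simpa [Pi.single_apply, Finset.sum_ite_eq] using this

theorem continuousOn_of_sub_le_mul_abs {p : ℝ → ℝ} {η K : ℝ} (hK : 0 ≤ K)
    (h : ∀ u v, |u| ≤ η → |v| ≤ η → p u - p v ≤ K * |u - v|) :
    ContinuousOn p {u | |u| ≤ η} := by
  refine (LipschitzOnWith.of_dist_le_mul (K := ⟨K, hK⟩) fun u hu v hv => ?_).continuousOn
  rw [Real.dist_eq, Real.dist_eq, abs_sub_le_iff]
  refine ⟨h u v hu hv, ?_⟩
  rw [abs_sub_comm u v]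
  exact h v u hv hu

section UniformBound

variable {Ω : Type*} [MeasurableSpace Ω] {μ : Measure Ω} [IsProbabilityMeasure μ]
  {ν : Measure ℝ} {n : ℕ} {X : Fin n → Ω → ℝ}
  {φ : ℝ → ℝ → ℝ} {D : ℝ → ℝ} {η τ : ℝ} {G : Fin n → Fin n → ℝ}

/-- Symmetrization, tensorization and the trace bound estimate the expected maximum; Markov's
inequality turns this into a probability. -/
theorem measure_finite_exists_lt_le [IsProbabilityMeasure ν]
    (hX : ∀ i, Measurable (X i)) (hind : iIndepFun X μ)
    (hlaw : ∀ i, μ.map (X i) = ν) (hη : 0 ≤ η) (hD : Measurable D) (hD2 : MemLp D 2 ν)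
    (hφ0 : ∀ e, φ e 0 = 0)
    (hφi : ∀ u, |u| ≤ η → Integrable (fun e => φ e u) ν)
    (hlip : ∀ e u v, |u| ≤ η → |v| ≤ η → φ e u - φ e v ≤ D e * |u - v|)
    (hG : ∀ z : Fin n → ℝ, 0 ≤ ∑ i, ∑ j, z i * z j * G i j) (hτ : 0 ≤ τ)
    {N : ℕ} (s : Fin (N + 1) → Fin n → ℝ) (hsη : ∀ k i, |s k i| ≤ η)
    (hs : ∀ k, ∀ z : Fin n → ℝ,
      ∑ i, z i * s k i ≤ τ * Real.sqrt (∑ i, ∑ j, z i * z j * G i j)) {a : ℝ} (ha : 0 < a) :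
    μ {ω | ∃ k, a < ∑ i, ((∫ e, φ e (s k i) ∂ν) - φ (X i ω) (s k i))} ≤
      ENNReal.ofReal (τ * Real.sqrt (4 * (∫ e, D e ^ 2 ∂ν) * ∑ i, G i i) / a) := by
  -- The extra index `none` stands for the zero vector, where the process vanishes; the maximum is
  -- then nonnegative, as Markov's inequality requires.
  set s' : Option (Fin (N + 1)) → Fin n → ℝ := fun o => o.elim 0 s with hs'
  have hs'η : ∀ k i, |s' k i| ≤ η := by
    rintro (_ | k) i
    · simpa [hs'] using hη
    · exact hsη k i
  have hs'z : ∀ k, ∀ z : Fin n → ℝ,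
      ∑ i, z i * s' k i ≤ τ * Real.sqrt (∑ i, ∑ j, z i * z j * G i j) := by
    rintro (_ | k) z
    · simpa [hs'] using mul_nonneg hτ (Real.sqrt_nonneg _)
    · exact hs k z
  set h : Fin n → ℝ → Option (Fin (N + 1)) → ℝ := fun i x k =>
    (∫ e, φ e (s' k i) ∂ν) - φ x (s' k i) with hh
  have hhi : ∀ i k, Integrable (fun x => h i x k) ν := fun i k =>
    (integrable_const _).sub (hφi _ (hs'η k i))
  have hπ := isProbabilityMeasure_signedSumLaw (ν := ν) hD
  have hDi : Integrable D ν := hD2.integrable (by norm_num)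
  have hstep : ∀ i (A : Option (Fin (N + 1)) → ℝ), ∫ x, finMax (fun k => A k + h i x k) ∂ν ≤
      ∫ z, finMax (fun k => A k + z * s' k i) ∂(signedSumLaw ν D) := fun i A =>
    integral_finMax_centered_le hD hDi (fun x k => φ x (s' k i)) (fun k => s' k i)
      (fun k => hφi _ (hs'η k i)) (fun x k l => hlip x _ _ (hs'η k i) (hs'η l i)) A
  have hten := integral_finMax_sum_le (integrable_id_signedSumLaw hD hDi) h
    (fun i k => s' k i) hhi hstep 0
  simp only [Pi.zero_apply, zero_add] at hten
  have hlin := integral_finMax_linear_le (memLp_id_signedSumLaw hD hD2)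
    (integral_id_signedSumLaw hD hDi) G hG hτ s' hs'z
  have htr : 0 ≤ ∑ i, G i i := Finset.sum_nonneg fun i _ => gram_diag_nonneg hG i
  have hbound : ∫ x, finMax (fun k => ∑ i, h i (x i) k) ∂(Measure.pi fun _ : Fin n => ν) ≤
      τ * Real.sqrt (4 * (∫ e, D e ^ 2 ∂ν) * ∑ i, G i i) := by
    refine (hten.trans hlin).trans (mul_le_mul_of_nonneg_left (Real.sqrt_le_sqrt ?_) hτ)
    exact mul_le_mul_of_nonneg_right (integral_sq_signedSumLaw_le hD hD2) htr
  have hmap : μ.map (fun ω i => X i ω) = Measure.pi fun _ : Fin n => ν := by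
    rw [hind.map_fun_eq_pi_map fun i => (hX i).aemeasurable]
    simp only [hlaw]
  have hXm : Measurable (fun ω i => X i ω) := measurable_pi_lambda _ hX
  have hint : Integrable (fun x : Fin n → ℝ => finMax (fun k => ∑ i, h i (x i) k))
      (Measure.pi fun _ : Fin n => ν) := integrable_finMax fun k =>
    integrable_finsetSum _ fun i _ => integrable_eval_pi (hhi i k) i
  have hint' : Integrable (fun ω => finMax (fun k => ∑ i, h i (X i ω) k)) μ := by
    rw [← hmap] at hint
    exact hint.comp_measurable hXm
  have hie : ∫ ω, finMax (fun k => ∑ i, h i (X i ω) k) ∂μ =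
      ∫ x, finMax (fun k => ∑ i, h i (x i) k) ∂(Measure.pi fun _ : Fin n => ν) := by
    rw [← hmap] at hint ⊢
    exact (integral_map hXm.aemeasurable hint.aestronglyMeasurable).symm
  have hnn : ∀ ω, 0 ≤ finMax (fun k => ∑ i, h i (X i ω) k) := fun ω => by
    refine le_trans (le_of_eq ?_) (le_finMax (fun k => ∑ i, h i (X i ω) k) none)
    simp [hh, hs', hφ0]
  have hmarkov := mul_meas_ge_le_integral_of_nonneg (Eventually.of_forall hnn) hint' a
  rw [hie] at hmarkov
  have hsub : {ω | ∃ k, a < ∑ i, ((∫ e, φ e (s k i) ∂ν) - φ (X i ω) (s k i))} ⊆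
      {ω | a ≤ finMax (fun k => ∑ i, h i (X i ω) k)} := by
    rintro ω ⟨k, hk⟩
    exact hk.le.trans (le_finMax (fun k => ∑ i, h i (X i ω) k) (some k))
  refine (measure_mono hsub).trans ?_
  rw [← ENNReal.ofReal_toReal (measure_ne_top μ _)]
  refine ENNReal.ofReal_le_ofReal ?_
  rw [le_div_iff₀ ha, mul_comm]
  exact hmarkov.trans hbound

/-- Uniform deviation bound over an arbitrary index set, for the outer measure. -/
theorem measure_exists_lt_le [IsProbabilityMeasure ν]
    (hX : ∀ i, Measurable (X i)) (hind : iIndepFun X μ)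
    (hlaw : ∀ i, μ.map (X i) = ν) (hη : 0 ≤ η) (hD : Measurable D) (hD0 : ∀ e, 0 ≤ D e)
    (hD2 : MemLp D 2 ν) (hφ0 : ∀ e, φ e 0 = 0)
    (hφi : ∀ u, |u| ≤ η → Integrable (fun e => φ e u) ν)
    (hlip : ∀ e u v, |u| ≤ η → |v| ≤ η → φ e u - φ e v ≤ D e * |u - v|)
    (hG : ∀ z : Fin n → ℝ, 0 ≤ ∑ i, ∑ j, z i * z j * G i j) (hτ : 0 ≤ τ)
    {T : Set (Fin n → ℝ)} (hTη : ∀ u ∈ T, ∀ i, |u i| ≤ η)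
    (hT : ∀ u ∈ T, ∀ z : Fin n → ℝ,
      ∑ i, z i * u i ≤ τ * Real.sqrt (∑ i, ∑ j, z i * z j * G i j)) {a : ℝ} (ha : 0 < a) :
    μ {ω | ∃ u ∈ T, a < ∑ i, ((∫ e, φ e (u i) ∂ν) - φ (X i ω) (u i))} ≤
      ENNReal.ofReal (τ * Real.sqrt (4 * (∫ e, D e ^ 2 ∂ν) * ∑ i, G i i) / a) := by
  rcases T.eq_empty_or_nonempty with rfl | hne
  · simp
  have : Nonempty T := hne.to_subtype
  -- The process is continuous in `u`, so a strict exceedance somewhere in `T` already occurs at a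
  -- point of a dense sequence. The finite bound is uniform in `N`.
  set d : ℕ → T := TopologicalSpace.denseSeq T with hd
  set E : ℕ → Set Ω := fun N => {ω | ∃ k : Fin (N + 1),
    a < ∑ i, ((∫ e, φ e ((d k).1 i) ∂ν) - φ (X i ω) ((d k).1 i))} with hE
  have hEmono : Monotone E := by
    intro N M hNM ω hω
    obtain ⟨k, hk⟩ := hω
    exact ⟨⟨k, by omega⟩, hk⟩
  have hcont1 : ∀ e, ContinuousOn (φ e) {u | |u| ≤ η} := fun e =>
    continuousOn_of_sub_le_mul_abs (hD0 e) (hlip e)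
  have hDi : Integrable D ν := hD2.integrable (by norm_num)
  have hcont2 : ContinuousOn (fun u => ∫ e, φ e u ∂ν) {u | |u| ≤ η} := by
    refine continuousOn_of_sub_le_mul_abs (K := ∫ e, D e ∂ν) (integral_nonneg hD0)
      fun u v hu hv => ?_
    rw [← integral_sub (hφi u hu) (hφi v hv), ← integral_mul_const]
    exact integral_mono ((hφi u hu).sub (hφi v hv)) (hDi.mul_const _) fun e => hlip e u v hu hv
  have hsub : {ω | ∃ u ∈ T, a < ∑ i, ((∫ e, φ e (u i) ∂ν) - φ (X i ω) (u i))} ⊆ ⋃ N, E N := by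
    rintro ω ⟨u, hu, hau⟩
    have hc : Continuous (fun v : T =>
        ∑ i, ((∫ e, φ e (v.1 i) ∂ν) - φ (X i ω) (v.1 i))) := by
      refine continuous_finsetSum _ fun i _ => ?_
      have hci : Continuous (fun v : T => v.1 i) :=
        (continuous_apply i).comp continuous_subtype_val
      exact (hcont2.comp_continuous hci fun v => hTη v.1 v.2 i).sub
        ((hcont1 (X i ω)).comp_continuous hci fun v => hTη v.1 v.2 i)
    obtain ⟨k, hk⟩ := (TopologicalSpace.denseRange_denseSeq T).exists_mem_open
      (isOpen_lt continuous_const hc) ⟨⟨u, hu⟩, hau⟩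
    exact Set.mem_iUnion.2 ⟨k, ⟨⟨k, by omega⟩, hk⟩⟩
  refine (measure_mono hsub).trans ?_
  -- Continuity along increasing unions needs no measurability of the sets.
  rw [hEmono.measure_iUnion]
  exact iSup_le fun N => measure_finite_exists_lt_le hX hind hlaw hη hD hD2 hφ0 hφi hlip hG hτ
    (fun k : Fin (N + 1) => (d k).1) (fun k i => hTη _ (d k).2 i) (fun k => hT _ (d k).2) ha

theorem measure_quadraticForm_lt_le {ψ : ℝ → ℝ} (hX : ∀ i, Measurable (X i))
    (hind : iIndepFun X μ) (hlaw : ∀ i, μ.map (X i) = ν) (hψm : Measurable ψ)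
    (hψ2 : MemLp ψ 2 ν) (hψ0 : ∫ e, ψ e ∂ν = 0)
    (hG : ∀ z : Fin n → ℝ, 0 ≤ ∑ i, ∑ j, z i * z j * G i j) {a : ℝ} (ha : 0 < a) :
    μ {ω | a < ∑ i, ∑ j, ψ (X i ω) * ψ (X j ω) * G i j} ≤
      ENNReal.ofReal ((∫ e, ψ e ^ 2 ∂ν) * (∑ i, G i i) / a) := by
  have hL : ∀ i, MemLp (fun ω => ψ (X i ω)) 2 μ := fun i =>
    (hψ2.comp_measurePreserving ⟨hX i, hlaw i⟩ :)
  have hint : ∀ (f : ℝ → ℝ) (_ : Measurable f) (i : Fin n),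
      ∫ ω, f (X i ω) ∂μ = ∫ e, f e ∂ν := fun f hf i => by
    rw [← hlaw i, integral_map (hX i).aemeasurable hf.aestronglyMeasurable]
  obtain ⟨h1, h2⟩ := integral_quadraticForm hL
    (fun i j hij => (hind.indepFun hij).comp hψm hψm)
    (fun i => by rw [hint ψ hψm i, hψ0]) G
  simp only [hint (fun e => ψ e ^ 2) (hψm.pow_const 2), ← Finset.mul_sum] at h2
  have hmarkov := mul_meas_ge_le_integral_of_nonneg
    (Eventually.of_forall fun ω => hG fun i => ψ (X i ω)) h1 a
  rw [h2] at hmarkov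
  refine (measure_mono (Set.ofPred_subset_ofPred.2 fun ω hω => le_of_lt hω)).trans ?_
  rw [← ENNReal.ofReal_toReal (measure_ne_top μ _)]
  refine ENNReal.ofReal_le_ofReal ?_
  rw [le_div_iff₀ ha, mul_comm]
  exact hmarkov

end UniformBound

/-! ### The remainder of a convex loss function -/

namespace IsSubgradientSelection

variable {ρ ψ : ℝ → ℝ}

theorem monotone (hψ : IsSubgradientSelection ρ ψ) : Monotone ψ := by
  intro x y hxy
  rcases hxy.eq_or_lt with rfl | h
  · exact le_rfl
  · have h1 := hψ x y
    have h2 := hψ y x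
    by_contra hlt
    push Not at hlt
    nlinarith [mul_pos (sub_pos.2 hlt) (sub_pos.2 h)]

end IsSubgradientSelection

/-- The remainder `ρ(e - u) - ρ(e) + ψ(e) u` of the first order expansion of the loss. -/
def lossRemainder (ρ ψ : ℝ → ℝ) (e u : ℝ) : ℝ := ρ (e - u) - ρ e + ψ e * u

theorem lossRemainder_zero (ρ ψ : ℝ → ℝ) (e : ℝ) : lossRemainder ρ ψ e 0 = 0 := by
  simp [lossRemainder]

namespace IsSubgradientSelection

variable {ρ ψ : ℝ → ℝ}

/-- `ψ(e) - ψ(e - u)` is a subgradient of the convex function `lossRemainder ρ ψ e` at `u`, and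
monotonicity bounds it by the oscillation of `ψ` over `[e - η, e + η]`. -/
theorem lossRemainder_sub_le (hψ : IsSubgradientSelection ρ ψ) {η e u v : ℝ} (hu : |u| ≤ η) :
    lossRemainder ρ ψ e u - lossRemainder ρ ψ e v ≤ (ψ (e + η) - ψ (e - η)) * |u - v| := by
  have h := hψ (e - u) (e - v)
  have hη : 0 ≤ η := (abs_nonneg u).trans hu
  obtain ⟨h1, h2⟩ := abs_le.1 hu
  have m1 := hψ.monotone (show e - η ≤ e - u by linarith)
  have m2 := hψ.monotone (show e - u ≤ e + η by linarith)
  have m3 := hψ.monotone (show e - η ≤ e by linarith)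
  have m4 := hψ.monotone (show e ≤ e + η by linarith)
  have hb : |ψ e - ψ (e - u)| ≤ ψ (e + η) - ψ (e - η) := abs_le.2 ⟨by linarith, by linarith⟩
  calc lossRemainder ρ ψ e u - lossRemainder ρ ψ e v
      ≤ (ψ e - ψ (e - u)) * (u - v) := by simp only [lossRemainder]; linarith
    _ ≤ |ψ e - ψ (e - u)| * |u - v| := by rw [← abs_mul]; exact le_abs_self _
    _ ≤ _ := mul_le_mul_of_nonneg_right hb (abs_nonneg _)

/-- Two subgradient inequalities chained through the midpoint `e - u/2`. The single inequality at
`e` would only give nonnegativity; the midpoint retains an increment of `ψ` and hence quadratic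
growth in the mean. -/
theorem le_lossRemainder (hψ : IsSubgradientSelection ρ ψ) (e u : ℝ) :
    -(u / 2) * (ψ (e + -(u / 2)) - ψ e) ≤ lossRemainder ρ ψ e u := by
  have h1 := hψ (e + -(u / 2)) (e - u)
  have h2 := hψ e (e + -(u / 2))
  simp only [lossRemainder]
  linarith

theorem measurable (hψ : IsSubgradientSelection ρ ψ) : Measurable ψ := hψ.monotone.measurable

variable {ν : Measure ℝ}

/-- Since (A2) is stated with values in `[0, ∞]`, closeness to zero includes finiteness, hence
square integrability of small increments. -/
theorem exists_memLp_oscillation (hψ : IsSubgradientSelection ρ ψ)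
    (hA2 : Tendsto (fun s : ℝ => ∫⁻ e, ENNReal.ofReal ((ψ (e + s) - ψ e) ^ 2) ∂ν) (𝓝 0) (𝓝 0))
    {δ : ℝ} (hδ : 0 < δ) :
    ∃ η₁ : ℝ, 0 < η₁ ∧ ∀ s : ℝ, |s| ≤ η₁ → MemLp (fun e => ψ (e + s) - ψ e) 2 ν ∧
      ∫ e, (ψ (e + s) - ψ e) ^ 2 ∂ν ≤ δ := by
  have hev := (tendsto_order.1 hA2).2 (ENNReal.ofReal δ) (ENNReal.ofReal_pos.2 hδ)
  obtain ⟨r, hr, h⟩ := Metric.eventually_nhds_iff.1 hev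
  refine ⟨r / 2, by positivity, fun s hs => ?_⟩
  have hlt := h (show dist s 0 < r by rw [Real.dist_eq, sub_zero]; linarith)
  have hm : Measurable (fun e => ψ (e + s) - ψ e) :=
    (hψ.measurable.comp (measurable_id.add_const s)).sub hψ.measurable
  have hint : Integrable (fun e => (ψ (e + s) - ψ e) ^ 2) ν :=
    (lintegral_ofReal_ne_top_iff_integrable (hm.pow_const 2).aestronglyMeasurable
      (Eventually.of_forall fun e => sq_nonneg _)).1 (hlt.trans ENNReal.ofReal_lt_top).ne
  refine ⟨(memLp_two_iff_integrable_sq hm.aestronglyMeasurable).2 hint, ?_⟩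
  rw [integral_eq_lintegral_of_nonneg_ae (Eventually.of_forall fun e => sq_nonneg _)
    (hm.pow_const 2).aestronglyMeasurable]
  exact ENNReal.toReal_le_of_le_ofReal hδ.le hlt.le

/-- The two-sided oscillation is a difference of two increments from `e`, each given the budget `δ /
4`. It is the Lipschitz constant of the remainder, and its smallness is what beats the quadratic
drift. -/
theorem exists_integral_oscillation_sq_le (hψ : IsSubgradientSelection ρ ψ)
    (hA2 : Tendsto (fun s : ℝ => ∫⁻ e, ENNReal.ofReal ((ψ (e + s) - ψ e) ^ 2) ∂ν) (𝓝 0) (𝓝 0))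
    {δ η₀ : ℝ} (hδ : 0 < δ) (hη₀ : 0 < η₀) :
    ∃ η : ℝ, 0 < η ∧ η ≤ η₀ ∧ MemLp (fun e => ψ (e + η) - ψ (e - η)) 2 ν ∧
      ∫ e, (ψ (e + η) - ψ (e - η)) ^ 2 ∂ν ≤ δ := by
  obtain ⟨η₁, hη₁, h⟩ := hψ.exists_memLp_oscillation hA2 (show 0 < δ / 4 by positivity)
  set η := min η₁ η₀ with hηdef
  have hη : 0 < η := lt_min hη₁ hη₀
  obtain ⟨h1, h1'⟩ := h η (by rw [abs_of_pos hη]; exact min_le_left _ _)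
  obtain ⟨h2, h2'⟩ := h (-η) (by rw [abs_neg, abs_of_pos hη]; exact min_le_left _ _)
  have he : (fun e => ψ (e + η) - ψ (e - η)) =
      fun e => (ψ (e + η) - ψ e) - (ψ (e + -η) - ψ e) := by
    ext e; rw [← sub_eq_add_neg]; ring
  have hmem : MemLp (fun e => ψ (e + η) - ψ (e - η)) 2 ν := by rw [he]; exact h1.sub h2
  refine ⟨η, hη, min_le_right _ _, hmem, ?_⟩
  have : ∫ e, (ψ (e + η) - ψ (e - η)) ^ 2 ∂ν ≤
      ∫ e, (2 * (ψ (e + η) - ψ e) ^ 2 + 2 * (ψ (e + -η) - ψ e) ^ 2) ∂ν := by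
    refine integral_mono hmem.integrable_sq
      ((h1.integrable_sq.const_mul 2).add (h2.integrable_sq.const_mul 2)) fun e => ?_
    have := congrFun he e
    simp only at this ⊢
    rw [this]
    nlinarith [sq_nonneg ((ψ (e + η) - ψ e) + (ψ (e + -η) - ψ e))]
  rw [integral_add (h1.integrable_sq.const_mul 2) (h2.integrable_sq.const_mul 2),
    integral_const_mul, integral_const_mul] at this
  linarith

theorem integrable_lossRemainder [IsProbabilityMeasure ν]
    (hψ : IsSubgradientSelection ρ ψ) (hρ : Continuous ρ) {η : ℝ}
    (hD : MemLp (fun e => ψ (e + η) - ψ (e - η)) 2 ν) {u : ℝ} (hu : |u| ≤ η) :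
    Integrable (fun e => lossRemainder ρ ψ e u) ν := by
  have hm : Measurable (fun e => lossRemainder ρ ψ e u) := by
    have := hψ.measurable
    have := hρ.measurable
    unfold lossRemainder
    fun_prop
  refine ((hD.integrable (by norm_num)).mul_const |u|).mono' hm.aestronglyMeasurable
    (Eventually.of_forall fun e => ?_)
  rw [Real.norm_eq_abs, abs_le]
  have h1 := hψ.lossRemainder_sub_le (e := e) (v := 0) hu
  have h2 := hψ.lossRemainder_sub_le (e := e) (u := 0) (v := u) (η := η)
    (by rw [abs_zero]; exact (abs_nonneg u).trans hu)
  rw [lossRemainder_zero] at h1 h2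
  simp only [sub_zero, zero_sub, abs_neg] at h1 h2
  exact ⟨by linarith, h1⟩

/-- Integrate the midpoint bound with `s = -u/2`: near zero `s · E ψ(ε + s)` is at least `(ξ/2)s² =
(ξ/8)u²`, half of the linear expansion being spent on its error. -/
theorem exists_le_integral_lossRemainder [IsProbabilityMeasure ν]
    (hψ : IsSubgradientSelection ρ ψ) (hρ : Continuous ρ)
    (hA2 : Tendsto (fun s : ℝ => ∫⁻ e, ENNReal.ofReal ((ψ (e + s) - ψ e) ^ 2) ∂ν) (𝓝 0) (𝓝 0))
    (hψ2 : MemLp ψ 2 ν) (hψ0 : ∫ e, ψ e ∂ν = 0) {ξ : ℝ} (hξ : 0 < ξ)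
    (hlin : (fun s : ℝ => (∫ e, ψ (e + s) ∂ν) - ξ * s) =o[𝓝 0] (fun s : ℝ => s)) :
    ∃ η₀ : ℝ, 0 < η₀ ∧ ∀ u : ℝ, |u| ≤ η₀ →
      ξ / 8 * u ^ 2 ≤ ∫ e, lossRemainder ρ ψ e u ∂ν := by
  obtain ⟨η₁, hη₁, h₁⟩ := hψ.exists_memLp_oscillation hA2 one_pos
  obtain ⟨η₂, hη₂, -, hD, -⟩ := hψ.exists_integral_oscillation_sq_le hA2 one_pos one_pos
  have hev := hlin.def (show 0 < ξ / 2 by positivity)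
  obtain ⟨r, hr, h⟩ := Metric.eventually_nhds_iff.1 hev
  refine ⟨min (min η₁ η₂) r, by positivity, fun u hu => ?_⟩
  have hu1 : |u| ≤ η₁ := hu.trans ((min_le_left _ _).trans (min_le_left _ _))
  have hu2 : |u| ≤ η₂ := hu.trans ((min_le_left _ _).trans (min_le_right _ _))
  have hur : |u| ≤ r := hu.trans (min_le_right _ _)
  set s := -(u / 2) with hs
  have hsu : |s| = |u| / 2 := by rw [hs, abs_neg, abs_div, abs_of_pos (two_pos : (0 : ℝ) < 2)]
  obtain ⟨hm, -⟩ := h₁ s (by rw [hsu]; linarith [abs_nonneg u])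
  have hle : ∫ e, s * (ψ (e + s) - ψ e) ∂ν ≤ ∫ e, lossRemainder ρ ψ e u ∂ν :=
    integral_mono ((hm.integrable (by norm_num)).const_mul s)
      (hψ.integrable_lossRemainder hρ hD hu2) fun e => hψ.le_lossRemainder e u
  have hψi : Integrable ψ ν := hψ2.integrable (by norm_num)
  have hψs : Integrable (fun e => ψ (e + s)) ν := by
    have := (hm.integrable (by norm_num)).add hψi
    refine this.congr (Eventually.of_forall fun e => ?_)
    simp
  rw [integral_const_mul, integral_sub hψs hψi, hψ0, sub_zero] at hle
  refine le_trans ?_ hle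
  rcases eq_or_ne u 0 with rfl | hu0
  · simp [hs]
  have hb := h (y := s) (by
    rw [Real.dist_eq, sub_zero, hsu]
    have := abs_pos.2 hu0
    linarith)
  rw [Real.norm_eq_abs, Real.norm_eq_abs] at hb
  have hprod : |s * ((∫ e, ψ (e + s) ∂ν) - ξ * s)| ≤ ξ / 2 * s ^ 2 := by
    rw [abs_mul, ← sq_abs s]
    nlinarith [abs_nonneg s]
  have := (abs_le.1 hprod).1
  have hs2 : s ^ 2 = u ^ 2 / 4 := by rw [hs]; ring
  nlinarith

end IsSubgradientSelection

/-! ### Coercivity of the loss -/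

/-- If `ψ` kept one sign, so would the integral of its translates, whereas the expansion makes that
integral change sign at zero. -/
theorem exists_pos_and_exists_neg_of_expansion {ψ : ℝ → ℝ}
    {ν : Measure ℝ} {ξ : ℝ} (hξ : 0 < ξ)
    (hlin : (fun s : ℝ => (∫ e, ψ (e + s) ∂ν) - ξ * s) =o[𝓝 0] (fun s : ℝ => s)) :
    (∃ x, 0 < ψ x) ∧ ∃ x, ψ x < 0 := by
  have hev := hlin.def (show 0 < ξ / 2 by positivity)
  obtain ⟨r, hr, h⟩ := Metric.eventually_nhds_iff.1 hev
  constructor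
  · by_contra hcon
    push Not at hcon
    have hb := h (y := r / 2) (by rw [Real.dist_eq, sub_zero, abs_of_pos] <;> linarith)
    rw [Real.norm_eq_abs, Real.norm_eq_abs, abs_of_pos (show 0 < r / 2 by positivity)] at hb
    have h1 : ∫ e, ψ (e + r / 2) ∂ν ≤ 0 := integral_nonpos fun e => hcon _
    have h2 := (abs_le.1 hb).1
    nlinarith [mul_pos hξ hr]
  · by_contra hcon
    push Not at hcon
    have hb := h (y := -(r / 2)) (by rw [Real.dist_eq, sub_zero, abs_neg, abs_of_pos] <;> linarith)
    rw [Real.norm_eq_abs, Real.norm_eq_abs, abs_neg,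
      abs_of_pos (show 0 < r / 2 by positivity)] at hb
    have h1 : 0 ≤ ∫ e, ψ (e + -(r / 2)) ∂ν := integral_nonneg fun e => hcon _
    have h2 := (abs_le.1 hb).2
    nlinarith [mul_pos hξ hr]

/-- A convex function whose subgradient takes both signs grows at least linearly. -/
theorem IsSubgradientSelection.exists_linear_growth {ρ ψ : ℝ → ℝ}
    (hψ : IsSubgradientSelection ρ ψ) (hpos : ∃ x, 0 < ψ x) (hneg : ∃ x, ψ x < 0) :
    ∃ c K : ℝ, 0 < c ∧ ∀ x, c * |x| - K ≤ ρ x := by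
  obtain ⟨p, hp⟩ := hpos
  obtain ⟨q, hq⟩ := hneg
  refine ⟨min (ψ p) (-ψ q), max (ψ p * p - ρ p) (ψ q * q - ρ q),
    lt_min hp (by linarith), fun x => ?_⟩
  have h1 := hψ p x
  have h2 := hψ q x
  have h3 := le_max_left (ψ p * p - ρ p) (ψ q * q - ρ q)
  have h4 := le_max_right (ψ p * p - ρ p) (ψ q * q - ρ q)
  rcases le_total 0 x with hx | hx
  · rw [abs_of_nonneg hx]
    have := mul_le_mul_of_nonneg_right (min_le_left (ψ p) (-ψ q)) hx
    linarith
  · rw [abs_of_nonpos hx]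
    have := mul_le_mul_of_nonneg_right (min_le_right (ψ p) (-ψ q)) (neg_nonneg.2 hx)
    linarith

/-! ### Minimization of a coercive function of finitely many functionals plus a squared norm -/

/-- Replacing `h` by its projection to `(ker l)ᗮ` keeps `l h` and does not increase the norm. That
complement is finite dimensional, so the problem becomes minimizing a coercive continuous function
on a subspace of a finite-dimensional space. Only the values `A a` matter, so `A` may fail to be
injective. -/
theorem exists_forall_le_comp_add_norm_sq {H V : Type*} [NormedAddCommGroup H]
    [InnerProductSpace ℝ H] [CompleteSpace H] [AddCommGroup V] [Module ℝ V] {n : ℕ}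
    (A : V →ₗ[ℝ] (Fin n → ℝ)) (l : H →L[ℝ] (Fin n → ℝ)) {F : (Fin n → ℝ) → ℝ}
    (hF : Continuous F) (hcoer : Tendsto F (cocompact _) atTop) {c : ℝ} (hc : ∀ v, c ≤ F v)
    {lam : ℝ} (hlam : 0 < lam) :
    ∃ a h, ∀ a' h', F (A a + l h) + lam * ‖h‖ ^ 2 ≤ F (A a' + l h') + lam * ‖h'‖ ^ 2 := by
  set K : Submodule ℝ H := LinearMap.ker (l : H →ₗ[ℝ] (Fin n → ℝ)) with hK
  have hKc : IsClosed (K : Set H) := l.isClosed_ker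
  have : CompleteSpace K := hKc.completeSpace_coe
  set M : Submodule ℝ H := Kᗮ with hM
  set lM : M →ₗ[ℝ] (Fin n → ℝ) := (l : H →ₗ[ℝ] (Fin n → ℝ)).comp M.subtype with hlM
  have hinj : Function.Injective lM := by
    rw [← LinearMap.ker_eq_bot, LinearMap.ker_eq_bot']
    intro k hk
    have h1 : (k : H) ∈ K := hk
    have h2 : (k : H) ∈ Kᗮ := k.2
    have : (k : H) = 0 := by
      have h3 := Submodule.inner_right_of_mem_orthogonal h1 h2
      exact inner_self_eq_zero.1 h3
    exact Subtype.ext this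
  have hfin : FiniteDimensional ℝ M := FiniteDimensional.of_injective lM hinj
  have : ProperSpace M := FiniteDimensional.proper ℝ M
  -- Parametrize by value vector and penalized part; the range of `B` is the set of attainable
  -- pairs, and it is closed.
  set B : V × M →ₗ[ℝ] (Fin n → ℝ) × M :=
    ((A.comp (LinearMap.fst ℝ V M)) + (lM.comp (LinearMap.snd ℝ V M))).prod
      (LinearMap.snd ℝ V M) with hB
  set Φ : (Fin n → ℝ) × M → ℝ := fun p => F p.1 + lam * ‖p.2‖ ^ 2 with hΦ
  have hΦc : Continuous Φ := by fun_prop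
  have hclosed : IsClosed (LinearMap.range B : Set ((Fin n → ℝ) × M)) :=
    Submodule.closed_of_finiteDimensional _
  have hcoerΦ : ∀ᶠ p in cocompact ((Fin n → ℝ) × M), Φ 0 ≤ Φ p := by
    have h1 : ∀ᶠ v in cocompact (Fin n → ℝ), Φ 0 ≤ F v := hcoer.eventually_ge_atTop _
    rw [Filter.eventually_iff, mem_cocompact] at h1
    obtain ⟨S, hS, hSsub⟩ := h1
    set r := Real.sqrt ((Φ 0 - c) / lam) with hr
    rw [Filter.eventually_iff, mem_cocompact]
    refine ⟨S ×ˢ Metric.closedBall 0 r, hS.prod (isCompact_closedBall 0 r), fun p hp => ?_⟩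
    show Φ 0 ≤ F p.1 + lam * ‖p.2‖ ^ 2
    by_cases hpS : p.1 ∈ S
    · have hp2 : p.2 ∉ Metric.closedBall (0 : M) r := fun h => hp ⟨hpS, h⟩
      rw [mem_closedBall_zero_iff, not_le] at hp2
      have h2 := (Real.sqrt_lt' ((Real.sqrt_nonneg _).trans_lt hp2)).1 hp2
      rw [div_lt_iff₀ hlam] at h2
      linarith [hc p.1]
    · have h2 : Φ 0 ≤ F p.1 := hSsub hpS
      have h3 : 0 ≤ lam * ‖p.2‖ ^ 2 := by positivity
      linarith
  obtain ⟨p, ⟨⟨a, k⟩, rfl⟩, hp⟩ := hΦc.continuousOn.exists_isMinOn' hclosed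
    (LinearMap.range B).zero_mem (hcoerΦ.filter_mono inf_le_left)
  refine ⟨a, (k : H), fun a' h' => ?_⟩
  set k' : M := M.orthogonalProjectionOnto h' with hk'
  have hl : l (k' : H) = l h' := by
    have h1 : h' - M.starProjection h' ∈ Kᗮᗮ := Submodule.sub_starProjection_mem_orthogonal h'
    rw [Submodule.orthogonal_orthogonal] at h1
    have h2 : l (h' - M.starProjection h') = 0 := h1
    rw [map_sub, sub_eq_zero] at h2
    exact h2.symm
  have hn : ‖(k' : H)‖ ≤ ‖h'‖ := M.norm_starProjection_apply_le h'
  have hmin : Φ (B (a, k)) ≤ Φ (B (a', k')) := hp (LinearMap.mem_range_self B (a', k'))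
  have hmin' : F (A a + l k) + lam * ‖(k : H)‖ ^ 2 ≤
      F (A a' + l k') + lam * ‖(k' : H)‖ ^ 2 := hmin
  rw [hl] at hmin'
  refine hmin'.trans ?_
  gcongr

/-! ### Sobolev functions as iterated primitives -/

/-- Iterated primitives of `h` with prescribed initial values. -/
def iteratedPrimitive (a : ℕ → ℝ) (h : ℝ → ℝ) : ℕ → ℝ → ℝ
  | 0 => h
  | k + 1 => fun x => a k + ∫ s in (0 : ℝ)..x, iteratedPrimitive a h k s

theorem iteratedPrimitive_succ (a : ℕ → ℝ) (h : ℝ → ℝ) (k : ℕ) (x : ℝ) :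
    iteratedPrimitive a h (k + 1) x = a k + ∫ s in (0 : ℝ)..x, iteratedPrimitive a h k s := rfl

theorem iteratedPrimitive_chain (a : ℕ → ℝ) (h : ℝ → ℝ) (m : ℕ) :
    ∀ j < m, ∀ x ∈ Set.Icc (0 : ℝ) 1,
      (fun j => iteratedPrimitive a h (m - j)) j x = (fun j => iteratedPrimitive a h (m - j)) j 0 +
        ∫ s in (0 : ℝ)..x, (fun j => iteratedPrimitive a h (m - j)) (j + 1) s := by
  intro j hj x _
  obtain ⟨k, hk⟩ : ∃ k, m - j = k + 1 := ⟨m - j - 1, by omega⟩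
  have hk' : m - (j + 1) = k := by omega
  simp only [hk, hk', iteratedPrimitive, intervalIntegral.integral_same, add_zero]

theorem intervalIntegrable_iteratedPrimitive (a : ℕ → ℝ) {h : ℝ → ℝ}
    (hh : MemLp h 2 (volume.restrict (Set.Icc (0 : ℝ) 1))) (k : ℕ) :
    IntervalIntegrable (iteratedPrimitive a h k) volume 0 1 := by
  rcases k with _ | k
  · exact intervalIntegrable_of_memLp_unit hh
  · have := primitive_chain_absolutelyContinuous (m := k + 1)
      (F := fun j => iteratedPrimitive a h (k + 1 - j))
      (iteratedPrimitive_chain a h (k + 1)) (by simpa [iteratedPrimitive] using hh) k 0 (by omega)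
    exact this.continuousOn.intervalIntegrable

/-- Reconstruction from the initial values and the top derivative. The induction runs almost
everywhere, as `h` is known only up to null sets; each integration restores equality at every point.
-/
theorem MemSobolev.eqOn_iteratedPrimitive {m : ℕ} {g h : ℝ → ℝ} (hg : MemSobolev m g)
    {a : ℕ → ℝ} (ha : ∀ k < m, a k = unitDeriv (m - 1 - k) g 0)
    (hh : h =ᵐ[volume.restrict (Set.Icc (0 : ℝ) 1)] unitDeriv m g) :
    ∀ k, 1 ≤ k → k ≤ m → Set.EqOn (iteratedPrimitive a h k) (unitDeriv (m - k) g)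
      (Set.Icc 0 1) := by
  have hae : ∀ k ≤ m, ∀ᵐ x, x ∈ Set.Icc (0 : ℝ) 1 →
      iteratedPrimitive a h k x = unitDeriv (m - k) g x := by
    intro k
    induction k with
    | zero => intro _; exact (ae_restrict_iff' measurableSet_Icc).1 hh
    | succ k ih =>
      intro hk
      refine Eventually.of_forall fun x hx => ?_
      rw [iteratedPrimitive_succ, hg.chain (j := m - (k + 1)) (by omega) hx, ha k (by omega),
        show m - 1 - k = m - (k + 1) by omega, show m - (k + 1) + 1 = m - k by omega]
      congr 1
      refine intervalIntegral.integral_congr_ae ?_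
      filter_upwards [ih (by omega)] with s hs hs'
      exact hs (uIcc_subset_unit (by simp) hx (Set.uIoc_subset_uIcc hs'))
  intro k hk hkm x hx
  obtain ⟨k, rfl⟩ : ∃ l, k = l + 1 := ⟨k - 1, by omega⟩
  rw [iteratedPrimitive_succ, hg.chain (j := m - (k + 1)) (by omega) hx, ha k (by omega),
    show m - 1 - k = m - (k + 1) by omega, show m - (k + 1) + 1 = m - k by omega]
  congr 1
  refine intervalIntegral.integral_congr_ae ?_
  filter_upwards [hae k (by omega)] with s hs hs'
  exact hs (uIcc_subset_unit (by simp) hx (Set.uIoc_subset_uIcc hs'))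

/-- Linearity in `L²` holds only almost everywhere at level zero, but pointwise after one
integration; both forms are recorded because point evaluation needs the latter. -/
theorem iteratedPrimitive_linear {a₁ a₂ a₃ : ℕ → ℝ} {h₁ h₂ h₃ : ℝ → ℝ} {c₁ c₂ : ℝ}
    (hh₁ : MemLp h₁ 2 (volume.restrict (Set.Icc (0 : ℝ) 1)))
    (hh₂ : MemLp h₂ 2 (volume.restrict (Set.Icc (0 : ℝ) 1)))
    (ha : ∀ k, a₃ k = c₁ * a₁ k + c₂ * a₂ k)
    (hh : h₃ =ᵐ[volume.restrict (Set.Icc (0 : ℝ) 1)] fun x => c₁ * h₁ x + c₂ * h₂ x) (k : ℕ) :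
    iteratedPrimitive a₃ h₃ k =ᵐ[volume.restrict (Set.Icc (0 : ℝ) 1)]
        (fun x => c₁ * iteratedPrimitive a₁ h₁ k x + c₂ * iteratedPrimitive a₂ h₂ k x) ∧
      ∀ x ∈ Set.Icc (0 : ℝ) 1, iteratedPrimitive a₃ h₃ (k + 1) x =
        c₁ * iteratedPrimitive a₁ h₁ (k + 1) x + c₂ * iteratedPrimitive a₂ h₂ (k + 1) x := by
  have step : ∀ k, iteratedPrimitive a₃ h₃ k =ᵐ[volume.restrict (Set.Icc (0 : ℝ) 1)]
        (fun x => c₁ * iteratedPrimitive a₁ h₁ k x + c₂ * iteratedPrimitive a₂ h₂ k x) →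
      ∀ x ∈ Set.Icc (0 : ℝ) 1, iteratedPrimitive a₃ h₃ (k + 1) x =
        c₁ * iteratedPrimitive a₁ h₁ (k + 1) x + c₂ * iteratedPrimitive a₂ h₂ (k + 1) x := by
    intro k hk x hx
    have hs : Set.uIcc 0 x ⊆ Set.Icc (0 : ℝ) 1 := uIcc_subset_unit (by simp) hx
    have hs' : Set.uIcc 0 x ⊆ Set.uIcc (0 : ℝ) 1 := by rwa [Set.uIcc_of_le (zero_le_one' ℝ)]
    have h1 : ∫ s in (0 : ℝ)..x, iteratedPrimitive a₃ h₃ k s =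
        ∫ s in (0 : ℝ)..x,
          (c₁ * iteratedPrimitive a₁ h₁ k s + c₂ * iteratedPrimitive a₂ h₂ k s) := by
      refine intervalIntegral.integral_congr_ae ?_
      filter_upwards [(ae_restrict_iff' measurableSet_Icc).1 hk] with s h2 h3
      exact h2 (hs (Set.uIoc_subset_uIcc h3))
    simp only [iteratedPrimitive]
    rw [h1, intervalIntegral.integral_add
      (((intervalIntegrable_iteratedPrimitive a₁ hh₁ k).mono_set hs').const_mul c₁)
      (((intervalIntegrable_iteratedPrimitive a₂ hh₂ k).mono_set hs').const_mul c₂),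
      intervalIntegral.integral_const_mul, intervalIntegral.integral_const_mul, ha]
    ring
  have hae : iteratedPrimitive a₃ h₃ k =ᵐ[volume.restrict (Set.Icc (0 : ℝ) 1)]
      (fun x => c₁ * iteratedPrimitive a₁ h₁ k x + c₂ * iteratedPrimitive a₂ h₂ k x) := by
    induction k with
    | zero => exact hh
    | succ k ih =>
      exact (ae_restrict_iff' measurableSet_Icc).2 (Eventually.of_forall (step k ih))
  exact ⟨hae, step k hae⟩

/-- This is the continuity of point evaluation as a functional of the top derivative, with norm at
most one. -/
theorem abs_iteratedPrimitive_zero_le {h : ℝ → ℝ}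
    (hh : MemLp h 2 (volume.restrict (Set.Icc (0 : ℝ) 1))) (k : ℕ) :
    ∀ x ∈ Set.Icc (0 : ℝ) 1, |iteratedPrimitive 0 h (k + 1) x| ≤ Real.sqrt (l2NormSq h) := by
  have hmono : ∀ (f : ℝ → ℝ), IntervalIntegrable f volume 0 1 → ∀ x ∈ Set.Icc (0 : ℝ) 1,
      |∫ s in (0 : ℝ)..x, f s| ≤ ∫ s in (0 : ℝ)..1, |f s| := by
    intro f hf x hx
    refine (intervalIntegral.abs_integral_le_integral_abs hx.1).trans ?_
    exact intervalIntegral.integral_mono_interval le_rfl hx.1 hx.2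
      (Eventually.of_forall fun s => abs_nonneg _) hf.abs
  induction k with
  | zero =>
    intro x hx
    simp only [iteratedPrimitive, Pi.zero_apply, zero_add]
    refine (hmono h (intervalIntegrable_of_memLp_unit hh) x hx).trans ?_
    refine Real.le_sqrt_of_sq_le ?_
    rw [intervalIntegral.integral_of_le zero_le_one, ← integral_Icc_eq_integral_Ioc,
      l2NormSq_eq_setIntegral]
    have := sq_integral_mul_le hh.abs (memLp_const (1 : ℝ))
    simpa using this
  | succ k ih =>
    intro x hx
    rw [iteratedPrimitive_succ, Pi.zero_apply, zero_add]
    refine (hmono _ (intervalIntegrable_iteratedPrimitive 0 hh (k + 1)) x hx).trans ?_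
    have : ∫ s in (0 : ℝ)..1, |iteratedPrimitive 0 h (k + 1) s| ≤
        ∫ _ in (0 : ℝ)..1, Real.sqrt (l2NormSq h) :=
      intervalIntegral.integral_mono_on zero_le_one
        (intervalIntegrable_iteratedPrimitive 0 hh (k + 1)).abs (by simp) ih
    simpa using this

/-! ### Existence of M-type smoothing splines -/

/-- The space of square integrable functions on the unit interval. -/
abbrev UnitL2 : Type := Lp ℝ 2 (volume.restrict (Set.Icc (0 : ℝ) 1))

theorem UnitL2.norm_sq_eq (h : UnitL2) : ‖h‖ ^ 2 = l2NormSq h := by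
  rw [← real_inner_self_eq_norm_sq, L2.inner_def, l2NormSq_eq_setIntegral]
  refine integral_congr_ae (Eventually.of_forall fun x => ?_)
  simp [sq]

/-- Extension of a finite sequence by zero. -/
def extendZero {m : ℕ} (a : Fin m → ℝ) (k : ℕ) : ℝ := if hk : k < m then a ⟨k, hk⟩ else 0

/-- Point evaluation of the iterated primitives as a linear map. -/
def evalPrimitive (m : ℕ) {n : ℕ} (t : Fin n → ℝ) (ht : ∀ i, t i ∈ Set.Icc (0 : ℝ) 1) :
    ((Fin (m + 1) → ℝ) × UnitL2) →ₗ[ℝ] (Fin n → ℝ) where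
  -- The order is `m + 1`: at least one primitive is taken, so point values do not depend on the
  -- representative of the class.
  toFun p i := iteratedPrimitive (extendZero p.1) p.2 (m + 1) (t i)
  map_add' p q := by
    ext i
    have := (iteratedPrimitive_linear (a₁ := extendZero p.1) (a₂ := extendZero q.1)
      (a₃ := extendZero (p + q).1) (h₁ := p.2) (h₂ := q.2) (h₃ := (p + q).2) (c₁ := 1) (c₂ := 1)
      (Lp.memLp p.2) (Lp.memLp q.2) (fun k => by simp only [extendZero]; split_ifs <;> simp)
      ((Lp.coeFn_add p.2 q.2).mono fun x hx => by
        simp only [one_mul]; exact hx) m).2 (t i) (ht i)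
    simpa using this
  map_smul' c p := by
    ext i
    have := (iteratedPrimitive_linear (a₁ := extendZero p.1) (a₂ := extendZero p.1)
      (a₃ := extendZero (c • p).1) (h₁ := p.2) (h₂ := p.2) (h₃ := (c • p).2) (c₁ := c) (c₂ := 0)
      (Lp.memLp p.2) (Lp.memLp p.2) (fun k => by simp only [extendZero]; split_ifs <;> simp)
      ((Lp.coeFn_smul c p.2).mono fun x hx => by
        simp only [zero_mul, add_zero]; exact hx) m).2 (t i) (ht i)
    simpa using this

theorem penalizedLoss_congr {m : ℕ} (ρ : ℝ → ℝ) (lam : ℝ) {n : ℕ} {t : Fin n → ℝ}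
    (y : Fin n → ℝ) {f : ℝ → ℝ} {v : Fin n → ℝ} {h : UnitL2} (hv : ∀ i, v i = f (t i))
    (hf : unitDeriv m f =ᵐ[volume.restrict (Set.Icc (0 : ℝ) 1)] h) :
    penalizedLoss m ρ lam t y f = (1 / (n : ℝ)) * ∑ i, ρ (y i - v i) + lam * ‖h‖ ^ 2 := by
  rw [penalizedLoss, l2NormSq_congr_ae hf, UnitL2.norm_sq_eq]
  simp only [hv]

theorem tendsto_cocompact_sum_loss {ρ : ℝ → ℝ} {c K : ℝ} (hc : 0 < c)
    (hρ : ∀ x, c * |x| - K ≤ ρ x) {n : ℕ} (hn : 1 ≤ n) (y : Fin n → ℝ) :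
    Tendsto (fun v : Fin n → ℝ => (1 / (n : ℝ)) * ∑ i, ρ (y i - v i)) (cocompact _) atTop := by
  have hn0 : (0 : ℝ) < n := by exact_mod_cast hn
  have hlow : ∀ v : Fin n → ℝ, c / n * ‖v‖ - (c / n * ∑ i, |y i| + K) ≤
      (1 / (n : ℝ)) * ∑ i, ρ (y i - v i) := by
    intro v
    have h1 : ‖v‖ ≤ ∑ i, |v i| := by
      refine (pi_norm_le_iff_of_nonneg (Finset.sum_nonneg fun i _ => abs_nonneg _)).2 fun i => ?_
      exact Finset.single_le_sum (f := fun i => |v i|) (fun i _ => abs_nonneg _)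
        (Finset.mem_univ i)
    have h2 : ∑ i, (c * (|v i| - |y i|) - K) ≤ ∑ i, ρ (y i - v i) := by
      refine Finset.sum_le_sum fun i _ => le_trans ?_ (hρ (y i - v i))
      have : |v i| - |y i| ≤ |y i - v i| := by
        rw [abs_sub_comm]; exact abs_sub_abs_le_abs_sub _ _
      have := mul_le_mul_of_nonneg_left this hc.le
      linarith
    rw [Finset.sum_sub_distrib, ← Finset.mul_sum, Finset.sum_sub_distrib] at h2
    simp only [Finset.sum_const, Finset.card_univ, Fintype.card_fin, nsmul_eq_mul] at h2
    have h3 := mul_le_mul_of_nonneg_left h2 (show 0 ≤ 1 / (n : ℝ) by positivity)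
    refine le_trans ?_ h3
    have h4 := mul_le_mul_of_nonneg_left h1 (show 0 ≤ c / n by positivity)
    have h5 : 1 / (n : ℝ) * (c * (∑ i, |v i| - ∑ i, |y i|) - n * K) =
        c / n * ∑ i, |v i| - (c / n * ∑ i, |y i| + K) := by field_simp; ring
    rw [h5]; linarith
  refine tendsto_atTop_mono hlow ?_
  exact tendsto_atTop_add_const_right _ _
    ((tendsto_norm_cocompact_atTop).const_mul_atTop (by positivity))

/-- The Sobolev space is parametrized by initial values and top derivative in `L²`, so that the
penalty is a squared Hilbert norm and the abstract minimization applies. -/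
theorem exists_isMTypeSpline {m : ℕ} (hm : 1 ≤ m) {ρ : ℝ → ℝ} (hρc : Continuous ρ) {c K : ℝ}
    (hc : 0 < c) (hρ : ∀ x, c * |x| - K ≤ ρ x) {lam : ℝ} (hlam : 0 < lam) {n : ℕ} (hn : 1 ≤ n)
    {t : Fin n → ℝ} (ht : ∀ i, t i ∈ Set.Icc (0 : ℝ) 1) (y : Fin n → ℝ) :
    ∃ f, IsMTypeSpline m ρ lam t y f := by
  obtain ⟨m, rfl⟩ : ∃ k, m = k + 1 := ⟨m - 1, by omega⟩
  have hn0 : (0 : ℝ) < n := by exact_mod_cast hn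
  set L := evalPrimitive m t ht with hL
  set l : UnitL2 →L[ℝ] (Fin n → ℝ) :=
    (L.comp (LinearMap.inr ℝ (Fin (m + 1) → ℝ) UnitL2)).mkContinuous 1 (fun h => by
      rw [one_mul]
      refine (pi_norm_le_iff_of_nonneg (norm_nonneg _)).2 fun i => ?_
      have h1 := abs_iteratedPrimitive_zero_le (Lp.memLp h) m (t i) (ht i)
      rw [← UnitL2.norm_sq_eq, Real.sqrt_sq (norm_nonneg _)] at h1
      have h2 : extendZero (0 : Fin (m + 1) → ℝ) = 0 := by
        ext k; simp [extendZero]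
      rw [← h2] at h1
      exact h1) with hl
  have hsplit : ∀ a h, L.comp (LinearMap.inl ℝ (Fin (m + 1) → ℝ) UnitL2) a + l h = L (a, h) := by
    intro a h
    have : (a, h) = (a, (0 : UnitL2)) + ((0 : Fin (m + 1) → ℝ), h) := by simp
    rw [this, map_add]; rfl
  obtain ⟨a, h, hmin⟩ := exists_forall_le_comp_add_norm_sq
    (L.comp (LinearMap.inl ℝ (Fin (m + 1) → ℝ) UnitL2)) l
    (F := fun v : Fin n → ℝ => (1 / (n : ℝ)) * ∑ i, ρ (y i - v i)) (by fun_prop)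
    (tendsto_cocompact_sum_loss hc hρ hn y) (c := -K) (fun v => by
      have h1 : ∑ _i : Fin n, (-K) ≤ ∑ i, ρ (y i - v i) := Finset.sum_le_sum fun i _ => by
        have h1 := hρ (y i - v i)
        have h2 : 0 ≤ c * |y i - v i| := by positivity
        linarith
      simp only [Finset.sum_const, Finset.card_univ, Fintype.card_fin, nsmul_eq_mul] at h1
      rw [one_div, ← div_eq_inv_mul, le_div_iff₀ hn0]; linarith) hlam
  simp only [hsplit] at hmin
  have hchain := iteratedPrimitive_chain (extendZero a) h (m + 1)
  have htop : MemLp ((fun j => iteratedPrimitive (extendZero a) h (m + 1 - j)) (m + 1)) 2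
      (volume.restrict (Set.Icc (0 : ℝ) 1)) := by
    simpa [iteratedPrimitive] using Lp.memLp h
  have hder : unitDeriv (m + 1) (iteratedPrimitive (extendZero a) h (m + 1))
      =ᵐ[volume.restrict (Set.Icc (0 : ℝ) 1)] h := by
    have := unitDeriv_ae_eq_of_primitive_chain (by omega) hchain htop
      (f := iteratedPrimitive (extendZero a) h (m + 1)) (fun x _ => rfl)
    simpa [iteratedPrimitive] using this
  refine ⟨iteratedPrimitive (extendZero a) h (m + 1),
    memSobolev_of_primitive_chain (by omega) hchain htop fun x _ => rfl, fun g hg => ?_⟩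
  set hG : UnitL2 := (hg.memLp le_rfl).toLp _ with hhG
  have hGae : hG =ᵐ[volume.restrict (Set.Icc (0 : ℝ) 1)] unitDeriv (m + 1) g :=
    (hg.memLp le_rfl).coeFn_toLp
  set aG : Fin (m + 1) → ℝ := fun k => unitDeriv (m - k) g 0 with haG
  have hgeq := hg.eqOn_iteratedPrimitive (a := extendZero aG) (h := hG)
    (fun k hk => by simp only [extendZero, dif_pos hk, haG]; rfl) hGae (m + 1) (by omega) le_rfl
  rw [Nat.sub_self, unitDeriv_zero] at hgeq
  rw [penalizedLoss_congr ρ lam y (f := iteratedPrimitive (extendZero a) h (m + 1)) (v := L (a, h))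
      (h := h) (fun i => rfl) hder,
    penalizedLoss_congr ρ lam y (v := L (aG, hG)) (h := hG) (fun i => hgeq (ht i)) hGae.symm]
  exact hmin aG hG

/-! ### Deterministic comparison of penalized losses -/

theorem l2NormSq_linear_combination_le {f g : ℝ → ℝ}
    (hf : MemLp f 2 (volume.restrict (Set.Icc (0 : ℝ) 1)))
    (hg : MemLp g 2 (volume.restrict (Set.Icc (0 : ℝ) 1))) {a b : ℝ} (ha : 0 ≤ a) (hb : 0 ≤ b)
    (hab : a + b = 1) :
    l2NormSq (fun x => a * f x + b * g x) ≤ a * l2NormSq f + b * l2NormSq g := by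
  simp only [l2NormSq_eq_setIntegral]
  rw [← integral_const_mul, ← integral_const_mul,
    ← integral_add (hf.integrable_sq.const_mul _) (hg.integrable_sq.const_mul _)]
  refine integral_mono ((hf.const_mul a).add (hg.const_mul b)).integrable_sq
    ((hf.integrable_sq.const_mul _).add (hg.integrable_sq.const_mul _)) fun x => ?_
  show (a * f x + b * g x) ^ 2 ≤ a * f x ^ 2 + b * g x ^ 2
  obtain rfl : b = 1 - a := by linarith
  nlinarith [mul_nonneg (mul_nonneg ha hb) (sq_nonneg (f x - g x))]

theorem le_l2NormSq_add {f g : ℝ → ℝ}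
    (hf : MemLp f 2 (volume.restrict (Set.Icc (0 : ℝ) 1)))
    (hg : MemLp g 2 (volume.restrict (Set.Icc (0 : ℝ) 1))) :
    l2NormSq f + l2NormSq g - 2 * (Real.sqrt (l2NormSq f) * Real.sqrt (l2NormSq g)) ≤
      l2NormSq (fun x => f x + g x) := by
  have hfg : Integrable (fun x => f x * g x) (volume.restrict (Set.Icc (0 : ℝ) 1)) :=
    hf.integrable_mul hg
  have hcs := sq_integral_mul_le hf hg
  rw [← l2NormSq_eq_setIntegral, ← l2NormSq_eq_setIntegral] at hcs
  have hexp : l2NormSq (fun x => f x + g x) =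
      l2NormSq f + l2NormSq g + 2 * ∫ x in Set.Icc (0 : ℝ) 1, f x * g x := by
    simp only [l2NormSq_eq_setIntegral]
    have h1 : ∀ x, (f x + g x) ^ 2 = (f x ^ 2 + g x ^ 2) + 2 * (f x * g x) := fun x => by ring
    have h2 : Integrable (fun x => f x ^ 2 + g x ^ 2) (volume.restrict (Set.Icc (0 : ℝ) 1)) :=
      hf.integrable_sq.add hg.integrable_sq
    simp only [h1]
    rw [integral_add h2 (hfg.const_mul 2), integral_add hf.integrable_sq hg.integrable_sq,
      integral_const_mul]
  have habs : |∫ x in Set.Icc (0 : ℝ) 1, f x * g x| ≤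
      Real.sqrt (l2NormSq f) * Real.sqrt (l2NormSq g) := by
    rw [← Real.sqrt_mul (l2NormSq_nonneg f)]
    exact Real.abs_le_sqrt hcs
  have := (abs_le.1 habs).1
  rw [hexp]; linarith

section Comparison

variable {m : ℕ} {f₀ g : ℝ → ℝ}

theorem MemSobolev.unitDeriv_top_add_const_mul (hm : 1 ≤ m) (hf₀ : MemSobolev m f₀)
    (hg : MemSobolev m g) (θ : ℝ) :
    unitDeriv m (fun x => f₀ x + θ * g x) =ᵐ[volume.restrict (Set.Icc (0 : ℝ) 1)]
      fun x => unitDeriv m f₀ x + θ * unitDeriv m g x := by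
  simpa using hf₀.unitDeriv_top_linear_combination hm hg 1 θ

theorem sobolevNormSq_const_mul (hm : 1 ≤ m) (lam θ : ℝ) (hg : MemSobolev m g) :
    sobolevNormSq m lam (fun x => θ * g x) = θ ^ 2 * sobolevNormSq m lam g := by
  have h : unitDeriv m (fun x => θ * g x) =ᵐ[volume.restrict (Set.Icc (0 : ℝ) 1)]
      fun x => θ * unitDeriv m g x := by
    simpa using hg.unitDeriv_top_linear_combination hm hg θ 0
  rw [sobolevNormSq, sobolevNormSq, l2NormSq_congr_ae h, l2NormSq_const_mul, l2NormSq_const_mul]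
  ring

/-- If the penalized loss exceeds its value at `f₀` on the sphere of radius `√q` around `f₀`,
then every minimizer lies in the corresponding ball. -/
theorem sobolevNormSq_sub_le_of_sphere (hm : 1 ≤ m) (hf₀ : MemSobolev m f₀) {ρ : ℝ → ℝ}
    (hρ : ConvexOn ℝ Set.univ ρ) {lam q : ℝ} (hlam : 0 < lam) (hq : 0 < q) {n : ℕ}
    {t y : Fin n → ℝ} {f : ℝ → ℝ} (hf : IsMTypeSpline m ρ lam t y f)
    (hsphere : ∀ g, MemSobolev m g → sobolevNormSq m lam g = q →
      penalizedLoss m ρ lam t y f₀ < penalizedLoss m ρ lam t y (fun x => f₀ x + g x)) :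
    sobolevNormSq m lam (fun x => f x - f₀ x) ≤ q := by
  by_contra hlt
  push Not at hlt
  set g : ℝ → ℝ := fun x => f x - f₀ x with hg
  have hgS : MemSobolev m g := by
    have := hf.1.linear_combination hm hf₀ 1 (-1)
    simpa [hg, sub_eq_add_neg] using this
  set N := sobolevNormSq m lam g with hN
  have hNpos : 0 < N := hq.trans hlt
  -- Shrinking by `θ` puts the deviation onto the sphere. By convexity the loss there is at most a
  -- mixture of the losses at `f₀` and at the minimizer, hence at most the loss at `f₀`: a
  -- contradiction.
  set θ := Real.sqrt (q / N) with hθ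
  have hθ0 : 0 ≤ θ := Real.sqrt_nonneg _
  have hθ2 : θ ^ 2 = q / N := Real.sq_sqrt (by positivity)
  have hθ1 : θ ≤ 1 := by
    exact Real.sqrt_le_iff.2 ⟨zero_le_one, by rw [one_pow, div_le_one hNpos]; exact hlt.le⟩
  have hθS : MemSobolev m (fun x => θ * g x) := by
    simpa using hgS.linear_combination hm hgS θ 0
  have hNθ : sobolevNormSq m lam (fun x => θ * g x) = q := by
    rw [sobolevNormSq_const_mul hm lam θ hgS, hθ2, ← hN]; field_simp
  have h1 := hsphere _ hθS hNθ
  have h2 := hf.2 f₀ hf₀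
  have hcomb : (fun x => f₀ x + θ * g x) = fun x => (1 - θ) * f₀ x + θ * f x := by
    ext x; simp only [hg]; ring
  have hpen : l2NormSq (unitDeriv m (fun x => f₀ x + θ * g x)) ≤
      (1 - θ) * l2NormSq (unitDeriv m f₀) + θ * l2NormSq (unitDeriv m f) := by
    rw [hcomb, l2NormSq_congr_ae (hf₀.unitDeriv_top_linear_combination hm hf.1 (1 - θ) θ)]
    exact l2NormSq_linear_combination_le (hf₀.memLp le_rfl) (hf.1.memLp le_rfl) (by linarith)
      hθ0 (by ring)
  have hloss : ∑ i, ρ (y i - (f₀ (t i) + θ * g (t i))) ≤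
      (1 - θ) * ∑ i, ρ (y i - f₀ (t i)) + θ * ∑ i, ρ (y i - f (t i)) := by
    rw [Finset.mul_sum, Finset.mul_sum, ← Finset.sum_add_distrib]
    refine Finset.sum_le_sum fun i _ => ?_
    have := hρ.2 (Set.mem_univ (y i - f₀ (t i))) (Set.mem_univ (y i - f (t i)))
      (show 0 ≤ 1 - θ by linarith) hθ0 (by ring)
    simp only [smul_eq_mul] at this
    convert this using 2
    simp only [hg]; ring
  have hn : (0 : ℝ) ≤ 1 / n := by positivity
  have e1 := mul_le_mul_of_nonneg_left hloss hn
  have e2 := mul_le_mul_of_nonneg_left hpen hlam.le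
  have h3 : penalizedLoss m ρ lam t y (fun x => f₀ x + θ * g x) ≤
      (1 - θ) * penalizedLoss m ρ lam t y f₀ + θ * penalizedLoss m ρ lam t y f := by
    simp only [penalizedLoss]
    linarith
  nlinarith

/-- Lower bound for the excess penalized loss on a sphere. -/
theorem penalizedLoss_lt_of_bounds (hm : 1 ≤ m) (hf₀ : MemSobolev m f₀) (hg : MemSobolev m g)
    {ρ ψ : ℝ → ℝ} {lam τ κ r M : ℝ} (hlam : 0 < lam) (hτ : 0 < τ) (hκ : 0 < κ) (hκ1 : κ ≤ 1)
    {n : ℕ} (hn : 1 ≤ n) {t e : Fin n → ℝ} {S : ℝ → ℝ}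
    (hN : sobolevNormSq m lam g = τ ^ 2)
    (hS : ∀ i, κ * g (t i) ^ 2 ≤ S (g (t i)))
    (hrem : ∑ i, (S (g (t i)) - lossRemainder ρ ψ (e i) (g (t i))) ≤ n * (κ * τ ^ 2 / 4))
    (hlin : ∑ i, ψ (e i) * g (t i) ≤ n * (τ * (M * r)))
    (hemp : l2NormSq g ≤ (1 / (n : ℝ)) * ∑ i, g (t i) ^ 2 + 1 / 4 * sobolevNormSq m lam g)
    (hr : Real.sqrt lam ≤ r)
    (hτr : 4 * (M + 2 * Real.sqrt (l2NormSq (unitDeriv m f₀))) * r < κ * τ) :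
    penalizedLoss m ρ lam t (fun i => f₀ (t i) + e i) f₀ <
      penalizedLoss m ρ lam t (fun i => f₀ (t i) + e i) (fun x => f₀ x + g x) := by
  have hn0 : (0 : ℝ) < n := by exact_mod_cast hn
  set A := l2NormSq (unitDeriv m f₀) with hA
  set B := l2NormSq (unitDeriv m g) with hB
  have hA0 : 0 ≤ A := l2NormSq_nonneg _
  have hB0 : 0 ≤ B := l2NormSq_nonneg _
  have hpen : A + B - 2 * (Real.sqrt A * Real.sqrt B) ≤
      l2NormSq (unitDeriv m (fun x => f₀ x + g x)) := by
    have h1 := hf₀.unitDeriv_top_add_const_mul hm hg 1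
    simp only [one_mul] at h1
    rw [l2NormSq_congr_ae h1]
    exact le_l2NormSq_add (hf₀.memLp le_rfl) (hg.memLp le_rfl)
  -- Mean remainder minus centred fluctuation minus linear noise; `S` plays the role of the mean
  -- remainder.
  have hdiff : ∑ i, ρ (f₀ (t i) + e i - (f₀ (t i) + g (t i))) - ∑ i, ρ (f₀ (t i) + e i - f₀ (t i)) =
      ∑ i, S (g (t i)) - ∑ i, (S (g (t i)) - lossRemainder ρ ψ (e i) (g (t i))) -
        ∑ i, ψ (e i) * g (t i) := by
    rw [← Finset.sum_sub_distrib, ← Finset.sum_sub_distrib, ← Finset.sum_sub_distrib]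
    refine Finset.sum_congr rfl fun i _ => ?_
    rw [lossRemainder, show f₀ (t i) + e i - (f₀ (t i) + g (t i)) = e i - g (t i) by ring,
      show f₀ (t i) + e i - f₀ (t i) = e i by ring]
    ring
  have hSsum : κ * ∑ i, g (t i) ^ 2 ≤ ∑ i, S (g (t i)) := by
    rw [Finset.mul_sum]; exact Finset.sum_le_sum fun i _ => hS i
  have hd : 1 / (n : ℝ) * (κ * ∑ i, g (t i) ^ 2 - n * (κ * τ ^ 2 / 4) - n * (τ * (M * r))) ≤
      1 / (n : ℝ) * ∑ i, ρ (f₀ (t i) + e i - (f₀ (t i) + g (t i))) -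
        1 / (n : ℝ) * ∑ i, ρ (f₀ (t i) + e i - f₀ (t i)) := by
    rw [← mul_sub, hdiff]
    exact mul_le_mul_of_nonneg_left (by linarith) (by positivity)
  have hd' : 1 / (n : ℝ) * (κ * ∑ i, g (t i) ^ 2 - n * (κ * τ ^ 2 / 4) - n * (τ * (M * r))) =
      κ * ((1 / (n : ℝ)) * ∑ i, g (t i) ^ 2) - κ * τ ^ 2 / 4 - τ * (M * r) := by
    field_simp
  rw [hd'] at hd
  have hBτ : lam * (2 * (Real.sqrt A * Real.sqrt B)) ≤ 2 * Real.sqrt A * r * τ := by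
    have h1 : Real.sqrt lam * Real.sqrt B ≤ τ := by
      rw [← Real.sqrt_mul hlam.le, ← Real.sqrt_sq hτ.le]
      refine Real.sqrt_le_sqrt ?_
      rw [← hN, sobolevNormSq]
      linarith [l2NormSq_nonneg g]
    have h2 : Real.sqrt lam * Real.sqrt lam = lam := Real.mul_self_sqrt hlam.le
    have h3 : Real.sqrt lam * (Real.sqrt lam * Real.sqrt B) ≤ r * τ :=
      mul_le_mul hr h1 (by positivity) ((Real.sqrt_nonneg _).trans hr)
    calc lam * (2 * (Real.sqrt A * Real.sqrt B))
        = 2 * Real.sqrt A * (Real.sqrt lam * (Real.sqrt lam * Real.sqrt B)) := by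
          linear_combination (-(2 * Real.sqrt A * Real.sqrt B)) * h2
      _ ≤ 2 * Real.sqrt A * (r * τ) := by gcongr
      _ = _ := by ring
  have hpen' := mul_le_mul_of_nonneg_left hpen hlam.le
  have hemp' := mul_le_mul_of_nonneg_left hemp hκ.le
  rw [hN] at hemp'
  have hN' : l2NormSq g + lam * B = τ ^ 2 := by rw [← hN, sobolevNormSq]
  have hκB : κ * (lam * B) ≤ lam * B := by
    have : 0 ≤ lam * B := by positivity
    nlinarith
  have hκτ : κ * l2NormSq g + κ * (lam * B) = κ * τ ^ 2 := by rw [← hN']; ring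
  -- Of the gain `κτ²`, one quarter goes to the empirical norm, one to the fluctuation and less than
  -- one to noise and penalty cross term; the excess stays positive.
  have hlast : (M + 2 * Real.sqrt A) * r * τ < κ * τ ^ 2 / 4 := by
    have := mul_lt_mul_of_pos_right hτr hτ
    nlinarith
  simp only [penalizedLoss]
  nlinarith

end Comparison

/-! ### Rates -/

/-- The `2m`-th root turns `λ` into the bandwidth `b`. With `x = n^{1/(2m+1)}`, so `n = x^{2m+1}`
and `λ = b^{2m}`, later rate computations use natural powers of `x` and `b`. -/
theorem exists_bandwidth_bounds {m : ℕ} (hm : 1 ≤ m) {lam : ℕ → ℝ} (hlam_pos : ∀ n, 0 < lam n)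
    (hlam : lam =Θ[atTop] (fun n : ℕ => (n : ℝ) ^ (-(2 * (m : ℝ)) / (2 * (m : ℝ) + 1)))) :
    ∃ c₁ c₂ : ℝ, 0 < c₁ ∧ 0 < c₂ ∧ ∀ᶠ n : ℕ in atTop,
      c₁ / (n : ℝ) ^ (1 / (2 * (m : ℝ) + 1)) ≤ lam n ^ (1 / (2 * (m : ℝ))) ∧
      lam n ^ (1 / (2 * (m : ℝ))) ≤ c₂ / (n : ℝ) ^ (1 / (2 * (m : ℝ) + 1)) := by
  have hm0 : (0 : ℝ) < m := by exact_mod_cast hm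
  have hθ := IsTheta.rpow (r := 1 / (2 * (m : ℝ))) (Eventually.of_forall fun n => (hlam_pos n).le)
    (Eventually.of_forall fun n : ℕ => Real.rpow_nonneg (Nat.cast_nonneg n) _) hlam
  have hval : ∀ n : ℕ, ((n : ℝ) ^ (-(2 * (m : ℝ)) / (2 * (m : ℝ) + 1))) ^ (1 / (2 * (m : ℝ))) =
      ((n : ℝ) ^ (1 / (2 * (m : ℝ) + 1)))⁻¹ := fun n => by
    rw [← Real.rpow_mul (Nat.cast_nonneg n), ← Real.rpow_neg (Nat.cast_nonneg n)]
    congr 1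
    field_simp
  simp only [hval] at hθ
  obtain ⟨c₂, hc₂, h₂⟩ := hθ.1.exists_pos
  obtain ⟨c₁, hc₁, h₁⟩ := hθ.2.exists_pos
  refine ⟨c₁⁻¹, c₂, inv_pos.2 hc₁, hc₂, ?_⟩
  filter_upwards [h₁.bound, h₂.bound] with n hn1 hn2
  have hx : 0 ≤ ((n : ℝ) ^ (1 / (2 * (m : ℝ) + 1)))⁻¹ := by positivity
  have hb : 0 ≤ lam n ^ (1 / (2 * (m : ℝ))) := Real.rpow_nonneg (hlam_pos n).le _
  rw [Real.norm_of_nonneg hx, Real.norm_of_nonneg hb] at hn1 hn2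
  refine ⟨?_, by rw [div_eq_mul_inv]; exact hn2⟩
  rw [div_eq_mul_inv, inv_mul_le_iff₀ hc₁]
  exact hn1

theorem rpow_inv_pow_eq {m : ℕ} (n : ℕ) :
    ((n : ℝ) ^ (1 / (2 * (m : ℝ) + 1))) ^ (2 * m + 1) = n := by
  rw [← Real.rpow_natCast, ← Real.rpow_mul (Nat.cast_nonneg n)]
  push_cast
  rw [one_div_mul_cancel (by positivity), Real.rpow_one]

theorem tendsto_rpow_inv_atTop (m : ℕ) :
    Tendsto (fun n : ℕ => (n : ℝ) ^ (1 / (2 * (m : ℝ) + 1))) atTop atTop :=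
  (tendsto_rpow_atTop (by positivity)).comp tendsto_natCast_atTop_atTop

theorem bandwidth_pow_eq {m : ℕ} (hm : 1 ≤ m) {l : ℝ} (hl : 0 < l) :
    (l ^ (1 / (2 * (m : ℝ)))) ^ (2 * m) = l := by
  have hm0 : (0 : ℝ) < m := by exact_mod_cast hm
  rw [← Real.rpow_natCast, ← Real.rpow_mul hl.le]
  push_cast
  rw [one_div_mul_cancel (by positivity), Real.rpow_one]

section RateBounds

variable {m : ℕ} {lam : ℕ → ℝ}

theorem tendsto_bandwidth (hm : 1 ≤ m) (hlam_pos : ∀ n, 0 < lam n)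
    (hlam : lam =Θ[atTop] (fun n : ℕ => (n : ℝ) ^ (-(2 * (m : ℝ)) / (2 * (m : ℝ) + 1)))) :
    Tendsto (fun n => lam n ^ (1 / (2 * (m : ℝ)))) atTop (𝓝 0) := by
  obtain ⟨c₁, c₂, hc₁, hc₂, h⟩ := exists_bandwidth_bounds hm hlam_pos hlam
  refine squeeze_zero' (Eventually.of_forall fun n => Real.rpow_nonneg (hlam_pos n).le _)
    (h.mono fun n hn => hn.2) ?_
  exact (tendsto_rpow_inv_atTop m).const_div_atTop c₂

/-- `n b²` is of order `x^{2m-1}`, which is at least `x` since `m ≥ 1`. This makes the error of the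
empirical norm negligible. -/
theorem tendsto_inv_mul_bandwidth_sq (hm : 1 ≤ m) (hlam_pos : ∀ n, 0 < lam n)
    (hlam : lam =Θ[atTop] (fun n : ℕ => (n : ℝ) ^ (-(2 * (m : ℝ)) / (2 * (m : ℝ) + 1)))) :
    Tendsto (fun n : ℕ => ((n : ℝ) * (lam n ^ (1 / (2 * (m : ℝ)))) ^ 2)⁻¹) atTop (𝓝 0) := by
  obtain ⟨c₁, c₂, hc₁, hc₂, h⟩ := exists_bandwidth_bounds hm hlam_pos hlam
  have hx := tendsto_rpow_inv_atTop m
  refine squeeze_zero' (Eventually.of_forall fun n => by positivity)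
    (g := fun n : ℕ => (c₁ ^ 2)⁻¹ / (n : ℝ) ^ (1 / (2 * (m : ℝ) + 1))) ?_
    (hx.const_div_atTop _)
  filter_upwards [h, hx.eventually_ge_atTop 1] with n hn hx1
  have hpow := rpow_inv_pow_eq (m := m) n
  set x := (n : ℝ) ^ (1 / (2 * (m : ℝ) + 1)) with hxdef
  have hx0 : 0 < x := by linarith
  rw [show (c₁ ^ 2)⁻¹ / x = (c₁ ^ 2 * x)⁻¹ by rw [mul_inv, div_eq_mul_inv]]
  refine inv_anti₀ (by positivity) ?_
  have hsq : (c₁ / x) ^ 2 ≤ (lam n ^ (1 / (2 * (m : ℝ)))) ^ 2 :=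
    pow_le_pow_left₀ (by positivity) hn.1 2
  calc c₁ ^ 2 * x = x ^ 3 * (c₁ / x) ^ 2 := by field_simp
    _ ≤ x ^ (2 * m + 1) * (c₁ / x) ^ 2 := by
        gcongr
        omega
    _ ≤ x ^ (2 * m + 1) * (lam n ^ (1 / (2 * (m : ℝ)))) ^ 2 := by gcongr
    _ = _ := by rw [hpow]

/-- A squared sphere radius of order `R` gives a squared sup norm of order `R/b`; its vanishing
brings the sphere into the range where (A2) and (A3) are informative. -/
theorem tendsto_rate_div_bandwidth (hm : 1 ≤ m) (hlam_pos : ∀ n, 0 < lam n)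
    (hlam : lam =Θ[atTop] (fun n : ℕ => (n : ℝ) ^ (-(2 * (m : ℝ)) / (2 * (m : ℝ) + 1)))) :
    Tendsto (fun n : ℕ => (lam n + ((n : ℝ) * lam n ^ (1 / (2 * (m : ℝ))))⁻¹) /
      lam n ^ (1 / (2 * (m : ℝ)))) atTop (𝓝 0) := by
  have hb := tendsto_bandwidth hm hlam_pos hlam
  have hs := hb.add (tendsto_inv_mul_bandwidth_sq hm hlam_pos hlam)
  rw [add_zero] at hs
  have hpos : ∀ n, 0 < lam n ^ (1 / (2 * (m : ℝ))) := fun n => Real.rpow_pos_of_pos (hlam_pos n) _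
  refine squeeze_zero' (Eventually.of_forall fun n => ?_) ?_ hs
  · have := hpos n
    have := hlam_pos n
    positivity
  filter_upwards [hb.eventually_le_const one_pos] with n hn
  have hbp := hpos n
  have hl := bandwidth_pow_eq hm (hlam_pos n)
  set b := lam n ^ (1 / (2 * (m : ℝ))) with hbdef
  rw [add_div]
  refine add_le_add ?_ (le_of_eq (by field_simp))
  rw [div_le_iff₀ hbp, ← hl, ← sq]
  exact pow_le_pow_of_le_one hbp.le hn (by omega)

/-- Comparison of the squared rate of convergence with powers of the sample size and with the
smoothing parameter. -/
theorem exists_rate_bounds (hm : 1 ≤ m) (hlam_pos : ∀ n, 0 < lam n)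
    (hlam : lam =Θ[atTop] (fun n : ℕ => (n : ℝ) ^ (-(2 * (m : ℝ)) / (2 * (m : ℝ) + 1)))) :
    ∃ a A : ℝ, 0 < a ∧ 0 < A ∧ ∀ᶠ n : ℕ in atTop,
      0 < (n : ℝ) ^ (1 / (2 * (m : ℝ) + 1)) ∧
      a / (n : ℝ) ^ (1 / (2 * (m : ℝ) + 1)) ≤ lam n ^ (1 / (2 * (m : ℝ))) ∧
      lam n + ((n : ℝ) * lam n ^ (1 / (2 * (m : ℝ))))⁻¹ ≤
        A / ((n : ℝ) ^ (1 / (2 * (m : ℝ) + 1))) ^ (2 * m) ∧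
      lam n + ((n : ℝ) * lam n ^ (1 / (2 * (m : ℝ))))⁻¹ ≤ A / a ^ (2 * m) * lam n := by
  obtain ⟨c₁, c₂, hc₁, hc₂, h⟩ := exists_bandwidth_bounds hm hlam_pos hlam
  refine ⟨c₁, c₂ ^ (2 * m) + c₁⁻¹, hc₁, by positivity, ?_⟩
  filter_upwards [h, (tendsto_rpow_inv_atTop m).eventually_ge_atTop 1] with n hn hx1
  have hpow := rpow_inv_pow_eq (m := m) n
  set x := (n : ℝ) ^ (1 / (2 * (m : ℝ) + 1)) with hxdef
  have hx0 : 0 < x := by linarith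
  have hl := bandwidth_pow_eq hm (hlam_pos n)
  have hbp : 0 < lam n ^ (1 / (2 * (m : ℝ))) := Real.rpow_pos_of_pos (hlam_pos n) _
  set b := lam n ^ (1 / (2 * (m : ℝ))) with hbdef
  have hup : lam n ≤ c₂ ^ (2 * m) / x ^ (2 * m) := by
    rw [← hl, ← div_pow]; exact pow_le_pow_left₀ hbp.le hn.2 _
  have hlow : c₁ ^ (2 * m) / x ^ (2 * m) ≤ lam n := by
    rw [← hl, ← div_pow]; exact pow_le_pow_left₀ (by positivity) hn.1 _
  have hinv : ((n : ℝ) * b)⁻¹ ≤ c₁⁻¹ / x ^ (2 * m) := by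
    rw [div_eq_mul_inv, ← mul_inv]
    refine inv_anti₀ (by positivity) ?_
    calc c₁ * x ^ (2 * m) = x ^ (2 * m + 1) * (c₁ / x) := by rw [pow_succ]; field_simp
      _ ≤ x ^ (2 * m + 1) * b := mul_le_mul_of_nonneg_left hn.1 (by positivity)
      _ = _ := by rw [hpow]
  have hsum : lam n + ((n : ℝ) * b)⁻¹ ≤ (c₂ ^ (2 * m) + c₁⁻¹) / x ^ (2 * m) := by
    rw [add_div]; exact add_le_add hup hinv
  refine ⟨hx0, hn.1, hsum, hsum.trans ?_⟩
  calc (c₂ ^ (2 * m) + c₁⁻¹) / x ^ (2 * m)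
      = (c₂ ^ (2 * m) + c₁⁻¹) / c₁ ^ (2 * m) * (c₁ ^ (2 * m) / x ^ (2 * m)) := by field_simp
    _ ≤ _ := by gcongr

theorem rpow_derivative_rate {j : ℕ} {n : ℕ} (hn : 0 < n) :
    (n : ℝ) ^ (-(2 * ((m : ℝ) - (j : ℝ))) / (2 * (m : ℝ) + 1)) =
      ((n : ℝ) ^ (1 / (2 * (m : ℝ) + 1))) ^ (2 * j) /
        ((n : ℝ) ^ (1 / (2 * (m : ℝ) + 1))) ^ (2 * m) := by
  have hn0 : (0 : ℝ) < n := by exact_mod_cast hn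
  rw [← Real.rpow_natCast, ← Real.rpow_natCast, ← Real.rpow_mul hn0.le, ← Real.rpow_mul hn0.le,
    ← Real.rpow_sub hn0]
  congr 1
  push_cast
  ring

end RateBounds

/-! ### Deviation bound at a fixed sample size -/

section FixedSampleSize

variable {Ω : Type*} [MeasurableSpace Ω] {μ : Measure Ω} [IsProbabilityMeasure μ]
  {ν : Measure ℝ} [IsProbabilityMeasure ν] {n : ℕ} {X : Fin n → Ω → ℝ}
  {m : ℕ} {f₀ ρ ψ : ℝ → ℝ}

/-- Deviation bound for M-type smoothing splines at a fixed sample size. -/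
theorem measure_lt_sobolevNormSq_sub_le (hm : 1 ≤ m) (hf₀ : MemSobolev m f₀)
    (hX : ∀ i, Measurable (X i)) (hind : iIndepFun X μ) (hlaw : ∀ i, μ.map (X i) = ν)
    (hρ : ConvexOn ℝ Set.univ ρ) (hρc : Continuous ρ) (hψ : IsSubgradientSelection ρ ψ)
    (hψ2 : MemLp ψ 2 ν) (hψ0 : ∫ e, ψ e ∂ν = 0)
    {κ η δ : ℝ} (hκ : 0 < κ) (hκ1 : κ ≤ 1) (hη : 0 ≤ η)
    (hS : ∀ u, |u| ≤ η → κ * u ^ 2 ≤ ∫ e, lossRemainder ρ ψ e u ∂ν)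
    (hD : MemLp (fun e => ψ (e + η) - ψ (e - η)) 2 ν)
    (hDδ : ∫ e, (ψ (e + η) - ψ (e - η)) ^ 2 ∂ν ≤ δ)
    (hn : 1 ≤ n) {t : Fin n → ℝ} {b C : ℝ} (hb : 0 < b)
    {G : Fin n → Fin n → ℝ} (hGC : ∀ i, b * G i i ≤ C)
    (hG : ∀ z : Fin n → ℝ, 0 ≤ ∑ i, ∑ j, z i * z j * G i j)
    (hrep : ∀ g : ℝ → ℝ, MemSobolev m g → ∀ z : Fin n → ℝ, (∑ i, z i * g (t i)) ^ 2 ≤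
      sobolevNormSq m (b ^ (2 * m)) g * ∑ i, ∑ j, z i * z j * G i j)
    (hemp : ∀ g : ℝ → ℝ, MemSobolev m g → l2NormSq g ≤ (1 / (n : ℝ)) * ∑ i, g (t i) ^ 2 +
      1 / 4 * sobolevNormSq m (b ^ (2 * m)) g)
    {τ r M : ℝ} (hM : 0 < M) (hr0 : 0 < r) (hrτ : r ≤ τ) (hrn : 1 ≤ r ^ 2 * (n * b))
    (hsup : ∀ g : ℝ → ℝ, MemSobolev m g → sobolevNormSq m (b ^ (2 * m)) g = τ ^ 2 →
      ∀ i, |g (t i)| ≤ η)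
    (hr : Real.sqrt (b ^ (2 * m)) ≤ r)
    (hτr : 4 * (M + 2 * Real.sqrt (l2NormSq (unitDeriv m f₀))) * r < κ * τ)
    {fhat : Ω → ℝ → ℝ}
    (hfhat : ∀ ω, IsMTypeSpline m ρ (b ^ (2 * m)) t (fun i => f₀ (t i) + X i ω) (fhat ω)) :
    μ {ω | τ ^ 2 < sobolevNormSq m (b ^ (2 * m)) (fun x => fhat ω x - f₀ x)} ≤
      ENNReal.ofReal ((∫ e, ψ e ^ 2 ∂ν) * C / M ^ 2) +
        ENNReal.ofReal (8 * Real.sqrt (δ * C) / κ) := by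
  have hn0 : (0 : ℝ) < n := by exact_mod_cast hn
  have hτ : 0 < τ := hr0.trans_le hrτ
  have hlam : 0 < b ^ (2 * m) := by positivity
  have hGsum : ∑ i, G i i ≤ n * C / b := by
    calc ∑ i, G i i ≤ ∑ _i : Fin n, C / b :=
          Finset.sum_le_sum fun i _ => by rw [le_div_iff₀ hb, mul_comm]; exact hGC i
      _ = n * C / b := by simp [mul_div_assoc]
  have hGsum0 : 0 ≤ ∑ i, G i i := Finset.sum_nonneg fun i _ => gram_diag_nonneg hG i
  have hC : 0 ≤ C := by
    have := mul_nonneg hb.le (gram_diag_nonneg hG ⟨0, hn⟩)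
    exact this.trans (hGC _)
  have hσ : 0 ≤ ∫ e, ψ e ^ 2 ∂ν := integral_nonneg fun e => sq_nonneg _
  have hδ : 0 ≤ δ := (integral_nonneg fun e => sq_nonneg _).trans hDδ
  set T : Set (Fin n → ℝ) := {u | ∃ g, MemSobolev m g ∧
    sobolevNormSq m (b ^ (2 * m)) g = τ ^ 2 ∧ u = fun i => g (t i)} with hT
  have hTz : ∀ u ∈ T, ∀ z : Fin n → ℝ,
      ∑ i, z i * u i ≤ τ * Real.sqrt (∑ i, ∑ j, z i * z j * G i j) := by
    rintro u ⟨g, hg, hN, rfl⟩ z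
    refine (Real.le_sqrt_of_sq_le (hrep g hg z)).trans (le_of_eq ?_)
    rw [hN, Real.sqrt_mul (sq_nonneg τ), Real.sqrt_sq hτ.le]
  -- The two bad events: large noise, measured uniformly over the sphere by the quadratic form, and
  -- large fluctuation of the remainder. Off their union the comparison is deterministic.
  set E₁ := {ω | (n * (M * r)) ^ 2 < ∑ i, ∑ j, ψ (X i ω) * ψ (X j ω) * G i j} with hE₁
  set E₂ := {ω | ∃ u ∈ T, n * (κ * τ ^ 2 / 4) <
    ∑ i, ((∫ e, lossRemainder ρ ψ e (u i) ∂ν) - lossRemainder ρ ψ (X i ω) (u i))} with hE₂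
  have h₁ : μ E₁ ≤ ENNReal.ofReal ((∫ e, ψ e ^ 2 ∂ν) * C / M ^ 2) := by
    refine (measure_quadraticForm_lt_le hX hind hlaw hψ.measurable hψ2 hψ0 hG
      (by positivity)).trans (ENNReal.ofReal_le_ofReal ?_)
    calc (∫ e, ψ e ^ 2 ∂ν) * (∑ i, G i i) / (n * (M * r)) ^ 2
        ≤ (∫ e, ψ e ^ 2 ∂ν) * (n * C / b) / (n * (M * r)) ^ 2 := by gcongr
      _ = (∫ e, ψ e ^ 2 ∂ν) * C / M ^ 2 / (r ^ 2 * (n * b)) := by field_simp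
      _ ≤ _ := div_le_self (by positivity) hrn
  have h₂ : μ E₂ ≤ ENNReal.ofReal (8 * Real.sqrt (δ * C) / κ) := by
    refine (measure_exists_lt_le (D := fun e => ψ (e + η) - ψ (e - η)) (η := η) hX hind hlaw hη
      ?_ (fun e => ?_) hD (fun e => lossRemainder_zero ρ ψ e)
      (fun u hu => hψ.integrable_lossRemainder hρc hD hu)
      (fun e u v hu _ => hψ.lossRemainder_sub_le hu) hG hτ.le ?_ hTz (by positivity)).trans
      (ENNReal.ofReal_le_ofReal ?_)
    · have := hψ.measurable
      fun_prop
    · linarith [hψ.monotone (show e - η ≤ e + η by linarith)]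
    · rintro u ⟨g, hg, hN, rfl⟩ i
      exact hsup g hg hN i
    · have hs1 : Real.sqrt (4 * (∫ e, (ψ (e + η) - ψ (e - η)) ^ 2 ∂ν) * ∑ i, G i i) ≤
          2 * Real.sqrt (δ * C) * (n * τ) := by
        refine Real.sqrt_le_iff.2 ⟨by positivity, ?_⟩
        have hrn' : 1 ≤ τ ^ 2 * (n * b) := hrn.trans (by gcongr)
        calc 4 * (∫ e, (ψ (e + η) - ψ (e - η)) ^ 2 ∂ν) * ∑ i, G i i
            ≤ 4 * δ * (n * C / b) := by gcongr
          _ = 4 * δ * (n * C / b) * 1 := by ring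
          _ ≤ 4 * δ * (n * C / b) * (τ ^ 2 * (n * b)) := by gcongr
          _ = (2 * (n * τ)) ^ 2 * (δ * C) := by field_simp; ring
          _ = _ := by rw [← Real.sq_sqrt (show 0 ≤ δ * C by positivity)]; ring_nf; simp
      calc τ * Real.sqrt (4 * (∫ e, (ψ (e + η) - ψ (e - η)) ^ 2 ∂ν) * ∑ i, G i i) /
            (n * (κ * τ ^ 2 / 4))
          ≤ τ * (2 * Real.sqrt (δ * C) * (n * τ)) / (n * (κ * τ ^ 2 / 4)) := by gcongr
        _ = _ := by field_simp; ring
  refine (measure_mono (t := E₁ ∪ E₂) fun ω hω => ?_).trans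
    ((measure_union_le _ _).trans (add_le_add h₁ h₂))
  by_contra hnot
  rw [Set.mem_union, not_or] at hnot
  obtain ⟨hn1, hn2⟩ := hnot
  simp only [hE₁, hE₂, Set.mem_ofPred_eq, not_lt, not_exists, not_and] at hn1 hn2
  rw [Set.mem_ofPred_eq, ← not_le] at hω
  refine hω ?_
  refine sobolevNormSq_sub_le_of_sphere hm hf₀ hρ hlam (by positivity) (hfhat ω)
    fun g hg hN => ?_
  have hgT : (fun i => g (t i)) ∈ T := ⟨g, hg, hN, rfl⟩
  refine penalizedLoss_lt_of_bounds (S := fun u => ∫ e, lossRemainder ρ ψ e u ∂ν) (M := M)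
    hm hf₀ hg hlam hτ hκ hκ1 hn hN (fun i => hS _ (hsup g hg hN i)) (hn2 _ hgT) ?_ (hemp g hg)
    hr hτr
  refine (hTz _ hgT fun i => ψ (X i ω)).trans ?_
  have : Real.sqrt (∑ i, ∑ j, ψ (X i ω) * ψ (X j ω) * G i j) ≤ n * (M * r) :=
    Real.sqrt_le_iff.2 ⟨by positivity, hn1⟩
  calc τ * Real.sqrt (∑ i, ∑ j, ψ (X i ω) * ψ (X j ω) * G i j) ≤ τ * (n * (M * r)) := by gcongr
    _ = _ := by ring

end FixedSampleSize

/-! ### M-type smoothing splines: rates of convergence -/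

section DerivativeRate

variable {Ω : Type*} [MeasurableSpace Ω] {μ : Measure Ω} {m : ℕ} {f₀ : ℝ → ℝ}

/-- A rate of convergence in the Sobolev norm entails rates for the lower order derivatives. -/
theorem isBigOInProb_l2NormSq_unitDeriv_sub (hm : 1 ≤ m) (hf₀ : MemSobolev m f₀)
    {lam : ℕ → ℝ} (hlam_pos : ∀ n, 0 < lam n)
    (hlam : lam =Θ[atTop] (fun n : ℕ => (n : ℝ) ^ (-(2 * (m : ℝ)) / (2 * (m : ℝ) + 1))))
    {fhat : ℕ → Ω → ℝ → ℝ} (hfhat : ∀ n, m ≤ n → ∀ ω, MemSobolev m (fhat n ω))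
    (hrate : IsBigOInProb μ (fun n ω => sobolevNormSq m (lam n) (fun x => fhat n ω x - f₀ x))
      (fun n => lam n + ((n : ℝ) * lam n ^ (1 / (2 * (m : ℝ))))⁻¹)) {j : ℕ} (hj : j < m) :
    IsBigOInProb μ (fun n ω => l2NormSq (fun x => unitDeriv j (fhat n ω) x - unitDeriv j f₀ x))
      (fun n => (n : ℝ) ^ (-(2 * ((m : ℝ) - (j : ℝ))) / (2 * (m : ℝ) + 1))) := by
  obtain ⟨C, hC, hint⟩ := exists_l2NormSq_unitDeriv_le hj.le
  obtain ⟨a, A, ha, hA, hbd⟩ := exists_rate_bounds hm hlam_pos hlam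
  intro δ hδ
  obtain ⟨K, hK, hKn⟩ := hrate δ hδ
  refine ⟨C * (K * A) / a ^ (2 * j), by positivity, ?_⟩
  filter_upwards [hKn, hbd, (tendsto_bandwidth hm hlam_pos hlam).eventually_le_const one_pos,
    eventually_ge_atTop m] with n hn hbn hb1 hnm
  refine (measure_mono (Set.ofPred_subset_ofPred.2 fun ω hω => ?_)).trans hn
  by_contra hle
  rw [not_lt, abs_of_nonneg (sobolevNormSq_nonneg m (hlam_pos n).le _)] at hle
  rw [abs_of_nonneg (l2NormSq_nonneg _), rpow_derivative_rate (by omega)] at hω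
  refine absurd hω (not_lt.2 ?_)
  obtain ⟨hx0, hlow, hup, -⟩ := hbn
  have hb : 0 < lam n ^ (1 / (2 * (m : ℝ))) := Real.rpow_pos_of_pos (hlam_pos n) _
  have hl := bandwidth_pow_eq hm (hlam_pos n)
  have hgS : MemSobolev m (fun x => fhat n ω x - f₀ x) := by
    simpa [sub_eq_add_neg] using (hfhat n hnm ω).linear_combination hm hf₀ 1 (-1)
  have hder : Set.EqOn (fun x => unitDeriv j (fhat n ω) x - unitDeriv j f₀ x)
      (unitDeriv j (fun x => fhat n ω x - f₀ x)) (Set.Icc 0 1) := by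
    have := (hfhat n hnm ω).unitDeriv_linear_combination hf₀ 1 (-1) hj
    simpa [sub_eq_add_neg] using this.symm
  rw [l2NormSq_congr hder]
  have h1 := hint _ hb hb1 _ hgS
  rw [hl] at h1
  set x := (n : ℝ) ^ (1 / (2 * (m : ℝ) + 1)) with hxdef
  set b := lam n ^ (1 / (2 * (m : ℝ))) with hbdef
  set L := l2NormSq (unitDeriv j (fun x => fhat n ω x - f₀ x)) with hL
  have hL0 : 0 ≤ L := l2NormSq_nonneg _
  -- Interpolation at scale `b`, with `b` bounded below by `a/x` and the rate bounded above by
  -- `A/x^{2m}`.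
  have h2 : (a / x) ^ (2 * j) * L ≤ C * (K * (A / x ^ (2 * m))) :=
    calc (a / x) ^ (2 * j) * L ≤ b ^ (2 * j) * L := by gcongr
      _ ≤ _ := h1
      _ ≤ C * (K * (A / x ^ (2 * m))) := by
        gcongr
        exact hle.trans (by gcongr)
  calc L = (x / a) ^ (2 * j) * ((a / x) ^ (2 * j) * L) := by
        rw [← mul_assoc, ← mul_pow, div_mul_div_cancel₀ ha.ne', div_self hx0.ne', one_pow, one_mul]
    _ ≤ (x / a) ^ (2 * j) * (C * (K * (A / x ^ (2 * m)))) := by gcongr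
    _ = _ := by rw [div_pow]; field_simp

end DerivativeRate

section BasicRate

variable {Ω : Type*} [MeasurableSpace Ω] {μ : Measure Ω} [IsProbabilityMeasure μ]
  {ν : Measure ℝ} [IsProbabilityMeasure ν] {m : ℕ} {f₀ ρ ψ : ℝ → ℝ}

/-- Every sequence of M-type smoothing splines attains the basic rate of convergence. -/
theorem isBigOInProb_sobolevNormSq_sub (hm : 1 ≤ m) (hf₀ : MemSobolev m f₀)
    {t : (n : ℕ) → Fin n → ℝ} (ht : ∀ n i, t n i ∈ Set.Icc (0 : ℝ) 1)
    {ε : ℕ → Ω → ℝ} (hε_meas : ∀ i, Measurable (ε i)) (hε_indep : iIndepFun ε μ)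
    (hlaw : ∀ i, μ.map (ε i) = ν)
    (hρ : ConvexOn ℝ Set.univ ρ) (hρc : Continuous ρ) (hψ : IsSubgradientSelection ρ ψ)
    (hA2 : Tendsto (fun s : ℝ => ∫⁻ e, ENNReal.ofReal ((ψ (e + s) - ψ e) ^ 2) ∂ν) (𝓝 0) (𝓝 0))
    (hψ2 : MemLp ψ 2 ν) (hψ0 : ∫ e, ψ e ∂ν = 0) {ξ : ℝ} (hξ : 0 < ξ)
    (hlin : (fun s : ℝ => (∫ e, ψ (e + s) ∂ν) - ξ * s) =o[𝓝 0] (fun s : ℝ => s))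
    (hA4 : IsQuasiUniform t) {lam : ℕ → ℝ} (hlam_pos : ∀ n, 0 < lam n)
    (hlam : lam =Θ[atTop] (fun n : ℕ => (n : ℝ) ^ (-(2 * (m : ℝ)) / (2 * (m : ℝ) + 1))))
    {fhat : ℕ → Ω → ℝ → ℝ}
    (hfhat : ∀ n, m ≤ n → ∀ ω,
      IsMTypeSpline m ρ (lam n) (t n) (fun i => f₀ (t n i) + ε i ω) (fhat n ω)) :
    IsBigOInProb μ (fun n ω => sobolevNormSq m (lam n) (fun x => fhat n ω x - f₀ x))
      (fun n => lam n + ((n : ℝ) * lam n ^ (1 / (2 * (m : ℝ))))⁻¹) := by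
  obtain ⟨η₀, hη₀, hlow⟩ := hψ.exists_le_integral_lossRemainder hρc hA2 hψ2 hψ0 hξ hlin
  obtain ⟨C, hC, hgram⟩ := exists_gram hm
  obtain ⟨C₁, hC₁, hsup⟩ := exists_sq_le_sobolevNormSq hm
  obtain ⟨C₂, hC₂, hemp⟩ := exists_l2NormSq_le_empirical hm hA4
  intro δ hδ
  set κ := min (ξ / 8) 1 with hκdef
  have hκ : 0 < κ := lt_min (by positivity) one_pos
  set σ := ∫ e, ψ e ^ 2 ∂ν with hσdef
  have hσ : 0 ≤ σ := integral_nonneg fun e => sq_nonneg _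
  -- Chosen to give the noise event probability at most `δ/2`. Next, `K` makes the drift dominate
  -- the noise, its `+ 1` supplying strictness; the oscillation level `(δκ/16)²/C` then makes the
  -- second event cost exactly `δ/2`.
  set M := 2 * (σ * C) / δ + 1 with hMdef
  have hM1 : 1 ≤ M := by rw [hMdef]; linarith [show 0 ≤ 2 * (σ * C) / δ by positivity]
  set F := Real.sqrt (l2NormSq (unitDeriv m f₀)) with hF
  have hF0 : 0 ≤ F := Real.sqrt_nonneg _
  set K := 4 * (M + 2 * F) / κ + 1 with hKdef
  have hK1 : 1 ≤ K := by rw [hKdef]; linarith [show 0 ≤ 4 * (M + 2 * F) / κ by positivity]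
  obtain ⟨η, hη, hηη₀, hD, hDδ⟩ := hψ.exists_integral_oscillation_sq_le hA2
    (show 0 < (δ * κ / 16) ^ 2 / C by positivity) hη₀
  have hp1 : σ * C / M ^ 2 ≤ δ / 2 := by
    rw [div_le_iff₀ (by positivity)]
    have h1 : δ / 2 * M = σ * C + δ / 2 := by rw [hMdef]; field_simp
    have h2 : δ / 2 * M ≤ δ / 2 * M ^ 2 := by gcongr; exact le_self_pow₀ hM1 two_ne_zero
    linarith
  have hp2 : 8 * Real.sqrt ((δ * κ / 16) ^ 2 / C * C) / κ = δ / 2 := by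
    rw [div_mul_cancel₀ _ hC.ne', Real.sqrt_sq (by positivity)]
    field_simp
    norm_num
  refine ⟨K ^ 2, by positivity, ?_⟩
  have e1 := (tendsto_bandwidth hm hlam_pos hlam).eventually_le_const one_pos
  have e2 := ((tendsto_inv_mul_bandwidth_sq hm hlam_pos hlam).const_mul C₂).eventually_le_const
    (show C₂ * 0 < 1 / 4 by norm_num)
  have e3 := ((tendsto_rate_div_bandwidth hm hlam_pos hlam).const_mul
    (C₁ * K ^ 2)).eventually_le_const (show C₁ * K ^ 2 * 0 < η ^ 2 by rw [mul_zero]; positivity)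
  filter_upwards [e1, e2, e3, eventually_ge_atTop 2, eventually_ge_atTop m] with
    n hb1 hn2 hn3 h2 hnm
  have hn0 : (0 : ℝ) < n := by positivity
  have hb : 0 < lam n ^ (1 / (2 * (m : ℝ))) := Real.rpow_pos_of_pos (hlam_pos n) _
  have hl := bandwidth_pow_eq hm (hlam_pos n)
  have hlpos := hlam_pos n
  have hf := hfhat n hnm
  -- From here on `λ` is replaced throughout by `b ^ (2 * m)`.
  generalize hln : lam n = l at *
  set b := l ^ (1 / (2 * (m : ℝ))) with hbdef
  clear_value b
  subst hl
  set R := b ^ (2 * m) + ((n : ℝ) * b)⁻¹ with hR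
  have hR0 : 0 < R := by positivity
  obtain ⟨G, hGC, hG, hrep⟩ := hgram b hb hb1 n (t n) (ht n)
  have hKR : (K * Real.sqrt R) ^ 2 = K ^ 2 * R := by rw [mul_pow, Real.sq_sqrt hR0.le]
  have hmain := measure_lt_sobolevNormSq_sub_le (μ := μ) (ν := ν) (X := fun i : Fin n => ε i)
    (τ := K * Real.sqrt R) (r := Real.sqrt R) (M := M) hm hf₀
    (fun i => hε_meas i) (hε_indep.precomp Fin.val_injective) (fun i => hlaw i) hρ hρc hψ hψ2 hψ0
    hκ (min_le_right _ _) hη.le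
    (fun u hu => (mul_le_mul_of_nonneg_right (min_le_left _ _) (sq_nonneg u)).trans
      (hlow u (hu.trans hηη₀))) hD hDδ (by omega) hb hGC hG hrep ?_ (by positivity)
    (Real.sqrt_pos.2 hR0) (le_mul_of_one_le_left (Real.sqrt_nonneg _) hK1) ?_ ?_
    (Real.sqrt_le_sqrt (by rw [hR]; linarith [show 0 ≤ ((n : ℝ) * b)⁻¹ by positivity])) ?_ hf
  · rw [hKR] at hmain
    refine le_trans (le_of_eq ?_) (hmain.trans ?_)
    · congr 1
      ext ω
      simp only [Set.mem_ofPred_eq]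
      rw [abs_of_nonneg (sobolevNormSq_nonneg m (by positivity) _)]
    · rw [hp2, ← ENNReal.ofReal_add (by positivity) (by positivity)]
      exact ENNReal.ofReal_le_ofReal (by linarith)
  · intro g hg
    refine (hemp b hb hb1 n h2 g hg).trans ?_
    have hN := sobolevNormSq_nonneg m (by positivity : 0 ≤ b ^ (2 * m)) g
    rw [← div_eq_mul_inv] at hn2
    gcongr
  · rw [Real.sq_sqrt hR0.le]
    calc 1 = ((n : ℝ) * b)⁻¹ * (n * b) := by field_simp
      _ ≤ R * (n * b) := by
        gcongr
        rw [hR]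
        linarith [show 0 ≤ b ^ (2 * m) by positivity]
  · intro g hg hN i
    have h := hsup b hb hb1 g hg (t n i) (ht n i)
    rw [hN, hKR] at h
    refine abs_le_of_sq_le_sq' ?_ hη.le |> abs_le.2
    refine le_trans ?_ hn3
    rw [← mul_div_assoc, le_div_iff₀ hb]
    linarith
  · have h1 : κ * K = 4 * (M + 2 * F) + κ := by rw [hKdef]; field_simp
    have h3 := Real.sqrt_pos.2 hR0
    rw [← mul_assoc, h1]
    nlinarith

/-- A real random variable is bounded in probability. -/
theorem exists_measure_lt_le {Z : Ω → ℝ} (hZ : Measurable Z) {δ : ℝ} (hδ : 0 < δ) :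
    ∃ k : ℝ, μ {ω | k < Z ω} ≤ ENNReal.ofReal δ := by
  have h := tendsto_measure_iInter_atTop (μ := μ) (s := fun k : ℕ => {ω | (k : ℝ) < Z ω})
    (fun k => (measurableSet_lt measurable_const hZ).nullMeasurableSet)
    (fun k l hkl => Set.ofPred_subset_ofPred.2 fun ω hω =>
      lt_of_le_of_lt (by exact_mod_cast hkl) hω)
    ⟨0, measure_ne_top _ _⟩
  have hempty : ⋂ k : ℕ, {ω | (k : ℝ) < Z ω} = ∅ := by
    ext ω
    simp only [Set.mem_iInter, Set.mem_ofPred_eq, Set.mem_empty_iff_false, iff_false, not_forall,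
      not_lt]
    exact exists_nat_ge (Z ω)
  rw [hempty, measure_empty] at h
  obtain ⟨k, hk⟩ := (h.eventually_le_const (ENNReal.ofReal_pos.2 hδ)).exists
  exact ⟨k, hk⟩

/-- At each sample size the top derivative of an M-type smoothing spline is dominated by a
measurable function of the errors. -/
theorem exists_measurable_ge_l2NormSq {n : ℕ} (hf₀ : MemSobolev m f₀) (hρc : Continuous ρ)
    {B : ℝ} (hB : ∀ x, -B ≤ ρ x) {lam : ℝ} (hlam : 0 < lam) {t : Fin n → ℝ} {X : Fin n → Ω → ℝ}
    (hX : ∀ i, Measurable (X i)) {fhat : Ω → ℝ → ℝ}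
    (hfhat : ∀ ω, IsMTypeSpline m ρ lam t (fun i => f₀ (t i) + X i ω) (fhat ω)) :
    ∃ Z : Ω → ℝ, Measurable Z ∧ ∀ ω, l2NormSq (unitDeriv m (fhat ω)) ≤ Z ω := by
  refine ⟨fun ω => ((1 / (n : ℝ)) * ∑ i, (ρ (X i ω) + B)) / lam + l2NormSq (unitDeriv m f₀), ?_,
    fun ω => ?_⟩
  · have := hρc.measurable
    fun_prop
  · have h := (hfhat ω).2 f₀ hf₀
    simp only [penalizedLoss, add_sub_cancel_left] at h
    have h1 : (1 / (n : ℝ)) * ∑ _i : Fin n, (-B) ≤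
        (1 / (n : ℝ)) * ∑ i, ρ (f₀ (t i) + X i ω - fhat ω (t i)) :=
      mul_le_mul_of_nonneg_left (Finset.sum_le_sum fun i _ => hB _) (by positivity)
    have h2 : (1 / (n : ℝ)) * ∑ i, (ρ (X i ω) + B) =
        (1 / (n : ℝ)) * ∑ i, ρ (X i ω) - (1 / (n : ℝ)) * ∑ _i : Fin n, (-B) := by
      rw [← mul_sub, ← Finset.sum_sub_distrib]
      simp only [sub_neg_eq_add]
    beta_reduce
    rw [h2, ← sub_le_iff_le_add, le_div_iff₀ hlam]
    linarith

/-- The top derivatives of M-type smoothing splines with the basic rate are tight. -/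
theorem isTightL2_unitDeriv (hm : 1 ≤ m) (hf₀ : MemSobolev m f₀)
    {t : (n : ℕ) → Fin n → ℝ} {ε : ℕ → Ω → ℝ} (hε_meas : ∀ i, Measurable (ε i))
    (hρc : Continuous ρ) {B : ℝ} (hB : ∀ x, -B ≤ ρ x)
    {lam : ℕ → ℝ} (hlam_pos : ∀ n, 0 < lam n)
    (hlam : lam =Θ[atTop] (fun n : ℕ => (n : ℝ) ^ (-(2 * (m : ℝ)) / (2 * (m : ℝ) + 1))))
    {fhat : ℕ → Ω → ℝ → ℝ}
    (hfhat : ∀ n, m ≤ n → ∀ ω,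
      IsMTypeSpline m ρ (lam n) (t n) (fun i => f₀ (t n i) + ε i ω) (fhat n ω))
    (hrate : IsBigOInProb μ (fun n ω => sobolevNormSq m (lam n) (fun x => fhat n ω x - f₀ x))
      (fun n => lam n + ((n : ℝ) * lam n ^ (1 / (2 * (m : ℝ))))⁻¹)) :
    IsTightL2 μ m (fun n ω => unitDeriv m (fhat n ω)) := by
  obtain ⟨a, A, ha, hA, hbd⟩ := exists_rate_bounds hm hlam_pos hlam
  intro δ hδ
  obtain ⟨K, hK, hKn⟩ := hrate δ hδ
  set F := l2NormSq (unitDeriv m f₀) with hF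
  have hF0 : 0 ≤ F := l2NormSq_nonneg _
  set K₁ := 2 * (K * (A / a ^ (2 * m))) + 2 * F with hK₁
  have hK₁0 : 0 ≤ K₁ := by positivity
  have hlarge : ∀ᶠ n in atTop, m ≤ n →
      μ {ω | K₁ < l2NormSq (unitDeriv m (fhat n ω))} ≤ ENNReal.ofReal δ := by
    filter_upwards [hKn, hbd] with n hn hbn hnm
    refine (measure_mono (Set.ofPred_subset_ofPred.2 fun ω hω => ?_)).trans hn
    by_contra hle
    rw [not_lt, abs_of_nonneg (sobolevNormSq_nonneg m (hlam_pos n).le _)] at hle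
    refine absurd hω (not_lt.2 ?_)
    have hlp := hlam_pos n
    have hf := (hfhat n hnm ω).1
    have hgS : MemSobolev m (fun x => fhat n ω x - f₀ x) := by
      simpa [sub_eq_add_neg] using hf.linear_combination hm hf₀ 1 (-1)
    have hd := hgS.unitDeriv_top_linear_combination hm hf₀ 1 1
    simp only [one_mul, sub_add_cancel] at hd
    have h1 : lam n * l2NormSq (unitDeriv m (fun x => fhat n ω x - f₀ x)) ≤
        lam n * (K * (A / a ^ (2 * m))) := by
      have h2 := hle
      rw [sobolevNormSq] at h2
      have h3 := mul_le_mul_of_nonneg_left hbn.2.2.2 hK.le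
      linarith [l2NormSq_nonneg (fun x => fhat n ω x - f₀ x)]
    have h4 := le_of_mul_le_mul_left h1 hlp
    rw [show unitDeriv m (fhat n ω) = unitDeriv m (fun x => fhat n ω x) from rfl,
      l2NormSq_congr_ae hd]
    refine (l2NormSq_add_le (hgS.memLp le_rfl) (hf₀.memLp le_rfl)).trans ?_
    rw [hK₁]
    linarith
  obtain ⟨n₀, hn₀⟩ := eventually_atTop.1 hlarge
  -- The rate says nothing about the finitely many `n` below `n₀`; for each of them a measurable
  -- majorant gives a separate constant, and the sum `S` absorbs them all.
  have hsmall : ∀ n, ∃ k : ℝ, m ≤ n →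
      μ {ω | k < l2NormSq (unitDeriv m (fhat n ω))} ≤ ENNReal.ofReal δ := by
    intro n
    by_cases hnm : m ≤ n
    · obtain ⟨Z, hZ, hZle⟩ := exists_measurable_ge_l2NormSq hf₀ hρc hB (hlam_pos n)
        (X := fun i : Fin n => ε i) (fun i => hε_meas i) (hfhat n hnm)
      obtain ⟨k, hk⟩ := exists_measure_lt_le (μ := μ) hZ hδ
      exact ⟨k, fun _ => (measure_mono (Set.ofPred_subset_ofPred.2 fun ω hω =>
        hω.trans_le (hZle ω))).trans hk⟩
    · exact ⟨0, fun h => absurd h hnm⟩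
  choose k hk using hsmall
  set S := ∑ i ∈ Finset.range n₀, |k i| with hS
  have hS0 : 0 ≤ S := Finset.sum_nonneg fun i _ => abs_nonneg _
  refine ⟨Real.sqrt (K₁ + S + 1), Real.sqrt_pos.2 (by positivity), fun n hnm => ?_⟩
  have hmono : ∀ c, c ≤ K₁ + S + 1 →
      μ {ω | Real.sqrt (K₁ + S + 1) < Real.sqrt (l2NormSq (unitDeriv m (fhat n ω)))} ≤
        μ {ω | c < l2NormSq (unitDeriv m (fhat n ω))} := fun c hc =>
    measure_mono (Set.ofPred_subset_ofPred.2 fun ω hω =>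
      hc.trans_lt ((Real.sqrt_lt_sqrt_iff (by positivity)).1 hω))
  rcases lt_or_ge n n₀ with hlt | hge
  · have : k n ≤ S := (le_abs_self _).trans
      (Finset.single_le_sum (f := fun i => |k i|) (fun i _ => abs_nonneg _)
        (Finset.mem_range.2 hlt))
    exact (hmono (k n) (by linarith)).trans (hk n hnm)
  · exact (hmono K₁ (by linarith)).trans (hn₀ n hge hnm)

end BasicRate

end

/-! ### The main theorem -/

theorem corollary1
    {Ω : Type*} [MeasurableSpace Ω] (μ : Measure Ω) [IsProbabilityMeasure μ]
    (m : ℕ) (hm : 1 ≤ m)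
    -- the regression function, the design points and the i.i.d. errors
    (f₀ : ℝ → ℝ) (hf₀ : MemSobolev m f₀)
    (t : (n : ℕ) → Fin n → ℝ) (ht : ∀ n i, t n i ∈ Set.Icc (0 : ℝ) 1)
    (ε : ℕ → Ω → ℝ) (hε_meas : ∀ i, Measurable (ε i))
    (hε_indep : iIndepFun ε μ) (hε_ident : ∀ i, IdentDistrib (ε i) (ε 0) μ μ)
    -- (A1) convex loss and a choice of its subgradient
    (ρ ψ : ℝ → ℝ) (hρ : ConvexOn ℝ Set.univ ρ) (hψ : IsSubgradientSelection ρ ψ)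
    -- (A2) mean-square continuity at zero
    (hA2 : Tendsto
      (fun s : ℝ => ∫⁻ ω, ENNReal.ofReal ((ψ (ε 0 ω + s) - ψ (ε 0 ω)) ^ 2) ∂μ) (𝓝 0) (𝓝 0))
    -- (A3) second moment, centring and linear expansion at zero
    (hA3_sq : MemLp (fun ω => ψ (ε 0 ω)) 2 μ)
    (hA3_mean : ∫ ω, ψ (ε 0 ω) ∂μ = 0)
    (hA3_lin : ∃ ξ : ℝ, 0 < ξ ∧
      (fun s : ℝ => (∫ ω, ψ (ε 0 ω + s) ∂μ) - ξ * s) =o[𝓝 0] (fun s : ℝ => s))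
    -- (A4) quasi-uniform design
    (hA4 : IsQuasiUniform t)
    -- the smoothing parameter
    (lam : ℕ → ℝ) (hlam_pos : ∀ n, 0 < lam n)
    (hlam : lam =Θ[atTop] (fun n : ℕ => (n : ℝ) ^ (-(2 * (m : ℝ)) / (2 * (m : ℝ) + 1)))) :
    -- an M-type sequence with the basic rate exists
    (∃ fhat : ℕ → Ω → ℝ → ℝ,
      (∀ n, m ≤ n → ∀ ω,
        IsMTypeSpline m ρ (lam n) (t n) (fun i => f₀ (t n i) + ε i ω) (fhat n ω)) ∧
      IsBigOInProb μ (fun n ω => sobolevNormSq m (lam n) (fun x => fhat n ω x - f₀ x))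
        (fun n => lam n + ((n : ℝ) * lam n ^ (1 / (2 * (m : ℝ))))⁻¹)) ∧
    -- and every such sequence estimates the derivatives at the stated rates
    (∀ fhat : ℕ → Ω → ℝ → ℝ,
      (∀ n, m ≤ n → ∀ ω,
        IsMTypeSpline m ρ (lam n) (t n) (fun i => f₀ (t n i) + ε i ω) (fhat n ω)) →
      IsBigOInProb μ (fun n ω => sobolevNormSq m (lam n) (fun x => fhat n ω x - f₀ x))
        (fun n => lam n + ((n : ℝ) * lam n ^ (1 / (2 * (m : ℝ))))⁻¹) →
      (∀ j : ℕ, 1 ≤ j → j ≤ m - 1 →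
        IsBigOInProb μ
          (fun n ω => l2NormSq (fun x => unitDeriv j (fhat n ω) x - unitDeriv j f₀ x))
          (fun n => (n : ℝ) ^ (-(2 * ((m : ℝ) - (j : ℝ))) / (2 * (m : ℝ) + 1)))) ∧
      IsTightL2 μ m (fun n ω => unitDeriv m (fhat n ω))) := by
  obtain ⟨ξ, hξ, hlin⟩ := hA3_lin
  have hρc : Continuous ρ := continuousOn_univ.1 (hρ.continuousOn isOpen_univ)
  have hψm := hψ.measurable
  -- The moment conditions depend only on the common law of the errors and are transferred to it.
  set ν := μ.map (ε 0) with hν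
  have : IsProbabilityMeasure ν := Measure.isProbabilityMeasure_map (hε_meas 0).aemeasurable
  have hlin' : (fun s : ℝ => (∫ e, ψ (e + s) ∂ν) - ξ * s) =o[𝓝 0] (fun s : ℝ => s) := by
    refine hlin.congr_left fun s => ?_
    have hs : Measurable fun e => ψ (e + s) := by fun_prop
    rw [hν, integral_map (hε_meas 0).aemeasurable hs.aestronglyMeasurable]
  have hA2' : Tendsto (fun s : ℝ => ∫⁻ e, ENNReal.ofReal ((ψ (e + s) - ψ e) ^ 2) ∂ν)
      (𝓝 0) (𝓝 0) := by
    refine hA2.congr fun s => ?_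
    rw [hν, lintegral_map (by fun_prop) (hε_meas 0)]
  have hψ2 : MemLp ψ 2 ν :=
    (memLp_map_measure_iff hψm.aestronglyMeasurable (hε_meas 0).aemeasurable).2 hA3_sq
  have hψ0 : ∫ e, ψ e ∂ν = 0 := by
    rw [hν, integral_map (hε_meas 0).aemeasurable hψm.aestronglyMeasurable, hA3_mean]
  obtain ⟨hpos, hneg⟩ := exists_pos_and_exists_neg_of_expansion hξ hlin'
  obtain ⟨c, B, hc, hgrowth⟩ := hψ.exists_linear_growth hpos hneg
  refine ⟨?_, fun fhat hfhat hrate => ⟨fun j _ hj =>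
    isBigOInProb_l2NormSq_unitDeriv_sub hm hf₀ hlam_pos hlam (fun n hn ω => (hfhat n hn ω).1)
      hrate (by omega), isTightL2_unitDeriv hm hf₀ hε_meas hρc
        (fun x => le_trans (by have := mul_nonneg hc.le (abs_nonneg x); linarith) (hgrowth x))
        hlam_pos hlam hfhat hrate⟩⟩
  have hex : ∀ n ω, ∃ f, m ≤ n →
      IsMTypeSpline m ρ (lam n) (t n) (fun i => f₀ (t n i) + ε i ω) f := by
    intro n ω
    by_cases hn : m ≤ n
    · obtain ⟨f, hf⟩ := exists_isMTypeSpline hm hρc hc hgrowth (hlam_pos n) (hm.trans hn) (ht n)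
        (fun i => f₀ (t n i) + ε i ω)
      exact ⟨f, fun _ => hf⟩
    · exact ⟨f₀, fun h => absurd h hn⟩
  choose fhat hfhat using hex
  exact ⟨fhat, fun n hn ω => hfhat n ω hn,
    isBigOInProb_sobolevNormSq_sub hm hf₀ ht hε_meas hε_indep (fun i => (hε_ident i).map_eq) hρ hρc
      hψ hA2' hψ2 hψ0 hξ hlin' hA4 hlam_pos hlam fun n hn ω => hfhat n ω hn⟩
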